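/- **Notation.** Let $d\ge 2$, let $d\sigma$ be the surface measure on the unit sphere $\mathbb S^{d-1}\subset\mathbb R^d$ and $\nabla$ the intrinsic gradient on $\mathbb S^{d-1}$. For an angular kernel $\beta=\beta(\cos\theta)\ge 0$ on $\mathbb S^{d-1}$ let $$L_\beta f(k)=\int_{\mathbb S^{d-1}}[f(\sigma)-f(k)]\,\beta(k\cdot\sigma)\,d\sigma ,$$ and for a measure $\beta(d\theta)$ on $[0,\pi]$ let, on the circle $\mathbb S^1$ (with $R_\theta$ the rotation of angle $\theta$), $$L_\beta f(k)=\int_{[0,\pi]}\bigl[f(R_\theta k)+f(R_{-\theta}k)-2f(k)\bigr]\,\beta(d\theta).$$ Let $\Gamma_1(f,g)=\nabla f\cdot\nabla g$ and $$\Gamma_\beta(f)=\tfrac12\bigl(L_\beta(f^2)-2fL_\beta f\bigr),\qquad \Gamma_{1,\beta}(f)=\tfrac12\bigl(L_\beta\Gamma_1(f,f)-2\Gamma_1(f,L_\beta f)\bigr).$$ Fix $r\in\{1,2,\dots,\infty\}$ and set $$K_*(\beta)=\inf_F\ \frac{\displaystyle\int_{\mathbb S^{d-1}}F\,\Gamma_{1,\beta}(\log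 F)}{\displaystyle\int_{\mathbb S^{d-1}}\Gamma_\beta(\sqrt F)},$$ where $F$ ranges over the positive even functions of class $C^r$ on $\mathbb S^{d-1}$ (equivalently, positive $C^r$ functions on $\mathbb S^{d-1}/\{\pm I\}$) for which the denominator is nonzero. **Theorem.** (i) Let $d=2$ and $\beta(d\theta)=\sum_{i=0}^N\beta_i\,\delta_{i\pi/N}$ with $N\in\mathbb N$, $\beta_i\ge0$ and $\sum_{i=1}^{N-1}\beta_i>0$. Then $K_*(\beta)=0$; in particular, for no $K>0$ does the inequality $\int\Gamma_\beta(\sqrt F)\le\frac1K\int F\,\Gamma_{1,\beta}(\log F)$ hold for all positive even $F$ of class $C^r$ on $\mathbb S^1$. (ii) If $\beta$ is a positive constant, then $K_*(\beta)\ge 4d$, for every $d\ge2$. (iii) Let $d=2$ and let $\beta(\cos\theta)=\frac12\bigl[\sin(\theta/2)+\cos(\theta/2)\bigr]$, $0\le\theta\le\pi$, be the symmetrised angular kernel $\frac12[b(\cos\theta)+b(-\cos\theta)]$ of two-dimensional hard spheres, $b(\cos\theta)=\sin(\theta/2)$. Then $K_*(\beta)\ge4\sqrt2$. Moreover, the Fisher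 information $I(f)=\int_{\mathbb R^2}\frac{|\nabla f|^2}{f}\,dv\in[0,\infty]$ is nonincreasing along solutions of the two-dimensional spatially homogeneous Boltzmann equation for hard spheres, $$\partial_t f(t,v)=\int_{\mathbb R^2}\int_{\mathbb S^1}\bigl[f(t,v')f(t,v'_*)-f(t,v)f(t,v_*)\bigr]\,|v-v_*|\sin\tfrac\theta2\,d\sigma\,dv_*,$$ $$v'=\tfrac{v+v_*}2+\tfrac{|v-v_*|}2\sigma,\quad v'_*=\tfrac{v+v_*}2-\tfrac{|v-v_*|}2\sigma,\quad \cos\theta=\tfrac{v-v_*}{|v-v_*|}\cdot\sigma.$$ That is: if $T>0$ and $f\ge0$ satisfies this equation pointwise on $[0,T]\times\mathbb R^2$, is $C^2$ in $v$, and decays faster than any power of $|v|$, together with its velocity derivatives of order at most $2$, uniformly in $t\in[0,T]$, then $t\mapsto I(f(t,\cdot))$ is nonincreasing on $[0,T]$. -/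

import Mathlib

open MeasureTheory Set
open scoped ENNReal NNReal

noncomputable section

namespace KineticFisher

/-- The Euclidean space `ℝ^d`. -/
abbrev Vel (d : ℕ) : Type := EuclideanSpace ℝ (Fin d)

/-- The unit sphere `S^{d-1}` of `ℝ^d`. -/
abbrev Sph (d : ℕ) : Type := Metric.sphere (0 : Vel d) 1

/-- The (unnormalised) surface measure `dσ` on `S^{d-1}`. -/
def surf (d : ℕ) : Measure (Sph d) := (volume : Measure (Vel d)).toSphere

/-! ### Calculus on the sphere -/

theorem normalize_mem {d : ℕ} {x : Vel d} (hx : x ≠ 0) :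
    ‖x‖⁻¹ • x ∈ Metric.sphere (0 : Vel d) 1 := by
  have h : ‖x‖ ≠ 0 := norm_ne_zero_iff.mpr hx
  rw [mem_sphere_zero_iff_norm, norm_smul, norm_inv, norm_norm, inv_mul_cancel₀ h]

open Classical in
/-- The `0`-homogeneous extension `x ↦ f (x / |x|)` of a function on the sphere
(with the irrelevant value `0` at the origin). -/
def homExt {d : ℕ} (f : Sph d → ℝ) (x : Vel d) : ℝ :=
  if hx : x = 0 then 0 else f ⟨‖x‖⁻¹ • x, normalize_mem hx⟩

/-- `f` is of class `C^r` on the sphere: its `0`-homogeneous extension is of class `C^r`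
away from the origin. -/
def IsCkOnSphere {d : ℕ} (r : ℕ∞) (f : Sph d → ℝ) : Prop :=
  ContDiffOn ℝ (r : WithTop ℕ∞) (homExt f) {0}ᶜ

/-- The intrinsic gradient on the sphere, a vector of `k^⊥`: the usual gradient at `k` of the
`0`-homogeneous extension. -/
def sphGrad {d : ℕ} (f : Sph d → ℝ) (k : Sph d) : Vel d :=
  gradient (homExt f) (k : Vel d)

/-- `Γ₁(f, g) = ∇f · ∇g`, the carré du champ of the Laplace operator on the sphere. -/
def gammaOne {d : ℕ} (f g : Sph d → ℝ) (k : Sph d) : ℝ :=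
  inner ℝ (sphGrad f k) (sphGrad g k)

/-! ### Linear Boltzmann operators on the sphere -/

/-- `L_β f (k) = ∫_{S^{d-1}} [f(σ) - f(k)] β(k·σ) dσ`, for an angular kernel `β = β(cos θ)`. -/
def linBoltz {d : ℕ} (β : ℝ → ℝ) (f : Sph d → ℝ) (k : Sph d) : ℝ :=
  ∫ σ, (f σ - f k) * β (inner ℝ (k : Vel d) (σ : Vel d)) ∂(surf d)

theorem rot_mem (θ : ℝ) (k : Sph 2) :
    (!₂[Real.cos θ * (k : Vel 2) 0 - Real.sin θ * (k : Vel 2) 1,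
        Real.sin θ * (k : Vel 2) 0 + Real.cos θ * (k : Vel 2) 1] : Vel 2)
      ∈ Metric.sphere (0 : Vel 2) 1 := by
  have hk : ‖(k : Vel 2)‖ = 1 := mem_sphere_zero_iff_norm.mp k.2
  have h2 : (k : Vel 2) 0 ^ 2 + (k : Vel 2) 1 ^ 2 = 1 := by
    have h := EuclideanSpace.real_norm_sq_eq (k : Vel 2)
    rw [hk, Fin.sum_univ_two] at h
    linarith
  rw [mem_sphere_zero_iff_norm, ← sq_eq_sq₀ (norm_nonneg _) zero_le_one,
    EuclideanSpace.real_norm_sq_eq, Fin.sum_univ_two]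
  simp only [Matrix.cons_val_zero, Matrix.cons_val_one]
  linear_combination ((k : Vel 2) 0 ^ 2 + (k : Vel 2) 1 ^ 2) * Real.sin_sq_add_cos_sq θ + h2

/-- The rotation of angle `θ` on the circle `S^1`. -/
def rot (θ : ℝ) (k : Sph 2) : Sph 2 :=
  ⟨!₂[Real.cos θ * (k : Vel 2) 0 - Real.sin θ * (k : Vel 2) 1,
      Real.sin θ * (k : Vel 2) 0 + Real.cos θ * (k : Vel 2) 1], rot_mem θ k⟩

/-- The linear Boltzmann operator on `S^1` associated with a measure `β(dθ)` on `[0, π]`: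
`L_β f (k) = ∫_{[0,π]} ∑_φ [f(exp_k (θ φ)) - f(k)] β(dθ)`, where `φ` runs over the two unit
vectors tangent to `S^1` at `k`. For `β(dθ) = b(cos θ) dθ` this is `linBoltz b`. -/
def linBoltzAngular (β : Measure ℝ) (f : Sph 2 → ℝ) (k : Sph 2) : ℝ :=
  ∫ θ in Icc 0 Real.pi, ((f (rot θ k) - f k) + (f (rot (-θ) k) - f k)) ∂β

/-- The measure `∑_{i=0}^N b_i δ_{iπ/N}`. -/
def angularSum (N : ℕ) (b : ℕ → ℝ≥0) : Measure ℝ :=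
  ∑ i ∈ Finset.range (N + 1), b i • Measure.dirac ((i : ℝ) * Real.pi / (N : ℝ))

/-! ### Gamma commutators, for an operator `L` acting on functions on the sphere -/

/-- `Γ_β(f, f) = (L_β (f²) - 2 f L_β f) / 2`, for `L = L_β`. -/
def gammaB {d : ℕ} (L : (Sph d → ℝ) → Sph d → ℝ) (f : Sph d → ℝ) (k : Sph d) : ℝ :=
  (L (fun σ => f σ ^ 2) k - 2 * (f k * L f k)) / 2

/-- `Γ_{1,β}(f, f) = (L_β Γ₁(f, f) - 2 Γ₁(f, L_β f)) / 2`, for `L = L_β`. -/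
def gammaOneB {d : ℕ} (L : (Sph d → ℝ) → Sph d → ℝ) (f : Sph d → ℝ) (k : Sph d) : ℝ :=
  (L (gammaOne f f) k - 2 * gammaOne f (L f) k) / 2

/-- `∫_{S^{d-1}} F Γ_{1,β}(log F)`. -/
def critNum {d : ℕ} (L : (Sph d → ℝ) → Sph d → ℝ) (F : Sph d → ℝ) : ℝ :=
  ∫ k, F k * gammaOneB L (fun σ => Real.log (F σ)) k ∂(surf d)

/-- `∫_{S^{d-1}} Γ_β(√F)`. -/
def critDen {d : ℕ} (L : (Sph d → ℝ) → Sph d → ℝ) (F : Sph d → ℝ) : ℝ :=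
  ∫ k, gammaB L (fun σ => Real.sqrt (F σ)) k ∂(surf d)

/-- Positive even functions of class `C^r` on the sphere `S^{d-1}`, that is, positive functions
of class `C^r` on the projective space `S^{d-1}/{±I}`. -/
structure IsEvenDensity {d : ℕ} (r : ℕ∞) (F : Sph d → ℝ) : Prop where
  pos : ∀ σ, 0 < F σ
  even : ∀ σ, F (-σ) = F σ
  regular : IsCkOnSphere r F

/-- The infimum of `∫ F Γ_{1,β}(log F) / ∫ Γ_β(√F)` over positive even functions `F` of class
`C^r` for which the quotient makes sense. It is taken in the extended reals. -/
def critInf {d : ℕ} (L : (Sph d → ℝ) → Sph d → ℝ) (r : ℕ∞) : EReal :=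
  sInf {q : EReal | ∃ F : Sph d → ℝ, IsEvenDensity r F ∧ critDen L F ≠ 0 ∧
    q = ((critNum L F / critDen L F : ℝ) : EReal)}

/-! ### Hard spheres in dimension two -/

/-- The angular part `b(cos θ) = sin (θ/2)` of the two-dimensional hard spheres kernel. -/
def hsAngular (s : ℝ) : ℝ := Real.sin (Real.arccos s / 2)

/-- The symmetrised angular kernel `[b(cos θ) + b(-cos θ)] / 2`. -/
def hsSym (s : ℝ) : ℝ := (hsAngular s + hsAngular (-s)) / 2

/-- The two-dimensional hard spheres collision kernel `B(z, σ) = |z| sin (θ/2)`, where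
`cos θ = (z/|z|)·σ`. -/
def hsKernel (z : Vel 2) (σ : Sph 2) : ℝ :=
  ‖z‖ * hsAngular (inner ℝ (‖z‖⁻¹ • z) (σ : Vel 2))

/-! ### The spatially homogeneous Boltzmann equation and the Fisher information -/

/-- `v' = (v + v_*)/2 + (|v - v_*|/2) σ`. -/
def postV {d : ℕ} (v w : Vel d) (σ : Sph d) : Vel d :=
  (2 : ℝ)⁻¹ • (v + w) + (‖v - w‖ / 2) • (σ : Vel d)

/-- `v'_* = (v + v_*)/2 - (|v - v_*|/2) σ`. -/
def postW {d : ℕ} (v w : Vel d) (σ : Sph d) : Vel d :=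
  (2 : ℝ)⁻¹ • (v + w) - (‖v - w‖ / 2) • (σ : Vel d)

/-- The Boltzmann collision operator
`Q(f,f)(v) = ∫∫ [f(v') f(v'_*) - f(v) f(v_*)] B(v - v_*, σ) dσ dv_*`. -/
def collision {d : ℕ} (B : Vel d → Sph d → ℝ) (f : Vel d → ℝ) (v : Vel d) : ℝ :=
  ∫ w, ∫ σ, (f (postV v w σ) * f (postW v w σ) - f v * f w) * B (v - w) σ ∂(surf d)

/-- `f` is a classical solution on the time interval `[0, T]` of the spatially homogeneous
Boltzmann equation `∂_t f = Q(f, f)` with kernel `B`: it is nonnegative, twice continuously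
differentiable in velocity, decays rapidly together with its velocity derivatives up to
order two (uniformly in time), and satisfies the equation pointwise. -/
structure IsBoltzmannSolution {d : ℕ} (B : Vel d → Sph d → ℝ) (T : ℝ)
    (f : ℝ → Vel d → ℝ) : Prop where
  nonneg : ∀ t ∈ Icc 0 T, ∀ v, 0 ≤ f t v
  contDiff : ∀ t ∈ Icc 0 T, ContDiff ℝ 2 (f t)
  decay : ∀ p j : ℕ, j ≤ 2 → ∃ C : ℝ, ∀ t ∈ Icc 0 T, ∀ v,
    ‖v‖ ^ p * ‖iteratedFDeriv ℝ j (f t) v‖ ≤ C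
  equation : ∀ t ∈ Icc 0 T, ∀ v,
    HasDerivWithinAt (fun s => f s v) (collision B (f t) v) (Icc 0 T) t

/-- The Fisher information `I(f) = ∫ |∇f|²/f dv`, with values in `[0, ∞]`. (For a nonnegative
differentiable `f`, the gradient vanishes where `f` does, and the integrand is `0` there.) -/
def fisherInfo {d : ℕ} (f : Vel d → ℝ) : ℝ≥0∞ :=
  ∫⁻ v, ENNReal.ofReal (‖gradient f v‖ ^ 2 / f v)

end KineticFisher

end

open KineticFisher

/-!
The four assertions rest on different ideas.

*Finitely supported angular measures.* On the circle the rotations commute with the derivative, so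
`Γ_{1,β}(f)(k)` is half the `β`-average of the squared increments of `f'` along the jumps. A density
of the form (function invariant under the jumps) × (step), where the step is constant wherever the
invariant function does not vanish, has a logarithmic derivative which is invariant under the jumps
on the support of the density, while the density itself is not invariant. The invariant function is
a cutoff of `cos (2 N x)`, the Chebyshev polynomial `T_N` at `cos (2 x)`; adding to it a
constant `δ > 0` makes the density positive, the numerator equal to a multiple of `δ`, and keeps the
denominator away from zero (`exists_degenerate_densities`). Hence the infimum vanishes
(`critInf_angularSum`).

*Constant kernels.* If `β` is constant, both integrals are explicit: the denominator is a multiple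
of the variance of `√F`, and the numerator is at least the corresponding multiple of
`2 ∫ |∇ √F|²`. The bound `4 d` is then twice the constant `2 d` of the Poincaré inequality for even
functions on the sphere (`sphere_poincare_even`). Without spherical harmonics, the latter is the
Gaussian Poincaré inequality for even functions, with the constant `2` of the second Hermite
polynomials (`gaussian_poincare_even`), applied to `|x|² f(x/|x|)`. In turn, the Gaussian inequality
follows from a one-dimensional inequality for `π`-periodic functions
(`integral_sq_quarter_increment_le`): for independent Gaussian vectors `x` and `y` the process
`s ↦ u (cos s x + sin s y)` is `π`-periodic and stationary.

*The criterion for hard spheres.* In dimension two the numerator and the denominator are both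
increasing in the kernel, and the symmetrised kernel lies between `1/2` and `√2/2`. The bound
`4 d = 8` for constant kernels therefore yields `8 / √2 = 4 √2` (`le_critInf_hsSym`).

*Monotonicity of the Fisher information.* A solution may vanish, and it is differentiated in time
only through the equation, so `f` is replaced by `f + ε wt`, where `wt` is a fixed positive weight
of polynomial decay. The Fisher information is convex: the difference of its values at two densities
is at most its derivative at the first one applied to the difference of the densities
(`regFisher_sub_le`). Only the time derivative of `f` itself, given by the equation, is needed, and
the left difference quotients are bounded by the integral of `Φ · Q(f, f)`, where
`Φ = -2 Δ log f - |∇ log f|²` is taken at the regularised density.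

An integration by parts (`integral_fisherDeriv_mul_collision`) turns this integral into one over
pairs of velocities and collision angles. After exchanging the particles, then the collisions with
their inverses, then the angle with its opposite, it is at most half the integral of `revFlux`
against the symmetrised kernel (`SymPair.integral_angular_fisherFlux_le`). The collisions of a pair
describe a circle, along which a square can be completed in the component of the gradients parallel
to the relative velocity. What remains involves, on that circle, only `√(f f_*)` and the tangential
derivative of `log (f f_*)`, and is nonpositive by a one-dimensional inequality for `π`-periodic
functions (`integral_circle_le`).

The collision operator is that of `f`, not of `f + ε wt`; the discrepancy is a multiple of `regErr`,
which tends to zero with `ε`. The mean value inequality in reversed time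
(`regFisher_sub_le_integral`) and the limit `ε → 0` conclude (`antitoneOn_fisherInfo`).
-/

noncomputable section

namespace KineticFisher

/-! ### Polar coordinates and rotations of the plane -/

theorem homExt_of_ne_zero {d : ℕ} (f : Sph d → ℝ) {x : Vel d} (hx : x ≠ 0) :
    homExt f x = f ⟨‖x‖⁻¹ • x, normalize_mem hx⟩ := by
  simp [homExt, hx]

theorem norm_sph {d : ℕ} (k : Sph d) : ‖(k : Vel d)‖ = 1 := mem_sphere_zero_iff_norm.mp k.2

theorem sph_ne_zero {d : ℕ} (k : Sph d) : (k : Vel d) ≠ 0 := by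
  intro h
  have := norm_sph k
  simp [h] at this

theorem homExt_coe {d : ℕ} (f : Sph d → ℝ) (k : Sph d) : homExt f (k : Vel d) = f k := by
  rw [homExt_of_ne_zero f (sph_ne_zero k)]
  congr 1
  ext1
  simp [norm_sph k]

theorem homExt_smul {d : ℕ} (f : Sph d → ℝ) {r : ℝ} (hr : 0 < r) (x : Vel d) :
    homExt f (r • x) = homExt f x := by
  by_cases hx : x = 0
  · simp [hx]
  · rw [homExt_of_ne_zero f hx, homExt_of_ne_zero f (smul_ne_zero hr.ne' hx)]
    congr 2
    rw [norm_smul, Real.norm_of_nonneg hr.le, mul_inv, smul_smul]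
    congr 1
    field_simp

/-- Integration in polar coordinates of a product of a radial and an angular function. No
integrability is needed, since both sides follow the same convention. -/
theorem integral_radial_mul_homExt {d : ℕ} (hd : 1 ≤ d) (ψ : ℝ → ℝ) (φ : Sph d → ℝ) :
    ∫ x : Vel d, ψ ‖x‖ * homExt φ x
      = (∫ σ, φ σ ∂(surf d)) * ∫ r in Ioi (0 : ℝ), r ^ (d - 1) * ψ r := by
  have hdim : Module.finrank ℝ (Vel d) = d := by simp
  have : Nontrivial (Vel d) := Module.nontrivial_of_finrank_pos (R := ℝ) (by omega)
  set μ : Measure (Vel d) := volume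
  calc
    ∫ x : Vel d, ψ ‖x‖ * homExt φ x
        = ∫ x : ({(0)}ᶜ : Set (Vel d)), ψ ‖x.1‖ * homExt φ x.1 ∂(μ.comap (↑)) := by
      rw [integral_subtype_comap (measurableSet_singleton _).compl
        fun x ↦ ψ ‖x‖ * homExt φ x, restrict_compl_singleton]
    _ = ∫ x : Sph d × Ioi (0 : ℝ), φ x.1 * ψ x.2
          ∂μ.toSphere.prod (.volumeIoiPow (Module.finrank ℝ (Vel d) - 1)) := by
      rw [← μ.measurePreserving_homeomorphUnitSphereProd.integral_comp
        (Homeomorph.measurableEmbedding _)]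
      refine integral_congr_ae (Filter.Eventually.of_forall fun x => ?_)
      have hx : (x : Vel d) ≠ 0 := x.2
      simp only [homExt_of_ne_zero φ hx, homeomorphUnitSphereProd_apply_snd_coe]
      rw [mul_comm]
      congr 2
      ext1
      simp [homeomorphUnitSphereProd]
    _ = (∫ σ, φ σ ∂(surf d)) *
          ∫ r : Ioi (0 : ℝ), ψ r ∂.volumeIoiPow (Module.finrank ℝ (Vel d) - 1) :=
      integral_prod_mul (fun σ => φ σ) (fun r : Ioi (0 : ℝ) => ψ r)
    _ = _ := by
      rw [hdim]
      simp only [Measure.volumeIoiPow, ENNReal.ofReal]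
      rw [integral_withDensity_eq_integral_smul,
        integral_subtype_comap measurableSet_Ioi fun a ↦ Real.toNNReal (a ^ (d - 1)) • ψ a,
        setIntegral_congr_fun measurableSet_Ioi fun x hx ↦ ?_]
      · rw [NNReal.smul_def, Real.coe_toNNReal _ (pow_nonneg hx.out.le _), smul_eq_mul]
      · exact (measurable_subtype_coe.pow_const _).real_toNNReal

/-- The rotation of angle `π / 2` of the plane. -/
def quarter : Vel 2 →L[ℝ] Vel 2 :=
  LinearMap.toContinuousLinearMap
    { toFun := fun v => !₂[-(v 1), v 0]
      map_add' := fun v w => by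
        ext i; fin_cases i <;> simp [add_comm]
      map_smul' := fun c v => by
        ext i; fin_cases i <;> simp }

@[simp] theorem quarter_zero_apply (v : Vel 2) : quarter v 0 = -(v 1) := by simp [quarter]

@[simp] theorem quarter_one_apply (v : Vel 2) : quarter v 1 = v 0 := by simp [quarter]

theorem inner_two (v w : Vel 2) : inner ℝ v w = v 0 * w 0 + v 1 * w 1 := by
  simp [PiLp.inner_apply, Fin.sum_univ_two, mul_comm]

theorem norm_sq_two (v : Vel 2) : ‖v‖ ^ 2 = v 0 ^ 2 + v 1 ^ 2 := by
  rw [EuclideanSpace.real_norm_sq_eq, Fin.sum_univ_two]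

theorem ext_two {v w : Vel 2} (h0 : v 0 = w 0) (h1 : v 1 = w 1) : v = w := by
  ext i; fin_cases i <;> assumption

theorem quarter_quarter (v : Vel 2) : quarter (quarter v) = -v :=
  ext_two (by simp) (by simp)

@[simp] theorem inner_quarter_self (v : Vel 2) : inner ℝ v (quarter v) = 0 := by
  rw [inner_two]; simp; ring

theorem inner_quarter_quarter (v w : Vel 2) :
    inner ℝ (quarter v) (quarter w) = inner ℝ v w := by
  rw [inner_two, inner_two]; simp; ring

/-- Decomposition of the norm along an orthogonal frame of the plane. -/
theorem norm_sq_mul_norm_sq (n x : Vel 2) :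
    ‖n‖ ^ 2 * ‖x‖ ^ 2 = inner ℝ n x ^ 2 + inner ℝ (quarter n) x ^ 2 := by
  rw [norm_sq_two, norm_sq_two, inner_two, inner_two]; simp; ring

/-- The rotation of angle `θ` of the plane. -/
def planeRot (θ : ℝ) : Vel 2 →L[ℝ] Vel 2 :=
  Real.cos θ • ContinuousLinearMap.id ℝ (Vel 2) + Real.sin θ • quarter

theorem planeRot_apply (θ : ℝ) (v : Vel 2) :
    planeRot θ v = Real.cos θ • v + Real.sin θ • quarter v := by
  simp [planeRot]

@[simp] theorem planeRot_zero (v : Vel 2) : planeRot 0 v = v := by simp [planeRot_apply]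

theorem planeRot_pi (v : Vel 2) : planeRot Real.pi v = -v := by simp [planeRot_apply]

theorem planeRot_add (a b : ℝ) (v : Vel 2) :
    planeRot (a + b) v = planeRot a (planeRot b v) := by
  refine ext_two ?_ ?_ <;> simp [planeRot_apply, Real.cos_add, Real.sin_add] <;> ring

theorem quarter_planeRot (a : ℝ) (v : Vel 2) : quarter (planeRot a v) = planeRot a (quarter v) := by
  refine ext_two ?_ ?_ <;> simp [planeRot_apply]

theorem inner_planeRot_left (a : ℝ) (v w : Vel 2) :
    inner ℝ (planeRot a v) w = inner ℝ v (planeRot (-a) w) := by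
  rw [inner_two, inner_two]
  simp [planeRot_apply]
  ring

@[simp] theorem planeRot_neg_planeRot (a : ℝ) (v : Vel 2) : planeRot (-a) (planeRot a v) = v := by
  rw [← planeRot_add]; simp

@[simp] theorem planeRot_planeRot_neg (a : ℝ) (v : Vel 2) : planeRot a (planeRot (-a) v) = v := by
  rw [← planeRot_add]; simp

theorem inner_planeRot_planeRot (a : ℝ) (v w : Vel 2) :
    inner ℝ (planeRot a v) (planeRot a w) = inner ℝ v w := by
  rw [inner_planeRot_left, planeRot_neg_planeRot]

@[simp] theorem norm_planeRot (a : ℝ) (v : Vel 2) : ‖planeRot a v‖ = ‖v‖ := by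
  rw [← sq_eq_sq₀ (norm_nonneg _) (norm_nonneg _), ← real_inner_self_eq_norm_sq,
    inner_planeRot_planeRot, real_inner_self_eq_norm_sq]

theorem coe_rot (a : ℝ) (k : Sph 2) : (rot a k : Vel 2) = planeRot a k := by
  refine ext_two ?_ ?_ <;> simp [rot, planeRot_apply] <;> ring

theorem rot_add (a b : ℝ) (k : Sph 2) : rot (a + b) k = rot a (rot b k) := by
  ext1; simp [coe_rot, planeRot_add]

@[simp] theorem rot_zero (k : Sph 2) : rot 0 k = k := by ext1; simp [coe_rot]

theorem inner_rot (a : ℝ) (k : Sph 2) : inner ℝ (k : Vel 2) (rot a k : Vel 2) = Real.cos a := by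
  rw [coe_rot, planeRot_apply, inner_add_right, inner_smul_right, inner_smul_right,
    inner_quarter_self, real_inner_self_eq_norm_sq, norm_sph]
  simp

theorem continuous_rot_comp {X : Type*} [TopologicalSpace X] {a : X → ℝ} {k : X → Sph 2}
    (ha : Continuous a) (hk : Continuous k) : Continuous fun x => rot (a x) (k x) := by
  rw [continuous_induced_rng]
  have h : (Subtype.val ∘ fun x => rot (a x) (k x)) = fun x => planeRot (a x) (k x) := by
    funext x
    exact coe_rot _ _
  rw [h]
  have hk' : Continuous fun x => (k x : Vel 2) := continuous_subtype_val.comp hk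
  simp only [planeRot_apply]
  fun_prop

theorem continuous_rot : Continuous fun p : ℝ × Sph 2 => rot p.1 p.2 :=
  continuous_rot_comp continuous_fst continuous_snd

theorem continuous_rot_left (k : Sph 2) : Continuous fun a : ℝ => rot a k :=
  continuous_rot_comp continuous_id continuous_const

theorem continuous_rot_right (a : ℝ) : Continuous (rot a) :=
  continuous_rot_comp continuous_const continuous_id

/-- The rotation of angle `θ` as a linear isometric equivalence. -/
def planeRotEquiv (θ : ℝ) : Vel 2 ≃ₗᵢ[ℝ] Vel 2 where
  toFun := planeRot θ
  invFun := planeRot (-θ)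
  left_inv v := by simp
  right_inv v := by simp
  map_add' := map_add _
  map_smul' := map_smul _
  norm_map' v := norm_planeRot θ v

theorem homExt_planeRot (φ : Sph 2 → ℝ) (a : ℝ) (x : Vel 2) :
    homExt (fun k => φ (rot a k)) x = homExt φ (planeRot a x) := by
  by_cases hx : x = 0
  · simp [homExt, hx]
  · have hx' : planeRot a x ≠ 0 := by
      rw [← norm_ne_zero_iff, norm_planeRot]; exact norm_ne_zero_iff.mpr hx
    rw [homExt_of_ne_zero _ hx, homExt_of_ne_zero _ hx']
    congr 1
    ext1
    simp [coe_rot]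

theorem radial_moment_pos :
    0 < ∫ r in Ioi (0 : ℝ), r ^ (2 - 1) * Real.exp (-(r ^ 2)) := by
  have : ∫ r in Ioi (0 : ℝ), r ^ (2 - 1) * Real.exp (-(r ^ 2)) = 1 / 2 := by
    have h := integral_rpow_mul_exp_neg_rpow (p := 2) (q := 1) (by norm_num) (by norm_num)
    norm_num at h
    simpa using h
  rw [this]; norm_num

/-- The surface measure of the circle is invariant under rotations. -/
theorem integral_comp_rot (φ : Sph 2 → ℝ) (a : ℝ) :
    ∫ k, φ (rot a k) ∂(surf 2) = ∫ k, φ k ∂(surf 2) := by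
  have h1 := integral_radial_mul_homExt (d := 2) (by norm_num) (fun r => Real.exp (-(r ^ 2))) φ
  have h2 := integral_radial_mul_homExt (d := 2) (by norm_num) (fun r => Real.exp (-(r ^ 2)))
    (fun k => φ (rot a k))
  have h3 : ∫ x : Vel 2, Real.exp (-(‖x‖ ^ 2)) * homExt (fun k => φ (rot a k)) x
      = ∫ x : Vel 2, Real.exp (-(‖x‖ ^ 2)) * homExt φ x := by
    rw [← (planeRotEquiv a).measurePreserving.integral_comp
      (planeRotEquiv a).toHomeomorph.measurableEmbedding
      (fun x => Real.exp (-(‖x‖ ^ 2)) * homExt φ x)]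
    refine integral_congr_ae (Filter.Eventually.of_forall fun x => ?_)
    simp only [LinearIsometryEquiv.norm_map]
    exact congrArg _ (homExt_planeRot φ a x)
  rw [h1, h2] at h3
  exact mul_right_cancel₀ radial_moment_pos.ne' h3

instance instFiniteSurf {d : ℕ} : IsFiniteMeasure (surf d) := by unfold surf; infer_instance

theorem surf_real_univ_two : (surf 2).real univ = 2 * Real.pi := by
  unfold surf
  rw [Measure.toSphere_real_apply_univ]
  simp [Measure.real, EuclideanSpace.volume_ball_fin_two, Real.pi_pos.le]

theorem exists_rot_eq (k σ : Sph 2) : ∃ a : ℝ, rot a k = σ := by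
  have hk := norm_sq_two (k : Vel 2)
  have hs := norm_sq_two (σ : Vel 2)
  rw [norm_sph] at hk hs
  set c := inner ℝ (k : Vel 2) (σ : Vel 2) with hc
  set s := inner ℝ (quarter k) (σ : Vel 2) with hs'
  have hcs : c ^ 2 + s ^ 2 = 1 := by
    rw [hc, hs', ← norm_sq_mul_norm_sq, norm_sph, norm_sph]; norm_num
  rw [inner_two] at hc hs'
  have hz : ‖(⟨c, s⟩ : ℂ)‖ = 1 := by
    rw [← sq_eq_sq₀ (norm_nonneg _) zero_le_one, Complex.sq_norm, Complex.normSq_apply]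
    simp; linarith
  refine ⟨Complex.arg ⟨c, s⟩, ?_⟩
  have hne : (⟨c, s⟩ : ℂ) ≠ 0 := by rw [← norm_ne_zero_iff, hz]; norm_num
  have h1 : Real.cos (Complex.arg ⟨c, s⟩) = c := by rw [Complex.cos_arg hne, hz]; simp
  have h2 : Real.sin (Complex.arg ⟨c, s⟩) = s := by rw [Complex.sin_arg, hz]; simp
  ext1
  rw [coe_rot, planeRot_apply, h1, h2, hc, hs']
  refine ext_two ?_ ?_ <;> simp
  · linear_combination (-(σ : Vel 2) 0) * hk
  · linear_combination (-(σ : Vel 2) 1) * hk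

theorem rot_two_pi_periodic (k : Sph 2) : Function.Periodic (fun a => rot a k) (2 * Real.pi) := by
  intro a
  ext1
  simp [coe_rot, planeRot_apply]

theorem integrable_surf_of_continuous {d : ℕ} {φ : Sph d → ℝ} (hφ : Continuous φ) :
    Integrable φ (surf d) :=
  hφ.integrable_of_hasCompactSupport (HasCompactSupport.of_compactSpace φ)

/-- Integration over the circle in the angular coordinate based at an arbitrary point. -/
theorem integral_surf_two {φ : Sph 2 → ℝ} (hφ : Continuous φ) (k : Sph 2) :
    ∫ σ, φ σ ∂(surf 2) = ∫ a in (-Real.pi)..Real.pi, φ (rot a k) := by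
  have hpi := Real.pi_pos
  -- averaging over rotations first, the inner integral does not depend on the base point
  have h1 : ∀ σ : Sph 2, ∫ a in (-Real.pi)..Real.pi, φ (rot a σ)
      = ∫ a in (-Real.pi)..Real.pi, φ (rot a k) := by
    intro σ
    obtain ⟨b, rfl⟩ := exists_rot_eq k σ
    simp_rw [← rot_add]
    rw [intervalIntegral.integral_comp_add_right (fun a => φ (rot a k))]
    have hper : Function.Periodic (fun a => φ (rot a k)) (2 * Real.pi) := fun a => by
      simp only [rot_two_pi_periodic k a]
    have := hper.intervalIntegral_add_eq (-Real.pi + b) (-Real.pi)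
    convert this using 2 <;> ring
  have h2 : ∫ a in (-Real.pi)..Real.pi, (∫ σ, φ (rot a σ) ∂(surf 2))
      = ∫ σ, (∫ a in (-Real.pi)..Real.pi, φ (rot a σ)) ∂(surf 2) := by
    rw [intervalIntegral.integral_of_le (by linarith)]
    simp_rw [intervalIntegral.integral_of_le (show -Real.pi ≤ Real.pi by linarith)]
    refine integral_integral_swap (f := fun a σ => φ (rot a σ)) ?_
    obtain ⟨C, hC⟩ := (isCompact_range hφ).isBounded.exists_norm_le
    refine Integrable.of_bound (C := C) ?_ (Filter.Eventually.of_forall fun p => ?_)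
    · exact (hφ.comp continuous_rot).aestronglyMeasurable
    · exact hC _ ⟨_, rfl⟩
  simp_rw [h1, integral_comp_rot] at h2
  rw [intervalIntegral.integral_const, integral_const, surf_real_univ_two, smul_eq_mul,
    smul_eq_mul] at h2
  have : Real.pi - -Real.pi = 2 * Real.pi := by ring
  rw [this] at h2
  exact mul_left_cancel₀ (by positivity) h2

/-! ### Calculus on the circle -/

/-- `f'` is the derivative of `f` along the circle, in the positive direction. -/
def HasTanDeriv (f f' : Sph 2 → ℝ) : Prop :=
  ∀ k, HasDerivAt (fun t => f (rot t k)) (f' k) 0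

theorem HasTanDeriv.hasDerivAt {f f' : Sph 2 → ℝ} (h : HasTanDeriv f f') (k : Sph 2) (s : ℝ) :
    HasDerivAt (fun t => f (rot t k)) (f' (rot s k)) s := by
  have h1 : HasDerivAt (fun t => f (rot t (rot s k))) (f' (rot s k)) (s - s) := by
    rw [sub_self]; exact h (rot s k)
  refine (h1.comp_sub_const s s).congr_of_eventuallyEq (Filter.Eventually.of_forall fun t => ?_)
  show f (rot t k) = f (rot (t - s) (rot s k))
  rw [← rot_add, sub_add_cancel]

/-- The tangential derivative determines the gradient of the homogeneous extension: near `k`,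
the direction of `x` is the rotation of `k` by the angle `arctan (⟪Jk, x⟫ / ⟪k, x⟫)`. -/
theorem hasGradientAt_homExt {f : Sph 2 → ℝ} {k : Sph 2} {a : ℝ}
    (h : HasDerivAt (fun t => f (rot t k)) a 0) :
    HasGradientAt (homExt f) (a • quarter k) (k : Vel 2) := by
  set kv : Vel 2 := (k : Vel 2) with hkv
  have hn : ‖kv‖ = 1 := norm_sph k
  have hkk : inner ℝ kv kv = 1 := by rw [real_inner_self_eq_norm_sq, norm_sph]; norm_num
  have hJk : inner ℝ (quarter kv) kv = 0 := by rw [real_inner_comm]; exact inner_quarter_self kv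
  have hnum : HasFDerivAt (fun x : Vel 2 => inner ℝ (quarter kv) x)
      (innerSL ℝ (quarter kv)) kv := (innerSL ℝ (quarter kv)).hasFDerivAt
  have hden : HasFDerivAt (fun x : Vel 2 => (inner ℝ kv x)⁻¹)
      (-(1 : ℝ) • innerSL ℝ kv) kv := by
    have h0 : HasFDerivAt (fun x : Vel 2 => inner ℝ kv x) (innerSL ℝ kv) kv :=
      (innerSL ℝ kv).hasFDerivAt
    have h1 := (hasDerivAt_inv (x := inner ℝ kv kv) (by rw [hkk]; norm_num)).comp_hasFDerivAt kv h0
    simpa [hn, Function.comp_def] using h1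
  have hang : HasFDerivAt (fun x : Vel 2 => Real.arctan (inner ℝ (quarter kv) x * (inner ℝ kv x)⁻¹))
      (innerSL ℝ (quarter kv)) kv := by
    have h2 := (hnum.mul hden).arctan
    simpa [hn, hJk] using h2
  have hcomp : HasFDerivAt
      (fun x : Vel 2 => f (rot (Real.arctan (inner ℝ (quarter kv) x * (inner ℝ kv x)⁻¹)) k))
      (a • innerSL ℝ (quarter kv)) kv := by
    have h3 : HasDerivAt (fun t => f (rot t k)) a
        (Real.arctan (inner ℝ (quarter kv) kv * (inner ℝ kv kv)⁻¹)) := by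
      simpa [hJk] using h
    exact h3.comp_hasFDerivAt kv hang
  rw [hasGradientAt_iff_hasFDerivAt]
  have heq : (InnerProductSpace.toDual ℝ (Vel 2)) (a • quarter kv) = a • innerSL ℝ (quarter kv) := by
    ext x; simp
  rw [heq]
  refine hcomp.congr_of_eventuallyEq ?_
  have hev : ∀ᶠ x : Vel 2 in nhds kv, 0 < inner ℝ kv x := by
    have hc : Continuous fun x : Vel 2 => inner ℝ kv x := by fun_prop
    exact hc.continuousAt.eventually (lt_mem_nhds (by simp only [hkk]; norm_num))
  filter_upwards [hev] with x hx
  set c := inner ℝ kv x with hc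
  set s := inner ℝ (quarter kv) x with hs
  set θ := Real.arctan (s * c⁻¹) with hθ
  have hcos : 0 < Real.cos θ := Real.cos_arctan_pos _
  have hsin : Real.sin θ = s * c⁻¹ * Real.cos θ := by
    have := Real.tan_arctan (s * c⁻¹)
    rw [← hθ, Real.tan_eq_sin_div_cos] at this
    field_simp at this
    field_simp
    linarith
  have hk2 := norm_sq_two kv
  rw [norm_sph] at hk2
  have hx' : x = (c / Real.cos θ) • (rot θ k : Vel 2) := by
    rw [coe_rot, planeRot_apply, hsin, smul_add, smul_smul, smul_smul]
    have e1 : c / Real.cos θ * Real.cos θ = c := by field_simp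
    have e2 : c / Real.cos θ * (s * c⁻¹ * Real.cos θ) = s := by field_simp
    rw [e1, e2, ← hkv, hc, hs, inner_two, inner_two]
    refine ext_two ?_ ?_ <;> simp
    · linear_combination (x 0) * hk2
    · linear_combination (x 1) * hk2
  conv_lhs => rw [hx']
  rw [homExt_smul f (by positivity), homExt_coe]

theorem HasTanDeriv.sphGrad_eq {f f' : Sph 2 → ℝ} (h : HasTanDeriv f f') (k : Sph 2) :
    sphGrad f k = f' k • quarter k :=
  (hasGradientAt_homExt (h k)).gradient

theorem HasTanDeriv.gammaOne_eq {f f' g g' : Sph 2 → ℝ} (hf : HasTanDeriv f f')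
    (hg : HasTanDeriv g g') : gammaOne f g = fun k => f' k * g' k := by
  funext k
  rw [gammaOne, hf.sphGrad_eq, hg.sphGrad_eq, inner_smul_left, inner_smul_right,
    inner_quarter_quarter, real_inner_self_eq_norm_sq, norm_sph]
  simp

theorem IsCkOnSphere.differentiableAt {d : ℕ} {r : ℕ∞} (hr : 1 ≤ r) {f : Sph d → ℝ}
    (hf : IsCkOnSphere r f) {x : Vel d} (hx : x ≠ 0) : DifferentiableAt ℝ (homExt f) x :=
  ((hf.differentiableOn (by simpa using (zero_lt_one.trans_le hr).ne')) x hx).differentiableAt (isOpen_compl_singleton.mem_nhds hx)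

theorem IsCkOnSphere.continuousOn_fderiv {d : ℕ} {r : ℕ∞} (hr : 1 ≤ r) {f : Sph d → ℝ}
    (hf : IsCkOnSphere r f) : ContinuousOn (fderiv ℝ (homExt f)) {0}ᶜ :=
  hf.continuousOn_fderiv_of_isOpen isOpen_compl_singleton (by exact_mod_cast hr)

theorem IsCkOnSphere.continuous {d : ℕ} {r : ℕ∞} {f : Sph d → ℝ} (hf : IsCkOnSphere r f) :
    Continuous f := by
  have h : Continuous fun k : Sph d => homExt f (k : Vel d) :=
    hf.continuousOn.comp_continuous continuous_subtype_val fun k => sph_ne_zero k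
  simpa only [homExt_coe] using h

theorem IsCkOnSphere.exists_tanDeriv {r : ℕ∞} (hr : 1 ≤ r) {f : Sph 2 → ℝ}
    (hf : IsCkOnSphere r f) : ∃ f' : Sph 2 → ℝ, Continuous f' ∧ HasTanDeriv f f' := by
  refine ⟨fun k => fderiv ℝ (homExt f) (k : Vel 2) (quarter (k : Vel 2)), ?_, fun k => ?_⟩
  · have h1 : Continuous fun k : Sph 2 => fderiv ℝ (homExt f) (k : Vel 2) :=
      (hf.continuousOn_fderiv hr).comp_continuous continuous_subtype_val fun k => sph_ne_zero k
    have h2 : Continuous fun k : Sph 2 => quarter (k : Vel 2) :=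
      quarter.continuous.comp continuous_subtype_val
    exact h1.clm_apply h2
  · have h1 : HasDerivAt (fun t => planeRot t (k : Vel 2)) (quarter (k : Vel 2)) 0 := by
      simp only [planeRot_apply]
      have hc : HasDerivAt (fun t => Real.cos t • (k : Vel 2)) _ 0 :=
        (Real.hasDerivAt_cos 0).smul_const _
      have hs : HasDerivAt (fun t => Real.sin t • quarter (k : Vel 2)) _ 0 :=
        (Real.hasDerivAt_sin 0).smul_const _
      have hcs := hc.add hs
      simp only [Real.sin_zero, neg_zero, zero_smul, Real.cos_zero, one_smul, zero_add] at hcs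
      exact hcs
    have h2 := (hf.differentiableAt hr (sph_ne_zero k)).hasFDerivAt
    have h3 : HasFDerivAt (homExt f) (fderiv ℝ (homExt f) (k : Vel 2))
        (planeRot 0 (k : Vel 2)) := by simpa using h2
    refine (h3.comp_hasDerivAt (0 : ℝ) h1).congr_of_eventuallyEq
      (Filter.Eventually.of_forall fun t => ?_)
    show f (rot t k) = homExt f (planeRot t k)
    rw [← coe_rot, homExt_coe]

/-! ### Averages over rotations of the circle -/

/-- The jump operator on the circle whose jumps are the rotations of angles distributed
according to `ν`. -/
def rotAverage (ν : Measure ℝ) (f : Sph 2 → ℝ) (k : Sph 2) : ℝ :=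
  ∫ a, (f (rot a k) - f k) ∂ν

theorem exists_bound_sph {d : ℕ} {f : Sph d → ℝ} (hf : Continuous f) : ∃ C, ∀ k, |f k| ≤ C := by
  obtain ⟨C, hC⟩ := (isCompact_range hf).isBounded.exists_norm_le
  exact ⟨C, fun k => hC _ ⟨k, rfl⟩⟩

theorem integrable_comp_rot {ν : Measure ℝ} [IsFiniteMeasure ν] {f : Sph 2 → ℝ}
    (hf : Continuous f) (k : Sph 2) : Integrable (fun a => f (rot a k)) ν := by
  obtain ⟨C, hC⟩ := exists_bound_sph hf
  exact Integrable.of_bound (hf.comp (continuous_rot_left k)).aestronglyMeasurable C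
    (Filter.Eventually.of_forall fun a => hC _)

theorem HasTanDeriv.rotAverage {ν : Measure ℝ} [IsFiniteMeasure ν] {f f' : Sph 2 → ℝ}
    (hf : Continuous f) (hf' : Continuous f') (h : HasTanDeriv f f') :
    HasTanDeriv (rotAverage ν f) (rotAverage ν f') := by
  intro k
  obtain ⟨C, hC⟩ := exists_bound_sph hf'
  have key := hasDerivAt_integral_of_dominated_loc_of_deriv_le (μ := ν) (x₀ := (0 : ℝ))
    (F := fun t a => f (rot a (rot t k)) - f (rot t k))
    (F' := fun t a => f' (rot a (rot t k)) - f' (rot t k)) (bound := fun _ => C + C)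
    (s := univ) Filter.univ_mem ?_ ?_ ?_ ?_ (integrable_const _) ?_
  · simpa [KineticFisher.rotAverage] using key.2
  · refine Filter.Eventually.of_forall fun t => ?_
    exact ((hf.comp (continuous_rot_left _)).sub continuous_const).aestronglyMeasurable
  · exact (integrable_comp_rot hf _).sub (integrable_const _)
  · exact ((hf'.comp (continuous_rot_left _)).sub continuous_const).aestronglyMeasurable
  · refine Filter.Eventually.of_forall fun a t _ => ?_
    exact (norm_sub_le _ _).trans (add_le_add (hC _) (hC _))
  · refine Filter.Eventually.of_forall fun a t _ => ?_
    refine HasDerivAt.sub ?_ (h.hasDerivAt k t)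
    have h1 := h.hasDerivAt (rot a k) t
    have e : ∀ s, rot a (rot s k) = rot s (rot a k) := fun s => by
      rw [← rot_add, ← rot_add, add_comm]
    simpa only [e] using h1

/-- The iterated carré du champ of a rotation average is a square: the commutator terms cancel
because the rotations of the circle commute with differentiation. -/
theorem gammaOneB_eq {ν : Measure ℝ} [IsFiniteMeasure ν] {L : (Sph 2 → ℝ) → Sph 2 → ℝ}
    (hL : ∀ g, Continuous g → L g = rotAverage ν g) {f f' : Sph 2 → ℝ}
    (hf : Continuous f) (hf' : Continuous f') (h : HasTanDeriv f f') (k : Sph 2) :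
    gammaOneB L f k = (∫ a, (f' (rot a k) - f' k) ^ 2 ∂ν) / 2 := by
  have h1 : gammaOne f f = fun k => f' k * f' k := h.gammaOne_eq h
  have h2 : gammaOne f (L f) k = f' k * rotAverage ν f' k := by
    rw [hL f hf, h.gammaOne_eq (h.rotAverage hf hf')]
  rw [gammaOneB, h1, h2, hL (fun k => f' k * f' k) (hf'.mul hf')]
  congr 1
  rw [rotAverage, rotAverage, ← mul_assoc, ← integral_const_mul, ← integral_sub]
  · refine integral_congr_ae (Filter.Eventually.of_forall fun a => ?_)
    simp only; ring
  · exact (integrable_comp_rot (hf'.mul hf') k).sub (integrable_const _)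
  · exact ((integrable_comp_rot hf' k).sub (integrable_const _)).const_mul _

theorem gammaB_eq {ν : Measure ℝ} [IsFiniteMeasure ν] {L : (Sph 2 → ℝ) → Sph 2 → ℝ}
    (hL : ∀ g, Continuous g → L g = rotAverage ν g) {f : Sph 2 → ℝ}
    (hf : Continuous f) (k : Sph 2) :
    gammaB L f k = (∫ a, (f (rot a k) - f k) ^ 2 ∂ν) / 2 := by
  rw [gammaB, hL f hf, hL (fun k => f k ^ 2) (hf.pow 2)]
  congr 1
  rw [rotAverage, rotAverage, ← mul_assoc, ← integral_const_mul, ← integral_sub]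
  · refine integral_congr_ae (Filter.Eventually.of_forall fun a => ?_)
    simp only; ring
  · exact (integrable_comp_rot (hf.pow 2) k).sub (integrable_const _)
  · exact ((integrable_comp_rot hf k).sub (integrable_const _)).const_mul _

theorem continuous_integral_sq_sub {ν : Measure ℝ} [IsFiniteMeasure ν] {f : Sph 2 → ℝ}
    (hf : Continuous f) : Continuous fun k => ∫ a, (f (rot a k) - f k) ^ 2 ∂ν := by
  obtain ⟨C, hC⟩ := exists_bound_sph hf
  refine continuous_of_dominated (bound := fun _ => (C + C) ^ 2) (fun k => ?_) (fun k => ?_)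
    (integrable_const _) (Filter.Eventually.of_forall fun a => ?_)
  · exact (((hf.comp (continuous_rot_left k)).sub continuous_const).pow 2).aestronglyMeasurable
  · refine Filter.Eventually.of_forall fun a => ?_
    rw [Real.norm_eq_abs, abs_pow]
    have : |f (rot a k) - f k| ≤ C + C := (abs_sub _ _).trans (add_le_add (hC _) (hC _))
    gcongr
  · exact ((hf.comp (continuous_rot_right a)).sub hf).pow 2

theorem HasTanDeriv.log {F F' : Sph 2 → ℝ} (h : HasTanDeriv F F') (hF : ∀ k, 0 < F k) :
    HasTanDeriv (fun k => Real.log (F k)) (fun k => F' k / F k) := fun k => by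
  have := (h k).log (by simpa using (hF k).ne')
  simpa using this

theorem critNum_eq {ν : Measure ℝ} [IsFiniteMeasure ν] {L : (Sph 2 → ℝ) → Sph 2 → ℝ}
    (hL : ∀ g, Continuous g → L g = rotAverage ν g) {F f' : Sph 2 → ℝ} (hF : Continuous F)
    (hpos : ∀ k, 0 < F k) (hf' : Continuous f')
    (h : HasTanDeriv (fun k => Real.log (F k)) f') :
    critNum L F = ∫ k, F k * ((∫ a, (f' (rot a k) - f' k) ^ 2 ∂ν) / 2) ∂(surf 2) := by
  refine integral_congr_ae (Filter.Eventually.of_forall fun k => ?_)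
  simp only
  rw [gammaOneB_eq hL (hF.log fun k => (hpos k).ne') hf' h]

theorem critDen_eq {ν : Measure ℝ} [IsFiniteMeasure ν] {L : (Sph 2 → ℝ) → Sph 2 → ℝ}
    (hL : ∀ g, Continuous g → L g = rotAverage ν g) {F : Sph 2 → ℝ} (hF : Continuous F) :
    critDen L F = ∫ k, (∫ a, (Real.sqrt (F (rot a k)) - Real.sqrt (F k)) ^ 2 ∂ν) / 2 ∂(surf 2) := by
  refine integral_congr_ae (Filter.Eventually.of_forall fun k => ?_)
  exact gammaB_eq hL hF.sqrt k

/-! ### Finitely supported angular measures -/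

/-- The symmetric extension to the line of the angular measure `∑ b_i δ_{iπ/N}`. -/
def symmAngular (N : ℕ) (b : ℕ → ℝ≥0) : Measure ℝ :=
  ∑ i ∈ Finset.range (N + 1), b i • (Measure.dirac ((i : ℝ) * Real.pi / (N : ℝ)) +
    Measure.dirac (-((i : ℝ) * Real.pi / (N : ℝ))))

instance (N : ℕ) (b : ℕ → ℝ≥0) : IsFiniteMeasure (symmAngular N b) := by
  unfold symmAngular; infer_instance

theorem integrable_dirac_real (φ : ℝ → ℝ) (x : ℝ) : Integrable φ (Measure.dirac x) :=
  integrable_dirac (by simp)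

theorem integral_symmAngular (N : ℕ) (b : ℕ → ℝ≥0) (φ : ℝ → ℝ) :
    ∫ a, φ a ∂(symmAngular N b) = ∑ i ∈ Finset.range (N + 1), (b i : ℝ) *
      (φ ((i : ℝ) * Real.pi / (N : ℝ)) + φ (-((i : ℝ) * Real.pi / (N : ℝ)))) := by
  have hi : ∀ i : ℕ, Integrable φ (Measure.dirac ((i : ℝ) * Real.pi / (N : ℝ)) +
    Measure.dirac (-((i : ℝ) * Real.pi / (N : ℝ)))) := fun i =>
    (integrable_dirac_real φ _).add_measure (integrable_dirac_real φ _)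
  rw [symmAngular, integral_finsetSum_measure fun i _ => (hi i).smul_measure_nnreal]
  refine Finset.sum_congr rfl fun i _ => ?_
  rw [integral_smul_nnreal_measure, integral_add_measure (integrable_dirac_real φ _)
    (integrable_dirac_real φ _), integral_dirac, integral_dirac]
  rfl

theorem linBoltzAngular_angularSum {N : ℕ} (hN : 0 < N) (b : ℕ → ℝ≥0) (f : Sph 2 → ℝ) :
    linBoltzAngular (angularSum N b) f = rotAverage (symmAngular N b) f := by
  funext k
  have hsum : ∀ m : ℕ → Measure ℝ, (∑ i ∈ Finset.range (N + 1), m i).restrict (Icc 0 Real.pi)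
      = ∑ i ∈ Finset.range (N + 1), (m i).restrict (Icc 0 Real.pi) := fun m =>
    map_sum (Measure.restrictₗ (Icc 0 Real.pi)) m _
  rw [rotAverage, integral_symmAngular, linBoltzAngular, angularSum, hsum,
    integral_finsetSum_measure]
  · refine Finset.sum_congr rfl fun i hi => ?_
    have hmem : (i : ℝ) * Real.pi / (N : ℝ) ∈ Icc 0 Real.pi := by
      have h1 : (i : ℝ) ≤ N := by
        exact_mod_cast Nat.lt_succ_iff.mp (Finset.mem_range.mp hi)
      have h2 : (0 : ℝ) < N := by exact_mod_cast hN
      refine ⟨by positivity, ?_⟩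
      rw [div_le_iff₀ h2]
      nlinarith [Real.pi_pos]
    rw [Measure.restrict_smul, restrict_dirac' measurableSet_Icc, if_pos hmem,
      integral_smul_nnreal_measure, integral_dirac]
    rfl
  · intro i _
    rw [Measure.restrict_smul, restrict_dirac' measurableSet_Icc]
    split_ifs
    · exact (integrable_dirac_real _ _).smul_measure_nnreal
    · simp

/-- The second harmonic `cos 2θ`, as a function on the circle. -/
def secondHarmonic (k : Sph 2) : ℝ := (k : Vel 2) 0 ^ 2 - (k : Vel 2) 1 ^ 2

/-- The tangential derivative `-2 sin 2θ` of the second harmonic. -/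
def secondHarmonicDeriv (k : Sph 2) : ℝ := -4 * ((k : Vel 2) 0 * (k : Vel 2) 1)

theorem continuous_secondHarmonic : Continuous secondHarmonic := by
  unfold secondHarmonic
  have h : Continuous fun k : Sph 2 => (k : Vel 2) := continuous_subtype_val
  fun_prop

theorem continuous_secondHarmonicDeriv : Continuous secondHarmonicDeriv := by
  unfold secondHarmonicDeriv
  have h : Continuous fun k : Sph 2 => (k : Vel 2) := continuous_subtype_val
  fun_prop

theorem secondHarmonic_neg (k : Sph 2) : secondHarmonic (-k) = secondHarmonic k := by
  simp [secondHarmonic]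

theorem coe_rot_apply_zero (t : ℝ) (k : Sph 2) :
    (rot t k : Vel 2) 0 = Real.cos t * (k : Vel 2) 0 - Real.sin t * (k : Vel 2) 1 := by
  simp [rot]

theorem coe_rot_apply_one (t : ℝ) (k : Sph 2) :
    (rot t k : Vel 2) 1 = Real.sin t * (k : Vel 2) 0 + Real.cos t * (k : Vel 2) 1 := by
  simp [rot]

theorem hasTanDeriv_secondHarmonic : HasTanDeriv secondHarmonic secondHarmonicDeriv := by
  intro k
  simp only [secondHarmonic, coe_rot_apply_zero, coe_rot_apply_one, secondHarmonicDeriv]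
  have hc := Real.hasDerivAt_cos 0
  have hs := Real.hasDerivAt_sin 0
  have h := (((hc.mul_const ((k : Vel 2) 0)).fun_sub (hs.mul_const ((k : Vel 2) 1))).fun_pow 2).fun_sub
    (((hs.mul_const ((k : Vel 2) 0)).fun_add (hc.mul_const ((k : Vel 2) 1))).fun_pow 2)
  refine h.congr_deriv ?_
  simp
  ring

/-- The point of angle `0` on the circle. -/
def baseSph : Sph 2 := ⟨!₂[1, 0], by
  rw [mem_sphere_zero_iff_norm, ← sq_eq_sq₀ (norm_nonneg _) zero_le_one, norm_sq_two]; simp⟩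

theorem secondHarmonic_rot_baseSph (t : ℝ) :
    secondHarmonic (rot t baseSph) = Real.cos (2 * t) := by
  rw [secondHarmonic, coe_rot_apply_zero, coe_rot_apply_one, Real.cos_two_mul']
  simp [baseSph]

/-- A Chebyshev polynomial of the second harmonic is invariant under rotations of angle `iπ/N`. -/
theorem chebyshev_secondHarmonic_rot {N : ℕ} (hN : 0 < N) (i : ℤ) (k : Sph 2) :
    (Polynomial.Chebyshev.T ℝ N).eval (secondHarmonic (rot ((i : ℝ) * Real.pi / N) k))
      = (Polynomial.Chebyshev.T ℝ N).eval (secondHarmonic k) := by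
  obtain ⟨t, rfl⟩ := exists_rot_eq baseSph k
  rw [← rot_add, secondHarmonic_rot_baseSph, secondHarmonic_rot_baseSph,
    Polynomial.Chebyshev.T_real_cos, Polynomial.Chebyshev.T_real_cos]
  have hN' : (N : ℝ) ≠ 0 := by exact_mod_cast hN.ne'
  have : ((N : ℤ) : ℝ) * (2 * ((i : ℝ) * Real.pi / N + t))
      = ((N : ℤ) : ℝ) * (2 * t) + i * (2 * Real.pi) := by
    push_cast; field_simp; ring
  rw [this, Real.cos_add_int_mul_two_pi]

theorem isCkOnSphere_comp_secondHarmonic {Φ : ℝ → ℝ} {r : ℕ∞} (hΦ : ContDiff ℝ (⊤ : ℕ∞) Φ) :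
    IsCkOnSphere r fun k => Φ (secondHarmonic k) := by
  have h : ContDiffOn ℝ (⊤ : ℕ∞)
      (fun x : Vel 2 => Φ ((‖x‖ ^ 2)⁻¹ * (x 0 ^ 2 - x 1 ^ 2))) {0}ᶜ := by
    refine hΦ.comp_contDiffOn ?_
    refine ContDiffOn.mul ?_ ?_
    · refine ContDiffOn.inv ?_ fun x hx => pow_ne_zero 2 (norm_ne_zero_iff.mpr hx)
      exact (contDiff_norm_sq ℝ).contDiffOn
    · have h0 : ContDiff ℝ (⊤ : ℕ∞) fun x : Vel 2 => x 0 := by fun_prop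
      have h1 : ContDiff ℝ (⊤ : ℕ∞) fun x : Vel 2 => x 1 := by fun_prop
      exact ((h0.pow 2).sub (h1.pow 2)).contDiffOn
  refine (h.of_le (by exact_mod_cast le_top)).congr fun x hx => ?_
  rw [homExt_of_ne_zero _ hx]
  congr 1
  simp [secondHarmonic]
  ring

theorem deriv_smoothTransition_eq_zero {x : ℝ} (hx : x ≤ 0 ∨ 1 ≤ x) :
    deriv Real.smoothTransition x = 0 := by
  rcases hx with hx | hx
  · refine IsLocalMin.deriv_eq_zero (Filter.Eventually.of_forall fun y => ?_)
    rw [Real.smoothTransition.zero_of_nonpos hx]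
    exact Real.smoothTransition.nonneg y
  · refine IsLocalMax.deriv_eq_zero (Filter.Eventually.of_forall fun y => ?_)
    rw [Real.smoothTransition.one_of_one_le hx]
    exact Real.smoothTransition.le_one y

/-- The smooth step `c(y)` from `1` to `2`, whose transition takes place in `(y₀ - ρ, y₀ + ρ)`. -/
def stepProfile (y₀ ρ y : ℝ) : ℝ := 1 + Real.smoothTransition ((y - y₀ + ρ) / (2 * ρ))

theorem stepProfile_pos (y₀ ρ y : ℝ) : 0 < stepProfile y₀ ρ y :=
  add_pos_of_pos_of_nonneg one_pos (Real.smoothTransition.nonneg _)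

theorem contDiff_stepProfile (y₀ ρ : ℝ) : ContDiff ℝ (⊤ : ℕ∞) (stepProfile y₀ ρ) := by
  unfold stepProfile
  refine contDiff_const.add (Real.smoothTransition.contDiff.comp ?_)
  fun_prop

theorem deriv_stepProfile_eq_zero {y₀ ρ y : ℝ} (hρ : 0 < ρ) (hy : ρ ≤ |y - y₀|) :
    deriv (stepProfile y₀ ρ) y = 0 := by
  have h1 : HasDerivAt (fun y => (y - y₀ + ρ) / (2 * ρ)) (1 / (2 * ρ)) y :=
    (((hasDerivAt_id y).sub_const y₀).add_const ρ).div_const (2 * ρ)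
  have h2 : HasDerivAt Real.smoothTransition (deriv Real.smoothTransition ((y - y₀ + ρ) / (2 * ρ)))
      ((y - y₀ + ρ) / (2 * ρ)) :=
    ((Real.smoothTransition.contDiff (n := 1)).differentiable (by simp)).differentiableAt.hasDerivAt
  have h3 := (h2.comp y h1).const_add 1
  have h4 : deriv (stepProfile y₀ ρ) y = _ := h3.deriv
  rw [h4, deriv_smoothTransition_eq_zero, zero_mul]
  rcases le_abs.mp hy with h | h
  · right; rw [le_div_iff₀ (by positivity)]; linarith
  · left; exact div_nonpos_of_nonpos_of_nonneg (by linarith) (by positivity)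

/-- The cut-off `η(y)`, which vanishes where the `N`-th Chebyshev polynomial is at most `-1/2`. -/
def cutProfile (N : ℕ) (y : ℝ) : ℝ :=
  Real.smoothTransition ((Polynomial.Chebyshev.T ℝ N).eval y + 1 / 2)

theorem contDiff_cutProfile (N : ℕ) : ContDiff ℝ (⊤ : ℕ∞) (cutProfile N) := by
  unfold cutProfile
  exact Real.smoothTransition.contDiff.comp ((Polynomial.contDiff_aeval _ _).add contDiff_const)

theorem cutProfile_nonneg (N : ℕ) (y : ℝ) : 0 ≤ cutProfile N y := Real.smoothTransition.nonneg _

theorem cutProfile_secondHarmonic_rot {N : ℕ} (hN : 0 < N) (i : ℤ) (k : Sph 2) :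
    cutProfile N (secondHarmonic (rot ((i : ℝ) * Real.pi / N) k))
      = cutProfile N (secondHarmonic k) := by
  rw [cutProfile, chebyshev_secondHarmonic_rot hN, cutProfile]

theorem hasTanDeriv_comp_secondHarmonic {Φ : ℝ → ℝ} (hΦ : Differentiable ℝ Φ) :
    HasTanDeriv (fun k => Φ (secondHarmonic k))
      (fun k => deriv Φ (secondHarmonic k) * secondHarmonicDeriv k) := fun k => by
  have h1 : HasDerivAt Φ (deriv Φ (secondHarmonic k)) (secondHarmonic (rot 0 k)) := by
    rw [rot_zero]; exact (hΦ _).hasDerivAt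
  exact h1.comp (0 : ℝ) (hasTanDeriv_secondHarmonic k)

/-- The tangential derivative of a function invariant under a rotation is invariant as well. -/
theorem HasTanDeriv.rot_eq {f f' : Sph 2 → ℝ} (h : HasTanDeriv f f') {a : ℝ}
    (ha : ∀ k, f (rot a k) = f k) (k : Sph 2) : f' (rot a k) = f' k := by
  refine (h (rot a k)).unique ((h k).congr_of_eventuallyEq (Filter.Eventually.of_forall fun t => ?_))
  show f (rot t (rot a k)) = f (rot t k)
  rw [← rot_add, add_comm, rot_add, ha]

theorem cos_two_mul_lt {N i : ℕ} (h1 : 1 ≤ i) (h2 : i < N) :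
    Real.cos (2 * ((i : ℝ) * Real.pi / N)) < Real.cos (Real.pi / N) := by
  have hN : (0 : ℝ) < N := by exact_mod_cast (by omega : 0 < N)
  have hi : (1 : ℝ) ≤ i := by exact_mod_cast h1
  have hiN : (i : ℝ) + 1 ≤ N := by exact_mod_cast h2
  have hpi := Real.pi_pos
  have h0 : 0 ≤ Real.pi / N := by positivity
  rcases le_total (2 * ((i : ℝ) * Real.pi / N)) Real.pi with h | h
  · refine Real.cos_lt_cos_of_nonneg_of_le_pi h0 h ?_
    rw [← mul_div_assoc, div_lt_div_iff_of_pos_right hN]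
    nlinarith
  · rw [← Real.cos_two_pi_sub]
    refine Real.cos_lt_cos_of_nonneg_of_le_pi h0 (by linarith) ?_
    rw [← mul_div_assoc, lt_sub_iff_add_lt, ← add_div, div_lt_iff₀ hN]
    nlinarith

/-- Choice of the centre and of the width of the step: near `cos (π/N)` the `N`-th Chebyshev
polynomial is close to its minimum `-1`. -/
theorem exists_step_width {N i : ℕ} (h1 : 1 ≤ i) (h2 : i < N) : ∃ y₀ ρ : ℝ, 0 < ρ ∧
    (∀ y, |y - y₀| < ρ → (Polynomial.Chebyshev.T ℝ N).eval y < -1 / 2) ∧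
    Real.cos (2 * ((i : ℝ) * Real.pi / N)) ≤ y₀ - ρ ∧ y₀ + ρ ≤ 1 := by
  have hN : (N : ℝ) ≠ 0 := by exact_mod_cast (by omega : N ≠ 0)
  have hval : (Polynomial.Chebyshev.T ℝ N).eval (Real.cos (Real.pi / N)) < -1 / 2 := by
    rw [Polynomial.Chebyshev.T_real_cos]
    have : ((N : ℤ) : ℝ) * (Real.pi / N) = Real.pi := by push_cast; field_simp
    rw [this, Real.cos_pi]; norm_num
  have hev := (Polynomial.continuous (Polynomial.Chebyshev.T ℝ N)).continuousAt.eventually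
    (gt_mem_nhds hval)
  obtain ⟨ρ₁, hρ₁, H⟩ := Metric.eventually_nhds_iff.mp hev
  have hlt := cos_two_mul_lt h1 h2
  have hlt1 : Real.cos (Real.pi / N) < 1 := by
    rw [← Real.cos_zero]
    have hpi := Real.pi_pos
    have hN2 : (2 : ℝ) ≤ N := by exact_mod_cast (by omega : 2 ≤ N)
    refine Real.cos_lt_cos_of_nonneg_of_le_pi le_rfl ?_ (by positivity)
    rw [div_le_iff₀ (by linarith)]; nlinarith
  refine ⟨Real.cos (Real.pi / N), min ρ₁ (min (Real.cos (Real.pi / N) -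
    Real.cos (2 * ((i : ℝ) * Real.pi / N))) (1 - Real.cos (Real.pi / N))), ?_, ?_, ?_, ?_⟩
  · exact lt_min hρ₁ (lt_min (by linarith) (by linarith))
  · intro y hy
    exact H (by rw [Real.dist_eq]; exact hy.trans_le (min_le_left _ _))
  · have := (min_le_right ρ₁ (min (Real.cos (Real.pi / N) -
      Real.cos (2 * ((i : ℝ) * Real.pi / N))) (1 - Real.cos (Real.pi / N)))).trans (min_le_left _ _)
    linarith
  · have := (min_le_right ρ₁ (min (Real.cos (Real.pi / N) -
      Real.cos (2 * ((i : ℝ) * Real.pi / N))) (1 - Real.cos (Real.pi / N)))).trans (min_le_right _ _)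
    linarith

instance instOpenPosSurf {d : ℕ} : (surf d).IsOpenPosMeasure := by unfold surf; infer_instance

/-- The densities that make the quotient degenerate: the product of the sum of `δ` and
a function invariant under the jumps, and of a step that is constant wherever this function does
not vanish. -/
theorem exists_degenerate_densities (r : ℕ∞) {N i : ℕ} {b : ℕ → ℝ≥0} (h1 : 1 ≤ i) (h2 : i < N)
    (hb : 0 < b i) : ∃ C c₀ : ℝ, 0 < c₀ ∧ ∀ δ : ℝ, 0 < δ → ∃ F : Sph 2 → ℝ, IsEvenDensity r F ∧
      critNum (linBoltzAngular (angularSum N b)) F = δ * C ∧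
      c₀ ≤ critDen (linBoltzAngular (angularSum N b)) F := by
  have hN : 0 < N := by omega
  obtain ⟨y₀, ρ, hρ, hT, hlow, hhigh⟩ := exists_step_width h1 h2
  set ν := symmAngular N b with hν
  set L := linBoltzAngular (angularSum N b) with hLdef
  have hL : ∀ g, Continuous g → L g = rotAverage ν g := fun g _ =>
    linBoltzAngular_angularSum hN b g
  set y := secondHarmonic
  have hy : Continuous y := continuous_secondHarmonic
  set c : Sph 2 → ℝ := fun k => stepProfile y₀ ρ (y k) with hc
  set η : Sph 2 → ℝ := fun k => cutProfile N (y k) with hη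
  have hcc : Continuous c := (contDiff_stepProfile y₀ ρ).continuous.comp hy
  have hηc : Continuous η := (contDiff_cutProfile N).continuous.comp hy
  have hc0 : ∀ k, 0 < c k := fun k => stepProfile_pos _ _ _
  have hη0 : ∀ k, 0 ≤ η k := fun k => cutProfile_nonneg _ _
  have hinv : ∀ (j : ℤ) (k : Sph 2), η (rot ((j : ℝ) * Real.pi / N) k) = η k := fun j k =>
    cutProfile_secondHarmonic_rot hN j k
  set c' : Sph 2 → ℝ := fun k => deriv (stepProfile y₀ ρ) (y k) * secondHarmonicDeriv k with hc'
  have hc't : HasTanDeriv c c' := hasTanDeriv_comp_secondHarmonic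
    ((contDiff_stepProfile y₀ ρ).differentiable (by simp))
  have hc'c : Continuous c' := (((contDiff_stepProfile y₀ ρ).continuous_deriv (by simp)).comp hy).mul
    continuous_secondHarmonicDeriv
  -- the step is flat where the cut-off does not vanish
  have hflat : ∀ k, η k ≠ 0 → c' k = 0 := by
    intro k hk
    have : deriv (stepProfile y₀ ρ) (y k) = 0 := by
      refine deriv_stepProfile_eq_zero hρ ?_
      by_contra hlt
      have := hT _ (not_le.mp hlt)
      exact hk (Real.smoothTransition.zero_of_nonpos (by linarith))
    rw [hc']; simp [this]
  -- an identity for integrals against `ν` from an identity at all angles of its support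
  have hcongr : ∀ φ ψ : ℝ → ℝ, (∀ j : ℤ, φ ((j : ℝ) * Real.pi / N) = ψ ((j : ℝ) * Real.pi / N)) →
      ∫ a, φ a ∂ν = ∫ a, ψ a ∂ν := by
    intro φ ψ h
    rw [hν, integral_symmAngular, integral_symmAngular]
    refine Finset.sum_congr rfl fun j _ => ?_
    have e1 := h j
    have e2 := h (-(j : ℤ))
    push_cast at e1 e2
    rw [neg_mul, neg_div] at e2
    rw [e1, e2]
  set D : Sph 2 → ℝ := fun k => (∫ a, (Real.sqrt (c (rot a k)) - Real.sqrt (c k)) ^ 2 ∂ν) / 2 with hD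
  have hDc : Continuous D := (continuous_integral_sq_sub hcc.sqrt).div_const 2
  have hD0 : ∀ k, 0 ≤ D k := fun k => by
    have : 0 ≤ ∫ a, (Real.sqrt (c (rot a k)) - Real.sqrt (c k)) ^ 2 ∂ν :=
      integral_nonneg fun a => sq_nonneg _
    simp only [hD]; positivity
  refine ⟨∫ k, c k * ((∫ a, (c' (rot a k) / c (rot a k) - c' k / c k) ^ 2 ∂ν) / 2) ∂(surf 2),
    ∫ k, η k * D k ∂(surf 2), ?_, fun δ hδ => ?_⟩
  · refine (hηc.mul hDc).integral_pos_of_hasCompactSupport_nonneg_nonzero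
      (HasCompactSupport.of_compactSpace _) (fun k => mul_nonneg (hη0 k) (hD0 k)) (x := baseSph) ?_
    have hy1 : y baseSph = 1 := by
      have := secondHarmonic_rot_baseSph 0
      simpa using this
    have e1 : c baseSph = 2 := by
      simp only [hc, hy1, stepProfile]
      rw [Real.smoothTransition.one_of_one_le]
      · norm_num
      · rw [le_div_iff₀ (by positivity)]; linarith
    have e2 : c (rot ((i : ℝ) * Real.pi / N) baseSph) = 1 := by
      simp only [hc, stepProfile]
      rw [show y (rot ((i : ℝ) * Real.pi / N) baseSph) = _ from secondHarmonic_rot_baseSph _,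
        Real.smoothTransition.zero_of_nonpos]
      · norm_num
      · exact div_nonpos_of_nonpos_of_nonneg (by linarith) (by positivity)
    have e3 : 0 < η baseSph := by
      simp only [hη, hy1, cutProfile]
      refine Real.smoothTransition.pos_of_pos ?_
      simp
      norm_num
    have e4 : 0 < D baseSph := by
      simp only [hD, hν, integral_symmAngular]
      refine half_pos (Finset.sum_pos' (fun j _ => by positivity)
        ⟨i, Finset.mem_range.mpr (by omega), ?_⟩)
      rw [e1, e2]
      have hs : Real.sqrt 1 - Real.sqrt 2 ≠ 0 := by
        have := Real.sqrt_lt_sqrt (by norm_num) (one_lt_two (α := ℝ))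
        exact (sub_neg.mpr this).ne
      have : (0 : ℝ) < b i := by exact_mod_cast hb
      have := sq_pos_of_ne_zero hs
      positivity
    exact (mul_pos e3 e4).ne'
  · set F : Sph 2 → ℝ := fun k => (δ + η k) * c k with hF
    have hg0 : ∀ k, 0 < δ + η k := fun k => add_pos_of_pos_of_nonneg hδ (hη0 k)
    have hF0 : ∀ k, 0 < F k := fun k => mul_pos (hg0 k) (hc0 k)
    have hFc : Continuous F := (continuous_const.add hηc).mul hcc
    refine ⟨F, ⟨hF0, fun k => ?_, ?_⟩, ?_, ?_⟩
    · simp [hF, hη, hc, y, secondHarmonic_neg]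
    · exact isCkOnSphere_comp_secondHarmonic
        (Φ := fun s => (δ + cutProfile N s) * stepProfile y₀ ρ s)
        ((contDiff_const.add (contDiff_cutProfile N)).mul (contDiff_stepProfile y₀ ρ))
    · obtain ⟨A, hAt, hAc⟩ : ∃ A, HasTanDeriv (fun k => Real.log (δ + η k)) A ∧ Continuous A := by
        have h0 : HasTanDeriv (fun k => δ + η k)
            (fun k => deriv (cutProfile N) (y k) * secondHarmonicDeriv k) := fun k =>
          (hasTanDeriv_comp_secondHarmonic ((contDiff_cutProfile N).differentiable (by simp))
            k).const_add δ
        refine ⟨_, h0.log hg0, ?_⟩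
        exact ((((contDiff_cutProfile N).continuous_deriv (by simp)).comp hy).mul
          continuous_secondHarmonicDeriv).div (continuous_const.add hηc) fun k => (hg0 k).ne'
      have hlog : HasTanDeriv (fun k => Real.log (F k)) (fun k => A k + c' k / c k) := by
        have e : (fun k => Real.log (F k)) = fun k => Real.log (δ + η k) + Real.log (c k) := by
          funext k; exact Real.log_mul (hg0 k).ne' (hc0 k).ne'
        rw [e]
        exact fun k => (hAt k).add (hc't.log hc0 k)
      rw [critNum_eq (f' := fun k => A k + c' k / c k) hL hFc hF0
          (hAc.add (hc'c.div hcc fun k => (hc0 k).ne')) hlog,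
        ← integral_const_mul]
      refine integral_congr_ae (Filter.Eventually.of_forall fun k => ?_)
      have hAinv : ∀ j : ℤ, A (rot ((j : ℝ) * Real.pi / N) k) = A k := fun j =>
        hAt.rot_eq (fun k => by simp only [hinv]) k
      have e : ∫ a, (A (rot a k) + c' (rot a k) / c (rot a k) - (A k + c' k / c k)) ^ 2 ∂ν
          = ∫ a, (c' (rot a k) / c (rot a k) - c' k / c k) ^ 2 ∂ν := by
        refine hcongr _ _ fun j => ?_
        rw [hAinv]; ring
      simp only
      rw [e]
      by_cases hk : η k = 0
      · simp only [hF, hk]; ring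
      · have e0 : ∫ a, (c' (rot a k) / c (rot a k) - c' k / c k) ^ 2 ∂ν = ∫ _, (0 : ℝ) ∂ν := by
          refine hcongr _ _ fun j => ?_
          rw [hflat k hk, hflat _ (by rw [hinv]; exact hk)]; simp
        rw [e0]; simp
    · rw [critDen_eq hL hFc]
      refine integral_mono (integrable_surf_of_continuous (hηc.mul hDc))
        (integrable_surf_of_continuous ((continuous_integral_sq_sub hFc.sqrt).div_const 2))
        fun k => ?_
      have e : ∫ a, (Real.sqrt (F (rot a k)) - Real.sqrt (F k)) ^ 2 ∂ν
          = ∫ a, (δ + η k) * (Real.sqrt (c (rot a k)) - Real.sqrt (c k)) ^ 2 ∂ν := by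
        refine hcongr _ _ fun j => ?_
        simp only [hF]
        rw [hinv, Real.sqrt_mul (hg0 k).le, Real.sqrt_mul (hg0 k).le, ← mul_sub, mul_pow,
          Real.sq_sqrt (hg0 k).le]
      simp only
      rw [e, integral_const_mul, mul_div_assoc]
      exact mul_le_mul_of_nonneg_right (by linarith) (hD0 k)

theorem critNum_angularSum_nonneg {r : ℕ∞} (hr : 1 ≤ r) {N : ℕ} (hN : 0 < N) (b : ℕ → ℝ≥0)
    {F : Sph 2 → ℝ} (hF : IsEvenDensity r F) :
    0 ≤ critNum (linBoltzAngular (angularSum N b)) F := by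
  obtain ⟨F', hF'c, hF't⟩ := hF.regular.exists_tanDeriv hr
  have hFc := hF.regular.continuous
  rw [critNum_eq (ν := symmAngular N b) (fun g _ => linBoltzAngular_angularSum hN b g) hFc hF.pos
    (hF'c.div hFc fun k => (hF.pos k).ne') (hF't.log hF.pos)]
  refine integral_nonneg fun k => mul_nonneg (hF.pos k).le ?_
  exact div_nonneg (integral_nonneg fun a => sq_nonneg _) (by norm_num)

theorem critDen_angularSum_nonneg {r : ℕ∞} {N : ℕ} (hN : 0 < N) (b : ℕ → ℝ≥0)
    {F : Sph 2 → ℝ} (hF : IsEvenDensity r F) :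
    0 ≤ critDen (linBoltzAngular (angularSum N b)) F := by
  rw [critDen_eq (ν := symmAngular N b) (fun g _ => linBoltzAngular_angularSum hN b g)
    hF.regular.continuous]
  exact integral_nonneg fun k => div_nonneg (integral_nonneg fun a => sq_nonneg _) (by norm_num)

theorem exists_index_of_sum_pos {N : ℕ} {b : ℕ → ℝ≥0} (hb : 0 < ∑ i ∈ Finset.Ico 1 N, b i) :
    ∃ i, 1 ≤ i ∧ i < N ∧ 0 < b i := by
  obtain ⟨i, hi, hi'⟩ := Finset.exists_ne_zero_of_sum_ne_zero hb.ne'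
  exact ⟨i, (Finset.mem_Ico.mp hi).1, (Finset.mem_Ico.mp hi).2, pos_iff_ne_zero.mpr hi'⟩

theorem critInf_angularSum {r : ℕ∞} (hr : 1 ≤ r) {N : ℕ} {b : ℕ → ℝ≥0}
    (hb : 0 < ∑ i ∈ Finset.Ico 1 N, b i) :
    critInf (linBoltzAngular (angularSum N b)) r = 0 := by
  obtain ⟨i, h1, h2, hbi⟩ := exists_index_of_sum_pos hb
  have hN : 0 < N := by omega
  obtain ⟨C, c₀, hc₀, H⟩ := exists_degenerate_densities r h1 h2 hbi
  refine le_antisymm ?_ ?_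
  · refine EReal.le_of_forall_lt_iff_le.mp fun e he => ?_
    have he' : 0 < e := by exact_mod_cast he
    obtain ⟨F, hF, hnum, hden⟩ := H (e * c₀ / (|C| + 1)) (by positivity)
    have hdpos : 0 < critDen (linBoltzAngular (angularSum N b)) F := hc₀.trans_le hden
    have hle : critInf (linBoltzAngular (angularSum N b)) r ≤ _ :=
      sInf_le ⟨F, hF, hdpos.ne', rfl⟩
    refine hle.trans ?_
    rw [EReal.coe_le_coe_iff, div_le_iff₀ hdpos, hnum]
    have hC : C ≤ |C| + 1 := (le_abs_self C).trans (by linarith)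
    calc e * c₀ / (|C| + 1) * C ≤ e * c₀ / (|C| + 1) * (|C| + 1) := by gcongr
      _ = e * c₀ := by field_simp
      _ ≤ _ := by gcongr
  · refine le_sInf ?_
    rintro q ⟨F, hF, -, rfl⟩
    have := div_nonneg (critNum_angularSum_nonneg hr hN b hF) (critDen_angularSum_nonneg hN b hF)
    exact_mod_cast this

theorem not_forall_critDen_le {r : ℕ∞} {N : ℕ} {b : ℕ → ℝ≥0}
    (hb : 0 < ∑ i ∈ Finset.Ico 1 N, b i) {K : ℝ} (hK : 0 < K) :
    ¬ ∀ F : Sph 2 → ℝ, IsEvenDensity r F →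
      critDen (linBoltzAngular (angularSum N b)) F
        ≤ 1 / K * critNum (linBoltzAngular (angularSum N b)) F := by
  obtain ⟨i, h1, h2, hbi⟩ := exists_index_of_sum_pos hb
  obtain ⟨C, c₀, hc₀, H⟩ := exists_degenerate_densities r h1 h2 hbi
  intro hall
  obtain ⟨F, hF, hnum, hden⟩ := H (K * c₀ / (2 * (|C| + 1))) (by positivity)
  have h := hden.trans (hall F hF)
  rw [hnum] at h
  have hC : C ≤ |C| + 1 := (le_abs_self C).trans (by linarith)
  have : 1 / K * (K * c₀ / (2 * (|C| + 1)) * C) ≤ c₀ / 2 := by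
    calc 1 / K * (K * c₀ / (2 * (|C| + 1)) * C)
        ≤ 1 / K * (K * c₀ / (2 * (|C| + 1)) * (|C| + 1)) := by gcongr
      _ = c₀ / 2 := by field_simp
  linarith

/-! ### A Wirtinger inequality for periodic functions of one variable -/

/-- Wirtinger's inequality with Dirichlet conditions, for every constant below the optimal one. The
function `sin (κ x + δ)` is positive on the whole interval, hence `κ cot (κ x + δ)` is smooth
there and `∫ (W' - κ cot (κ x + δ) W)² ≥ 0` can be integrated by parts. -/
theorem wirtinger_dirichlet_of_lt {W W' : ℝ → ℝ} {κ : ℝ} (hκ : 0 < κ) (hκ2 : κ < 2)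
    (hW : ∀ x, HasDerivAt W (W' x) x) (hW' : Continuous W') (h0 : W 0 = 0)
    (h1 : W (Real.pi / 2) = 0) :
    κ ^ 2 * ∫ x in (0 : ℝ)..(Real.pi / 2), W x ^ 2 ≤ ∫ x in (0 : ℝ)..(Real.pi / 2), W' x ^ 2 := by
  have hpi := Real.pi_pos
  set δ := (Real.pi - κ * (Real.pi / 2)) / 2 with hδ
  have hδ0 : 0 < δ := by rw [hδ]; nlinarith
  have hWc : Continuous W := continuous_iff_continuousAt.mpr fun x => (hW x).continuousAt
  have hpos : ∀ x ∈ Icc (0 : ℝ) (Real.pi / 2), 0 < Real.sin (κ * x + δ) := by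
    intro x hx
    refine Real.sin_pos_of_pos_of_lt_pi ?_ ?_
    · have := mul_nonneg hκ.le hx.1; linarith
    · have := mul_le_mul_of_nonneg_left hx.2 hκ.le
      linarith
  set c : ℝ → ℝ := fun x => κ * (Real.cos (κ * x + δ) / Real.sin (κ * x + δ)) with hc
  have hcc : ContinuousOn c (Icc 0 (Real.pi / 2)) := by
    refine continuousOn_const.mul (ContinuousOn.div ?_ ?_ fun x hx => (hpos x hx).ne') <;>
    exact Continuous.continuousOn (by fun_prop)
  have hle : (0 : ℝ) ≤ Real.pi / 2 := by positivity
  have huIcc : uIcc 0 (Real.pi / 2) = Icc 0 (Real.pi / 2) := uIcc_of_le hle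
  have hderiv : ∀ x ∈ uIcc 0 (Real.pi / 2), HasDerivAt (fun x => W x ^ 2 * c x)
      (2 * W x * W' x * c x - W x ^ 2 * (κ ^ 2 + c x ^ 2)) x := by
    intro x hx
    rw [huIcc] at hx
    have hl : HasDerivAt (fun x => κ * x + δ) κ x := by
      simpa using ((hasDerivAt_id x).const_mul κ).add_const δ
    have hs := (hpos x hx).ne'
    have h2 := ((hW x).fun_pow 2).fun_mul (((hl.cos).fun_div (hl.sin) hs).const_mul κ)
    refine h2.congr_deriv ?_
    have hsc := Real.sin_sq_add_cos_sq (κ * x + δ)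
    simp only [hc]
    field_simp
    norm_num
    linear_combination (-(W x ^ 2 * κ)) * hsc
  have hint : IntervalIntegrable (fun x => 2 * W x * W' x * c x - W x ^ 2 * (κ ^ 2 + c x ^ 2))
      volume 0 (Real.pi / 2) := by
    refine ContinuousOn.intervalIntegrable ?_
    rw [huIcc]
    exact ((continuous_const.mul hWc).mul hW').continuousOn.mul hcc |>.sub
      ((hWc.pow 2).continuousOn.mul (continuousOn_const.add (hcc.pow 2)))
  have hFTC := intervalIntegral.integral_eq_sub_of_hasDerivAt hderiv hint
  rw [h0, h1] at hFTC
  have hnn : 0 ≤ ∫ x in (0 : ℝ)..(Real.pi / 2), (W' x - c x * W x) ^ 2 :=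
    intervalIntegral.integral_nonneg hle fun x _ => sq_nonneg _
  have e : ∀ x, (W' x - c x * W x) ^ 2 = (W' x ^ 2 - κ ^ 2 * W x ^ 2)
      - (2 * W x * W' x * c x - W x ^ 2 * (κ ^ 2 + c x ^ 2)) := fun x => by ring
  simp_rw [e] at hnn
  have i1 : IntervalIntegrable (fun x => W' x ^ 2) volume 0 (Real.pi / 2) :=
    (hW'.pow 2).intervalIntegrable _ _
  have i2 : IntervalIntegrable (fun x => κ ^ 2 * W x ^ 2) volume 0 (Real.pi / 2) :=
    ((hWc.pow 2).const_mul (κ ^ 2)).intervalIntegrable _ _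
  rw [intervalIntegral.integral_sub (i1.sub i2) hint, hFTC, intervalIntegral.integral_sub i1 i2,
    intervalIntegral.integral_const_mul] at hnn
  linarith

theorem wirtinger_dirichlet {W W' : ℝ → ℝ} (hW : ∀ x, HasDerivAt W (W' x) x)
    (hW' : Continuous W') (h0 : W 0 = 0) (h1 : W (Real.pi / 2) = 0) :
    4 * ∫ x in (0 : ℝ)..(Real.pi / 2), W x ^ 2 ≤ ∫ x in (0 : ℝ)..(Real.pi / 2), W' x ^ 2 := by
  have hlim : Filter.Tendsto
      (fun κ : ℝ => κ ^ 2 * ∫ x in (0 : ℝ)..(Real.pi / 2), W x ^ 2) (nhdsWithin 2 (Iio 2))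
      (nhds (2 ^ 2 * ∫ x in (0 : ℝ)..(Real.pi / 2), W x ^ 2)) := by
    have : Continuous fun κ : ℝ => κ ^ 2 * ∫ x in (0 : ℝ)..(Real.pi / 2), W x ^ 2 := by fun_prop
    exact (this.tendsto 2).mono_left nhdsWithin_le_nhds
  have hle := le_of_tendsto hlim (b := ∫ x in (0 : ℝ)..(Real.pi / 2), W' x ^ 2) <| by
    filter_upwards [Ioo_mem_nhdsLT (show (1 : ℝ) < 2 by norm_num)] with κ hκ
    exact wirtinger_dirichlet_of_lt (by linarith [hκ.1]) hκ.2 hW hW' h0 h1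
  norm_num at hle
  exact hle

/-- A function that changes sign after a quarter turn vanishes somewhere, so that Wirtinger's
inequality with Dirichlet conditions applies from there on. -/
theorem wirtinger_antiperiodic {V V' : ℝ → ℝ} (hV : ∀ x, HasDerivAt V (V' x) x)
    (hV' : Continuous V') (hanti : Function.Antiperiodic V (Real.pi / 2)) :
    4 * ∫ x in (0 : ℝ)..(Real.pi / 2), V x ^ 2 ≤ ∫ x in (0 : ℝ)..(Real.pi / 2), V' x ^ 2 := by
  have hpi := Real.pi_pos
  have hVc : Continuous V := continuous_iff_continuousAt.mpr fun x => (hV x).continuousAt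
  obtain ⟨s, hs⟩ : ∃ s, V s = 0 := by
    have h0 : V (0 + Real.pi / 2) = -V 0 := hanti 0
    rcases le_total 0 (V 0) with h | h
    · exact mem_range_of_exists_le_of_exists_ge hVc ⟨_, by rw [h0]; linarith⟩ ⟨0, h⟩
    · exact mem_range_of_exists_le_of_exists_ge hVc ⟨0, h⟩ ⟨_, by rw [h0]; linarith⟩
  have hper : Function.Periodic (fun x => V x ^ 2) (Real.pi / 2) := fun x => by
    simp only [hanti x]; ring
  have hanti' : Function.Antiperiodic V' (Real.pi / 2) := fun x => by
    have h1 := (hV (x + Real.pi / 2)).comp_add_const x (Real.pi / 2)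
    have h2 : (fun x => V (x + Real.pi / 2)) = fun x => -V x := funext hanti
    rw [h2] at h1
    exact h1.unique (hV x).neg
  have hper' : Function.Periodic (fun x => V' x ^ 2) (Real.pi / 2) := fun x => by
    simp only [hanti' x]; ring
  have key := wirtinger_dirichlet (W := fun x => V (x + s)) (W' := fun x => V' (x + s))
    (fun x => (hV (x + s)).comp_add_const x s) (by fun_prop) (by simpa using hs)
    (by rw [add_comm, hanti s, hs, neg_zero])
  have e1 := intervalIntegral.integral_comp_add_right (a := 0) (b := Real.pi / 2)
    (fun x => V x ^ 2) s
  have e2 := intervalIntegral.integral_comp_add_right (a := 0) (b := Real.pi / 2)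
    (fun x => V' x ^ 2) s
  have e3 := hper.intervalIntegral_add_eq s 0
  have e4 := hper'.intervalIntegral_add_eq s 0
  rw [zero_add] at e1 e2 e3 e4
  rw [add_comm (Real.pi / 2) s] at e1 e2
  rw [e1, e2, e3, e4] at key
  exact key

/-- For a `π`-periodic function, the increments over a quarter turn are controlled by the
derivative with the constant of the second harmonic. -/
theorem integral_sq_quarter_increment_le {U U' : ℝ → ℝ} (hU : ∀ x, HasDerivAt U (U' x) x)
    (hU' : Continuous U') (hper : Function.Periodic U Real.pi) :
    ∫ x in (0 : ℝ)..Real.pi, (U (x + Real.pi / 2) - U x) ^ 2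
      ≤ ∫ x in (0 : ℝ)..Real.pi, U' x ^ 2 := by
  have hpi := Real.pi_pos
  have hUc : Continuous U := continuous_iff_continuousAt.mpr fun x => (hU x).continuousAt
  set V : ℝ → ℝ := fun x => U (x + Real.pi / 2) - U x with hV
  set V' : ℝ → ℝ := fun x => U' (x + Real.pi / 2) - U' x with hV'
  have hVd : ∀ x, HasDerivAt V (V' x) x := fun x =>
    ((hU (x + Real.pi / 2)).comp_add_const x (Real.pi / 2)).sub (hU x)
  have hV'c : Continuous V' := by fun_prop
  have hVc : Continuous V := by fun_prop
  have hanti : Function.Antiperiodic V (Real.pi / 2) := fun x => by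
    simp only [hV]
    rw [add_assoc x, add_halves, hper x]; ring
  have key := wirtinger_antiperiodic hVd hV'c hanti
  have split : ∀ g : ℝ → ℝ, Continuous g → ∫ x in (0 : ℝ)..Real.pi, g x
      = (∫ x in (0 : ℝ)..(Real.pi / 2), g x)
        + ∫ x in (0 : ℝ)..(Real.pi / 2), g (x + Real.pi / 2) := fun g hg => by
    rw [intervalIntegral.integral_comp_add_right g, zero_add, add_halves,
      intervalIntegral.integral_add_adjacent_intervals (hg.intervalIntegrable _ _)
        (hg.intervalIntegrable _ _)]
  have e1 : ∫ x in (0 : ℝ)..Real.pi, V x ^ 2 = 2 * ∫ x in (0 : ℝ)..(Real.pi / 2), V x ^ 2 := by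
    rw [split (fun x => V x ^ 2) (hVc.pow 2)]
    have : ∀ x, V (x + Real.pi / 2) ^ 2 = V x ^ 2 := fun x => by rw [hanti x]; ring
    simp_rw [this]; ring
  have e2 : ∫ x in (0 : ℝ)..(Real.pi / 2), V' x ^ 2
      ≤ 2 * ∫ x in (0 : ℝ)..Real.pi, U' x ^ 2 := by
    rw [split (fun x => U' x ^ 2) (hU'.pow 2), ← intervalIntegral.integral_add
      ((by fun_prop : Continuous fun x => U' x ^ 2).intervalIntegrable _ _) ((by fun_prop : Continuous
        fun x => U' (x + Real.pi / 2) ^ 2).intervalIntegrable _ _),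
      ← intervalIntegral.integral_const_mul]
    refine intervalIntegral.integral_mono (by positivity) ((hV'c.pow 2).intervalIntegrable _ _)
      ((by fun_prop : Continuous fun x => 2 * (U' x ^ 2 + U' (x + Real.pi / 2) ^ 2)).intervalIntegrable
        _ _) fun x => ?_
    simp only [hV']
    nlinarith [sq_nonneg (U' (x + Real.pi / 2) + U' x)]
  linarith

/-! ### A Poincaré inequality for even functions and the Gaussian weight -/

/-- A linear map of `V × V` that preserves the Euclidean norm preserves the Lebesgue measure. -/
theorem measurePreserving_of_norm_sq_add {V : Type*} [NormedAddCommGroup V] [InnerProductSpace ℝ V]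
    [FiniteDimensional ℝ V] [MeasurableSpace V] [BorelSpace V] (A : V × V →ₗ[ℝ] V × V)
    (hA : ∀ p, ‖(A p).1‖ ^ 2 + ‖(A p).2‖ ^ 2 = ‖p.1‖ ^ 2 + ‖p.2‖ ^ 2) :
    MeasurePreserving A (volume : Measure (V × V)) volume := by
  let e := WithLp.linearEquiv 2 ℝ (V × V)
  let B : WithLp 2 (V × V) →ₗᵢ[ℝ] WithLp 2 (V × V) :=
    { toLinearMap := e.symm.toLinearMap ∘ₗ A ∘ₗ e.toLinearMap
      norm_map' := fun x => by
        rw [← sq_eq_sq₀ (norm_nonneg _) (norm_nonneg _), WithLp.prod_norm_sq_eq_of_L2,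
          WithLp.prod_norm_sq_eq_of_L2]
        exact hA (e x) }
  have h := (WithLp.volume_preserving_ofLp V V).comp
    (((B.toLinearIsometryEquiv rfl).measurePreserving).comp (WithLp.volume_preserving_toLp V V))
  exact h

/-- The Gaussian weight `e^{-|x|²/2}`. -/
def gaussWeight {d : ℕ} (x : Vel d) : ℝ := Real.exp (-(‖x‖ ^ 2) / 2)

theorem gaussWeight_pos {d : ℕ} (x : Vel d) : 0 < gaussWeight x := Real.exp_pos _

theorem continuous_gaussWeight {d : ℕ} : Continuous (gaussWeight (d := d)) := by
  unfold gaussWeight; fun_prop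

theorem integrable_norm_pow_mul_gaussWeight {d : ℕ} (hd : 1 ≤ d) (n : ℕ) :
    Integrable fun x : Vel d => ‖x‖ ^ n * gaussWeight x := by
  have hdim : Module.finrank ℝ (Vel d) = d := by simp
  have : Nontrivial (Vel d) := Module.nontrivial_of_finrank_pos (R := ℝ) (by omega)
  have h := (integrable_fun_norm_addHaar (volume : Measure (Vel d))
    (f := fun r => r ^ n * Real.exp (-(r ^ 2) / 2))).mpr ?_
  · exact h
  · rw [hdim]
    have := integrableOn_rpow_mul_exp_neg_mul_sq (b := 1 / 2) (by norm_num)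
      (s := ((d - 1 + n : ℕ) : ℝ)) (by
        have : (0 : ℝ) ≤ ((d - 1 + n : ℕ) : ℝ) := by positivity
        linarith)
    refine this.congr_fun (fun x _ => ?_) measurableSet_Ioi
    simp only [Real.rpow_natCast, smul_eq_mul]
    rw [pow_add, mul_assoc]
    congr 3
    ring

theorem integrable_gaussWeight {d : ℕ} (hd : 1 ≤ d) : Integrable (gaussWeight (d := d)) := by
  simpa using integrable_norm_pow_mul_gaussWeight hd 0

theorem hasGradientAt_gaussWeight {d : ℕ} (x : Vel d) :
    HasFDerivAt (gaussWeight (d := d)) (-(gaussWeight x) • innerSL ℝ x) x := by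
  have h1 : HasFDerivAt (fun x : Vel d => ‖x‖ ^ 2) (2 • innerSL ℝ x) x :=
    (hasStrictFDerivAt_norm_sq x).hasFDerivAt
  have h2 := ((h1.neg).mul_const (1 / 2 : ℝ)).exp
  have e : (fun x : Vel d => Real.exp (-(‖x‖ ^ 2) * (1 / 2))) = gaussWeight := by
    funext x; simp [gaussWeight]; ring_nf
  have h3 : HasFDerivAt (fun x : Vel d => Real.exp (-(‖x‖ ^ 2) * (1 / 2))) _ x := h2
  rw [e] at h3
  refine h3.congr_fderiv ?_
  ext y
  simp [gaussWeight]
  left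
  ring_nf

/-- The covariance of the Gaussian weight is the identity. -/
theorem integral_inner_sq_mul_gaussWeight {d : ℕ} (hd : 1 ≤ d) (a : Vel d) :
    ∫ y : Vel d, inner ℝ a y ^ 2 * gaussWeight y = ‖a‖ ^ 2 * ∫ y : Vel d, gaussWeight y := by
  have hin : ∀ y : Vel d, |inner ℝ a y| ≤ ‖a‖ * ‖y‖ := fun y => abs_real_inner_le_norm a y
  have hf : ∀ y, HasFDerivAt (fun y : Vel d => inner ℝ a y) (innerSL ℝ a) y := fun y =>
    (innerSL ℝ a).hasFDerivAt
  have hcin : Continuous fun y : Vel d => inner ℝ a y := by fun_prop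
  have i1 : Integrable fun y : Vel d => inner ℝ a y * gaussWeight y := by
    refine ((integrable_norm_pow_mul_gaussWeight hd 1).const_mul ‖a‖).mono'
      (hcin.mul continuous_gaussWeight).aestronglyMeasurable (Filter.Eventually.of_forall fun y => ?_)
    rw [norm_mul, Real.norm_eq_abs, Real.norm_of_nonneg (gaussWeight_pos y).le, pow_one, ← mul_assoc]
    exact mul_le_mul_of_nonneg_right (hin y) (gaussWeight_pos y).le
  have i2 : Integrable fun y : Vel d => inner ℝ a y ^ 2 * gaussWeight y := by
    refine ((integrable_norm_pow_mul_gaussWeight hd 2).const_mul (‖a‖ ^ 2)).mono'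
      ((hcin.pow 2).mul continuous_gaussWeight).aestronglyMeasurable
      (Filter.Eventually.of_forall fun y => ?_)
    rw [norm_mul, Real.norm_eq_abs, Real.norm_of_nonneg (gaussWeight_pos y).le, ← mul_assoc,
      abs_pow, ← mul_pow]
    have := hin y
    have := gaussWeight_pos y
    gcongr
  have e1 : ∀ y : Vel d, fderiv ℝ (gaussWeight (d := d)) y a = -(inner ℝ a y * gaussWeight y) :=
    fun y => by
      rw [(hasGradientAt_gaussWeight y).fderiv]
      simp [real_inner_comm]
      ring
  have e2 : ∀ y : Vel d, fderiv ℝ (fun y : Vel d => inner ℝ a y) y a = ‖a‖ ^ 2 := fun y => by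
    rw [(hf y).fderiv]; simp
  have key := integral_mul_fderiv_eq_neg_fderiv_mul_of_integrable (μ := (volume : Measure (Vel d)))
    (f := fun y : Vel d => inner ℝ a y) (g := gaussWeight) (v := a)
    (by simp_rw [e2]; exact (integrable_gaussWeight hd).const_mul _)
    (by simp_rw [e1]; refine i2.neg.congr (Filter.Eventually.of_forall fun y => ?_); simp; ring) i1
    (fun y _ => (hf y).differentiableAt) (fun y _ => (hasGradientAt_gaussWeight y).differentiableAt)
  simp_rw [e1, e2] at key
  rw [integral_const_mul] at key
  have e3 : ∫ y : Vel d, inner ℝ a y * -(inner ℝ a y * gaussWeight y)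
      = -∫ y : Vel d, inner ℝ a y ^ 2 * gaussWeight y := by
    rw [← integral_neg]
    refine integral_congr_ae (Filter.Eventually.of_forall fun y => ?_)
    simp only; ring
  rw [e3] at key
  linarith

/-- The rotation `(x, y) ↦ (cos s x + sin s y, - sin s x + cos s y)` of `V × V`. -/
def pairRot {V : Type*} [AddCommGroup V] [Module ℝ V] (s : ℝ) : V × V →ₗ[ℝ] V × V where
  toFun p := (Real.cos s • p.1 + Real.sin s • p.2, Real.cos s • p.2 - Real.sin s • p.1)
  map_add' p q := by ext <;> simp <;> module
  map_smul' c p := by ext <;> simp <;> module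

theorem pairRot_norm_sq {V : Type*} [NormedAddCommGroup V] [InnerProductSpace ℝ V] (s : ℝ)
    (p : V × V) :
    ‖(pairRot s p).1‖ ^ 2 + ‖(pairRot s p).2‖ ^ 2 = ‖p.1‖ ^ 2 + ‖p.2‖ ^ 2 := by
  simp only [pairRot, LinearMap.coe_mk, AddHom.coe_mk]
  rw [norm_add_sq_real, norm_sub_sq_real]
  simp only [norm_smul, mul_pow, inner_smul_left, inner_smul_right, real_inner_comm p.1 p.2,
    Real.norm_eq_abs, sq_abs, conj_trivial]
  linear_combination (‖p.1‖ ^ 2 + ‖p.2‖ ^ 2) * Real.sin_sq_add_cos_sq s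

theorem pairRot_fst {V : Type*} [AddCommGroup V] [Module ℝ V] (s : ℝ) (p : V × V) :
    (pairRot s p).1 = Real.cos s • p.1 + Real.sin s • p.2 := rfl

theorem pairRot_snd {V : Type*} [AddCommGroup V] [Module ℝ V] (s : ℝ) (p : V × V) :
    (pairRot s p).2 = (pairRot (s + Real.pi / 2) p).1 := by
  simp [pairRot, Real.cos_add_pi_div_two, Real.sin_add_pi_div_two]
  module

/-- Gaussian Poincaré inequality for even functions, with the constant of the second Hermite
polynomials. For independent Gaussian vectors `x` and `y`, the function
`s ↦ u (cos s x + sin s y)` is `π`-periodic, takes the values `u x` and `u y` at `0` and `π / 2`,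
and is stationary in distribution: the inequality follows from the one-dimensional one by
averaging. -/
theorem gaussian_poincare_even {d : ℕ} (hd : 1 ≤ d) {u : Vel d → ℝ} {u' : Vel d → Vel d}
    {C : ℝ} (hu : ∀ x, HasGradientAt u (u' x) x) (hu'c : Continuous u') (heven : ∀ x, u (-x) = u x)
    (hub : ∀ x, |u x| ≤ C * ‖x‖ ^ 2) (hu'b : ∀ x, ‖u' x‖ ≤ C * ‖x‖)
    (hmean : ∫ x, u x * gaussWeight x = 0) :
    2 * ∫ x, u x ^ 2 * gaussWeight x ≤ ∫ x, ‖u' x‖ ^ 2 * gaussWeight x := by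
  have hpi := Real.pi_pos
  have huc : Continuous u := continuous_iff_continuousAt.mpr fun x =>
    (hu x).differentiableAt.continuousAt
  set e : Vel d → ℝ := gaussWeight with he
  have hec : Continuous e := continuous_gaussWeight
  have he0 : ∀ x, 0 < e x := gaussWeight_pos
  set Z := ∫ x, e x with hZ
  have hZ0 : 0 < Z := by
    exact integral_exp_pos (integrable_gaussWeight hd)
  set A : Vel d × Vel d → ℝ := fun p => (u p.2 - u p.1) ^ 2 * (e p.1 * e p.2) with hA
  set B : Vel d × Vel d → ℝ := fun p => inner ℝ (u' p.1) p.2 ^ 2 * (e p.1 * e p.2) with hB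
  set M : Vel d × Vel d → ℝ := fun p => (‖p.1‖ ^ 2 + ‖p.2‖ ^ 2) ^ 2 * (e p.1 * e p.2) with hM
  have hMint : Integrable M := by
    have h4 := (integrable_norm_pow_mul_gaussWeight hd 4).mul_prod (integrable_gaussWeight hd)
    have h22 := (integrable_norm_pow_mul_gaussWeight hd 2).mul_prod
      (integrable_norm_pow_mul_gaussWeight hd 2)
    have h04 := (integrable_gaussWeight hd).mul_prod (integrable_norm_pow_mul_gaussWeight hd 4)
    refine ((h4.add (h22.const_mul 2)).add h04).congr (Filter.Eventually.of_forall fun p => ?_)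
    simp [hM, he]; ring
  have hAc : Continuous A := by fun_prop
  have hBc : Continuous B := by fun_prop
  have hMrot : ∀ s p, M (pairRot s p) = M p := fun s p => by
    have h := pairRot_norm_sq s p
    simp only [hM, he, gaussWeight, ← Real.exp_add]
    rw [h]
    congr 2
    linear_combination (-1 / 2 : ℝ) * h
  have hAM : ∀ p, ‖A p‖ ≤ C ^ 2 * 2 * M p := fun p => by
    have h1 := hub p.1
    have h2 := hub p.2
    have hee : 0 < e p.1 * e p.2 := mul_pos (he0 _) (he0 _)
    have : (u p.2 - u p.1) ^ 2 ≤ C ^ 2 * 2 * (‖p.1‖ ^ 2 + ‖p.2‖ ^ 2) ^ 2 := by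
      have h3 : |u p.2 - u p.1| ≤ C * (‖p.1‖ ^ 2 + ‖p.2‖ ^ 2) :=
        (abs_sub _ _).trans (by linarith)
      have h4 := pow_le_pow_left₀ (abs_nonneg _) h3 2
      rw [sq_abs, mul_pow] at h4
      have : 0 ≤ C ^ 2 * (‖p.1‖ ^ 2 + ‖p.2‖ ^ 2) ^ 2 := by positivity
      linarith
    rw [Real.norm_of_nonneg (by positivity)]
    simp only [hA, hM]
    nlinarith
  have hBM : ∀ p, ‖B p‖ ≤ C ^ 2 * 2 * M p := fun p => by
    have h1 := hu'b p.1
    have hee : 0 < e p.1 * e p.2 := mul_pos (he0 _) (he0 _)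
    have : inner ℝ (u' p.1) p.2 ^ 2 ≤ C ^ 2 * 2 * (‖p.1‖ ^ 2 + ‖p.2‖ ^ 2) ^ 2 := by
      have h3 : |inner ℝ (u' p.1) p.2| ≤ C * ‖p.1‖ * ‖p.2‖ :=
        (abs_real_inner_le_norm _ _).trans (by gcongr)
      have h4 := pow_le_pow_left₀ (abs_nonneg _) h3 2
      rw [sq_abs] at h4
      have : 0 ≤ C ^ 2 * (‖p.1‖ ^ 4 + ‖p.2‖ ^ 4) := by positivity
      nlinarith [mul_nonneg (sq_nonneg C) (mul_nonneg (sq_nonneg ‖p.1‖) (sq_nonneg ‖p.2‖))]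
    rw [Real.norm_of_nonneg (by positivity)]
    simp only [hB, hM]
    nlinarith
  -- for fixed `p`, the one-dimensional inequality
  have hone : ∀ p : Vel d × Vel d, ∫ s in (0 : ℝ)..Real.pi, A (pairRot s p)
      ≤ ∫ s in (0 : ℝ)..Real.pi, B (pairRot s p) := by
    intro p
    set U : ℝ → ℝ := fun s => u (pairRot s p).1 with hU
    set U' : ℝ → ℝ := fun s => inner ℝ (u' (pairRot s p).1) (pairRot s p).2 with hU'
    have hder : ∀ s, HasDerivAt (fun s => (pairRot s p).1) ((pairRot s p).2) s := fun s => by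
      have h1 := ((Real.hasDerivAt_cos s).smul_const p.1).fun_add
        ((Real.hasDerivAt_sin s).smul_const p.2)
      refine h1.congr_deriv ?_
      simp [pairRot]; module
    have hUd : ∀ s, HasDerivAt U (U' s) s := fun s => by
      have h1 := (hu (pairRot s p).1).hasFDerivAt.comp_hasDerivAt s (hder s)
      exact h1.congr_deriv (InnerProductSpace.toDual_apply_apply)
    have hpc : Continuous fun s => pairRot s p := by
      simp only [pairRot, LinearMap.coe_mk, AddHom.coe_mk]; fun_prop
    have hU'c : Continuous U' := by fun_prop
    have hper : Function.Periodic U Real.pi := fun s => by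
      simp only [hU, pairRot_fst, Real.cos_add_pi, Real.sin_add_pi]
      rw [← heven]
      congr 1
      module
    have key := integral_sq_quarter_increment_le hUd hU'c hper
    have hee : ∀ s, e (pairRot s p).1 * e (pairRot s p).2 = e p.1 * e p.2 := fun s => by
      have h := pairRot_norm_sq s p
      simp only [he, gaussWeight, ← Real.exp_add]
      congr 1
      linear_combination (-1 / 2 : ℝ) * h
    simp only [hA, hB, hee]
    rw [intervalIntegral.integral_mul_const, intervalIntegral.integral_mul_const]
    refine mul_le_mul_of_nonneg_right ?_ (mul_pos (he0 _) (he0 _)).le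
    refine le_trans (le_of_eq ?_) key
    refine intervalIntegral.integral_congr fun s _ => ?_
    simp only [hU, pairRot_snd]
  have hpc2 : Continuous fun q : ℝ × (Vel d × Vel d) => pairRot q.1 q.2 := by
    simp only [pairRot, LinearMap.coe_mk, AddHom.coe_mk]; fun_prop
  have hle : (0 : ℝ) ≤ Real.pi := hpi.le
  have hfub : ∀ H : Vel d × Vel d → ℝ, Continuous H → (∀ p, ‖H p‖ ≤ C ^ 2 * 2 * M p) →
      Integrable (fun q : ℝ × (Vel d × Vel d) => H (pairRot q.1 q.2))
        ((volume.restrict (Ioc 0 Real.pi)).prod volume) := fun H hH hHM => by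
    have h1 : Integrable (fun q : ℝ × (Vel d × Vel d) => (1 : ℝ) * (C ^ 2 * 2 * M q.2))
        ((volume.restrict (Ioc 0 Real.pi)).prod volume) :=
      (integrable_const (1 : ℝ)).mul_prod (hMint.const_mul _)
    refine h1.mono' (hH.comp hpc2).aestronglyMeasurable (Filter.Eventually.of_forall fun q => ?_)
    rw [one_mul, ← hMrot q.1 q.2]
    exact hHM _
  have hswap : ∀ H : Vel d × Vel d → ℝ, Continuous H → (∀ p, ‖H p‖ ≤ C ^ 2 * 2 * M p) →
      ∫ p, (∫ s in (0 : ℝ)..Real.pi, H (pairRot s p)) = Real.pi * ∫ p, H p := fun H hH hHM => by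
    simp_rw [intervalIntegral.integral_of_le hle]
    rw [← integral_integral_swap (f := fun s p => H (pairRot s p)) (hfub H hH hHM)]
    have h1 : ∀ s, ∫ p, H (pairRot s p) = ∫ p, H p := fun s => by
      have hmp := measurePreserving_of_norm_sq_add (pairRot (V := Vel d) s) (pairRot_norm_sq s)
      have h2 : AEStronglyMeasurable H (Measure.map (pairRot s) volume) :=
        hH.aestronglyMeasurable
      rw [← integral_map hmp.measurable.aemeasurable h2, hmp.map_eq]
    simp_rw [h1]
    simp [hle]
  have hint : ∀ H : Vel d × Vel d → ℝ, Continuous H → (∀ p, ‖H p‖ ≤ C ^ 2 * 2 * M p) →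
      Integrable fun p => ∫ s in (0 : ℝ)..Real.pi, H (pairRot s p) := fun H hH hHM => by
    simp_rw [intervalIntegral.integral_of_le hle]
    exact (hfub H hH hHM).integral_prod_right
  have hmain : ∫ p, A p ≤ ∫ p, B p := by
    have h1 := integral_mono (hint A hAc hAM) (hint B hBc hBM) hone
    rw [hswap A hAc hAM, hswap B hBc hBM] at h1
    exact le_of_mul_le_mul_left h1 hpi
  -- evaluation of both sides
  have iu : Integrable fun x => u x * e x := by
    refine ((integrable_norm_pow_mul_gaussWeight hd 2).const_mul C).mono'
      (huc.mul hec).aestronglyMeasurable (Filter.Eventually.of_forall fun x => ?_)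
    rw [norm_mul, Real.norm_eq_abs, Real.norm_of_nonneg (he0 x).le, ← mul_assoc]
    exact mul_le_mul_of_nonneg_right (hub x) (he0 x).le
  have iu2 : Integrable fun x => u x ^ 2 * e x := by
    refine ((integrable_norm_pow_mul_gaussWeight hd 4).const_mul (C ^ 2)).mono'
      ((huc.pow 2).mul hec).aestronglyMeasurable (Filter.Eventually.of_forall fun x => ?_)
    rw [norm_mul, Real.norm_eq_abs, Real.norm_of_nonneg (he0 x).le, ← mul_assoc, abs_pow]
    refine mul_le_mul_of_nonneg_right ?_ (he0 x).le
    have := pow_le_pow_left₀ (abs_nonneg _) (hub x) 2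
    nlinarith
  have eA : ∫ p, A p = 2 * (Z * ∫ x, u x ^ 2 * e x) := by
    have e1 : ∀ p : Vel d × Vel d, A p = (e p.1 * (u p.2 ^ 2 * e p.2)
        + (u p.1 ^ 2 * e p.1) * e p.2) - 2 * ((u p.1 * e p.1) * (u p.2 * e p.2)) := fun p => by
      simp only [hA]; ring
    have ie : Integrable e := integrable_gaussWeight hd
    simp_rw [e1]
    rw [integral_sub, integral_add, integral_const_mul]
    · rw [show (volume : Measure (Vel d × Vel d)) = volume.prod volume from rfl,
        integral_prod_mul e (fun x => u x ^ 2 * e x), integral_prod_mul (fun x => u x ^ 2 * e x) e,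
        integral_prod_mul (fun x => u x * e x) (fun x => u x * e x), hmean]
      ring
    · exact ie.mul_prod iu2
    · exact iu2.mul_prod ie
    · exact (ie.mul_prod iu2).add (iu2.mul_prod ie)
    · exact (iu.mul_prod iu).const_mul 2
  have iB : Integrable B := (hMint.const_mul (C ^ 2 * 2)).mono' hBc.aestronglyMeasurable
    (Filter.Eventually.of_forall hBM)
  have eB : ∫ p, B p = Z * ∫ x, ‖u' x‖ ^ 2 * e x := by
    rw [show (volume : Measure (Vel d × Vel d)) = volume.prod volume from rfl, integral_prod _ iB,
      ← integral_const_mul]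
    refine integral_congr_ae (Filter.Eventually.of_forall fun x => ?_)
    simp only [hB]
    have h1 : ∀ y, inner ℝ (u' x) y ^ 2 * (e x * e y) = e x * (inner ℝ (u' x) y ^ 2 * e y) :=
      fun y => by ring
    simp_rw [h1]
    rw [integral_const_mul, he, integral_inner_sq_mul_gaussWeight hd, ← he]
    ring
  rw [eA, eB] at hmain
  refine le_of_mul_le_mul_left ?_ hZ0
  linarith

/-! ### The Poincaré inequality for even functions on the sphere -/

theorem homExt_mul {d : ℕ} (f g : Sph d → ℝ) (x : Vel d) :
    homExt (fun k => f k * g k) x = homExt f x * homExt g x := by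
  by_cases hx : x = 0
  · simp [homExt, hx]
  · simp only [homExt_of_ne_zero _ hx]

/-- The gradient of a `0`-homogeneous function is homogeneous of degree `-1`. -/
theorem hasGradientAt_homExt_of_ne_zero {d : ℕ} {f : Sph d → ℝ}
    (hf : ∀ x : Vel d, x ≠ 0 → DifferentiableAt ℝ (homExt f) x) {x : Vel d} (hx : x ≠ 0) :
    HasGradientAt (homExt f) (‖x‖⁻¹ • sphGrad f ⟨‖x‖⁻¹ • x, normalize_mem hx⟩) x := by
  have hr : 0 < ‖x‖⁻¹ := inv_pos.mpr (norm_pos_iff.mpr hx)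
  have h1 : HasFDerivAt (homExt f) (fderiv ℝ (homExt f) (‖x‖⁻¹ • x)) (‖x‖⁻¹ • x) :=
    (hf _ (smul_ne_zero hr.ne' hx)).hasFDerivAt
  have h2 : HasFDerivAt (fun y : Vel d => ‖x‖⁻¹ • y) (‖x‖⁻¹ • ContinuousLinearMap.id ℝ (Vel d)) x :=
    (‖x‖⁻¹ • ContinuousLinearMap.id ℝ (Vel d)).hasFDerivAt
  have h3 := h1.comp x h2
  have e : homExt f ∘ (fun y : Vel d => ‖x‖⁻¹ • y) = homExt f := by
    funext y; exact homExt_smul f hr y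
  rw [e] at h3
  rw [hasGradientAt_iff_hasFDerivAt]
  refine h3.congr_fderiv ?_
  ext y
  simp [sphGrad]

/-- A `0`-homogeneous function has no radial derivative. -/
theorem inner_gradient_homExt_self {d : ℕ} {f : Sph d → ℝ} {x : Vel d}
    (hf : DifferentiableAt ℝ (homExt f) x) : inner ℝ (gradient (homExt f) x) x = 0 := by
  have h1 : HasDerivAt (fun t : ℝ => (1 + t) • x) x 0 := by
    simpa using ((hasDerivAt_id (0 : ℝ)).const_add 1).smul_const x
  have h2 : HasFDerivAt (homExt f) (fderiv ℝ (homExt f) x) ((1 + (0 : ℝ)) • x) := by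
    simpa using hf.hasFDerivAt
  have h3 := h2.comp_hasDerivAt (0 : ℝ) h1
  have h4 : HasDerivAt (homExt f ∘ fun t : ℝ => (1 + t) • x) 0 0 := by
    refine (hasDerivAt_const (0 : ℝ) (homExt f x)).congr_of_eventuallyEq ?_
    filter_upwards [Ioi_mem_nhds (show (-1 : ℝ) < 0 by norm_num)] with t ht
    exact homExt_smul f (by linarith [mem_Ioi.mp ht]) x
  rw [inner_gradient_left]
  exact h3.unique h4

theorem IsCkOnSphere.continuous_sphGrad {d : ℕ} {r : ℕ∞} (hr : 1 ≤ r) {f : Sph d → ℝ}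
    (hf : IsCkOnSphere r f) : Continuous (sphGrad f) := by
  have h1 : Continuous fun k : Sph d => fderiv ℝ (homExt f) (k : Vel d) :=
    (hf.continuousOn_fderiv hr).comp_continuous continuous_subtype_val fun k => sph_ne_zero k
  exact (InnerProductSpace.toDual ℝ (Vel d)).symm.continuous.comp h1

theorem radial_moment_succ (n : ℕ) :
    ∫ r in Ioi (0 : ℝ), r ^ (n + 2) * Real.exp (-(r ^ 2) / 2)
      = (n + 1) * ∫ r in Ioi (0 : ℝ), r ^ n * Real.exp (-(r ^ 2) / 2) := by
  have key : ∀ m : ℕ, ∫ r in Ioi (0 : ℝ), r ^ m * Real.exp (-(r ^ 2) / 2)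
      = (1 / 2 : ℝ) ^ (-((m : ℝ) + 1) / 2) * (1 / 2) * Real.Gamma (((m : ℝ) + 1) / 2) := fun m => by
    rw [← integral_rpow_mul_exp_neg_mul_rpow (p := 2) (q := m) (b := 1 / 2) (by norm_num)
      (by have : (0 : ℝ) ≤ m := by positivity
          linarith) (by norm_num)]
    refine setIntegral_congr_fun measurableSet_Ioi fun x _ => ?_
    simp only [Real.rpow_natCast, Real.rpow_ofNat]
    congr 2
    ring
  rw [key, key]
  push_cast
  have e1 : ((n : ℝ) + 2 + 1) / 2 = ((n : ℝ) + 1) / 2 + 1 := by ring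
  have e2 : -((n : ℝ) + 2 + 1) / 2 = -((n : ℝ) + 1) / 2 - 1 := by ring
  rw [e1, e2, Real.Gamma_add_one (by positivity), Real.rpow_sub_one (by norm_num)]
  ring

theorem gaussian_moment_pos (n : ℕ) :
    0 < ∫ r in Ioi (0 : ℝ), r ^ n * Real.exp (-(r ^ 2) / 2) := by
  have h := integral_rpow_mul_exp_neg_mul_rpow (p := 2) (q := n) (b := 1 / 2) (by norm_num)
      (by have : (0 : ℝ) ≤ n := by positivity
          linarith) (by norm_num)
  have e : ∫ r in Ioi (0 : ℝ), r ^ n * Real.exp (-(r ^ 2) / 2)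
      = ∫ x in Ioi (0 : ℝ), x ^ (n : ℝ) * Real.exp (-(1 / 2) * x ^ (2 : ℝ)) := by
    refine setIntegral_congr_fun measurableSet_Ioi fun x _ => ?_
    simp only [Real.rpow_natCast, Real.rpow_ofNat]
    congr 2
    ring
  rw [e, h]
  have := Real.Gamma_pos_of_pos (show 0 < ((n : ℝ) + 1) / 2 by positivity)
  positivity

theorem integral_norm_pow_mul_gaussWeight_mul_homExt {d : ℕ} (hd : 1 ≤ d) (n : ℕ) (φ : Sph d → ℝ) :
    ∫ x : Vel d, ‖x‖ ^ n * gaussWeight x * homExt φ x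
      = (∫ σ, φ σ ∂(surf d)) * ∫ r in Ioi (0 : ℝ), r ^ (d - 1 + n) * Real.exp (-(r ^ 2) / 2) := by
  have h := integral_radial_mul_homExt hd (fun r => r ^ n * Real.exp (-(r ^ 2) / 2)) φ
  refine h.trans ?_
  congr 1
  refine setIntegral_congr_fun measurableSet_Ioi fun x _ => ?_
  simp only [pow_add]; ring

theorem homExt_neg_of_even {d : ℕ} {f : Sph d → ℝ} (hf : ∀ k, f (-k) = f k) (x : Vel d) :
    homExt f (-x) = homExt f x := by
  by_cases hx : x = 0
  · simp [hx]
  · rw [homExt_of_ne_zero f hx, homExt_of_ne_zero f (neg_ne_zero.mpr hx), ← hf]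
    congr 1
    ext1
    simp

/-- Poincaré inequality for even mean-zero functions on the sphere, with the constant `2d` of the
spherical harmonics of degree two. It is the Gaussian inequality `gaussian_poincare_even` for the
`2`-homogeneous extension `|x|² f (x / |x|)`. -/
theorem sphere_poincare_even_of_mean_zero {d : ℕ} (hd : 1 ≤ d) {r : ℕ∞} (hr : 1 ≤ r)
    {f : Sph d → ℝ} (hf : IsCkOnSphere r f) (heven : ∀ k, f (-k) = f k)
    (hmean : ∫ k, f k ∂(surf d) = 0) :
    2 * d * ∫ k, f k ^ 2 ∂(surf d) ≤ ∫ k, gammaOne f f k ∂(surf d) := by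
  have hfd : ∀ x : Vel d, x ≠ 0 → DifferentiableAt ℝ (homExt f) x := fun x hx =>
    hf.differentiableAt hr hx
  have hfc := hf.continuous
  have hgc := hf.continuous_sphGrad hr
  obtain ⟨C₁, hC₁⟩ := exists_bound_sph hfc
  obtain ⟨C₂, hC₂⟩ := exists_bound_sph hgc.norm
  set u : Vel d → ℝ := fun x => ‖x‖ ^ 2 * homExt f x with hu
  set u' : Vel d → Vel d := fun x => (2 * homExt f x) • x + ‖x‖ ^ 2 • gradient (homExt f) x with hu'
  have hgrad : ∀ (x : Vel d) (hx : x ≠ 0), gradient (homExt f) x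
      = ‖x‖⁻¹ • sphGrad f ⟨‖x‖⁻¹ • x, normalize_mem hx⟩ := fun x hx =>
    (hasGradientAt_homExt_of_ne_zero hfd hx).gradient
  have hhb : ∀ x : Vel d, |homExt f x| ≤ |C₁| := fun x => by
    by_cases hx : x = 0
    · simp [homExt, hx]
    · rw [homExt_of_ne_zero f hx]; exact (hC₁ _).trans (le_abs_self _)
  have hub : ∀ x, |u x| ≤ (2 * |C₁| + |C₂|) * ‖x‖ ^ 2 := fun x => by
    simp only [hu]
    rw [abs_mul, abs_of_nonneg (by positivity), mul_comm]
    have := hhb x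
    have := abs_nonneg C₁
    have := abs_nonneg C₂
    gcongr
    linarith
  have hu'b : ∀ x, ‖u' x‖ ≤ (2 * |C₁| + |C₂|) * ‖x‖ := fun x => by
    simp only [hu']
    refine (norm_add_le _ _).trans ?_
    have h1 : ‖(2 * homExt f x) • x‖ ≤ 2 * |C₁| * ‖x‖ := by
      rw [norm_smul, Real.norm_eq_abs, abs_mul, abs_two]
      have := hhb x
      gcongr
    have h2 : ‖‖x‖ ^ 2 • gradient (homExt f) x‖ ≤ |C₂| * ‖x‖ := by
      by_cases hx : x = 0
      · simp [hx]
      · have hn : 0 < ‖x‖ := norm_pos_iff.mpr hx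
        rw [hgrad x hx, smul_smul, norm_smul]
        have h3 := (le_abs_self _).trans ((hC₂ ⟨‖x‖⁻¹ • x, normalize_mem hx⟩).trans (le_abs_self C₂))
        have e : ‖x‖ ^ 2 * ‖x‖⁻¹ = ‖x‖ := by field_simp
        rw [e, Real.norm_of_nonneg hn.le, mul_comm]
        gcongr
    linarith
  have hu0 : ∀ x, HasGradientAt u (u' x) x := by
    intro x
    rw [hasGradientAt_iff_hasFDerivAt]
    by_cases hx : x = 0
    · subst hx
      have e : u' 0 = 0 := by simp [hu']
      rw [e, map_zero]
      refine HasFDerivAt.of_isLittleO ?_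
      have h1 : (fun x : Vel d => u x - u 0 - (0 : Vel d →L[ℝ] ℝ) (x - 0)) =O[nhds 0]
          fun x => ‖x‖ ^ 2 := by
        refine Asymptotics.IsBigO.of_bound (2 * |C₁| + |C₂|) (Filter.Eventually.of_forall fun x => ?_)
        have : u 0 = 0 := by simp [hu]
        simpa [this] using hub x
      refine h1.trans_isLittleO ?_
      have h2 := Asymptotics.isLittleO_norm_pow_norm_pow (E' := Vel d) (show 1 < 2 by norm_num)
      simp only [sub_zero]
      exact Asymptotics.isLittleO_norm_right.mp (by simpa using h2)
    · have h1 : HasFDerivAt (fun x : Vel d => ‖x‖ ^ 2) (2 • innerSL ℝ x) x :=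
        (hasStrictFDerivAt_norm_sq x).hasFDerivAt
      refine (h1.mul (hfd x hx).hasFDerivAt).congr_fderiv ?_
      ext y
      simp [hu']
      ring
  have hu'c : Continuous u' := by
    rw [continuous_iff_continuousAt]
    intro x
    by_cases hx : x = 0
    · subst hx
      have e : u' 0 = 0 := by simp [hu']
      rw [ContinuousAt, e]
      refine squeeze_zero_norm hu'b ?_
      have : Continuous fun x : Vel d => (2 * |C₁| + |C₂|) * ‖x‖ := by fun_prop
      simpa using this.tendsto 0
    · have hnhds : ({0}ᶜ : Set (Vel d)) ∈ nhds x := isOpen_compl_singleton.mem_nhds hx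
      have h1 : ContinuousAt (homExt f) x := (hfd x hx).continuousAt
      have h2 : ContinuousAt (gradient (homExt f)) x :=
        (InnerProductSpace.toDual ℝ (Vel d)).symm.continuous.continuousAt.comp
          ((hf.continuousOn_fderiv hr).continuousAt hnhds)
      exact ((continuousAt_const.mul h1).smul continuousAt_id).add
        ((by fun_prop : ContinuousAt (fun x : Vel d => ‖x‖ ^ 2) x).smul h2)
  have hueven : ∀ x, u (-x) = u x := fun x => by
    simp only [hu, norm_neg, homExt_neg_of_even heven]
  have humean : ∫ x, u x * gaussWeight x = 0 := by
    have h := integral_norm_pow_mul_gaussWeight_mul_homExt hd 2 f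
    rw [hmean, zero_mul] at h
    rw [← h]
    refine integral_congr_ae (Filter.Eventually.of_forall fun x => ?_)
    simp only [hu]; ring
  have key := gaussian_poincare_even hd hu0 hu'c hueven hub hu'b humean
  have e1 : ∫ x, u x ^ 2 * gaussWeight x = (∫ k, f k ^ 2 ∂(surf d)) *
      ∫ r in Ioi (0 : ℝ), r ^ (d - 1 + 4) * Real.exp (-(r ^ 2) / 2) := by
    rw [← integral_norm_pow_mul_gaussWeight_mul_homExt hd 4]
    refine integral_congr_ae (Filter.Eventually.of_forall fun x => ?_)
    simp only [hu, pow_two (f _), homExt_mul]; ring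
  have e2 : ∫ x, ‖u' x‖ ^ 2 * gaussWeight x
      = (∫ k, (4 * f k ^ 2 + gammaOne f f k) ∂(surf d)) *
      ∫ r in Ioi (0 : ℝ), r ^ (d - 1 + 2) * Real.exp (-(r ^ 2) / 2) := by
    rw [← integral_norm_pow_mul_gaussWeight_mul_homExt hd 2]
    refine integral_congr_ae (Filter.Eventually.of_forall fun x => ?_)
    simp only
    by_cases hx : x = 0
    · simp [hu', hx]
    · have hn : 0 < ‖x‖ := norm_pos_iff.mpr hx
      have h0 := inner_gradient_homExt_self (hfd x hx)
      have h1 : ‖u' x‖ ^ 2 = 4 * homExt f x ^ 2 * ‖x‖ ^ 2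
          + ‖x‖ ^ 4 * ‖gradient (homExt f) x‖ ^ 2 := by
        simp only [hu']
        rw [norm_add_sq_real, inner_smul_left, inner_smul_right, real_inner_comm, h0, norm_smul,
          norm_smul, mul_pow, mul_pow, Real.norm_eq_abs, Real.norm_eq_abs, sq_abs, sq_abs]
        ring
      rw [h1, hgrad x hx, norm_smul, homExt_of_ne_zero _ hx, homExt_of_ne_zero _ hx, gammaOne,
        real_inner_self_eq_norm_sq, norm_inv, norm_norm]
      field_simp
  have e3 := radial_moment_succ (d - 1 + 2)
  have e4 : ((d - 1 + 2 : ℕ) : ℝ) + 1 = d + 2 := by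
    have : d - 1 + 2 = d + 1 := by omega
    rw [this]; push_cast; ring
  have hpos := gaussian_moment_pos (d - 1 + 2)
  have hγc : Continuous (gammaOne f f) := by
    unfold gammaOne; exact hgc.inner hgc
  rw [e1, e2, e3, e4, integral_add (integrable_surf_of_continuous (by fun_prop))
    (integrable_surf_of_continuous hγc), integral_const_mul] at key
  have : 2 * (d + 2) * ∫ k, f k ^ 2 ∂(surf d)
      ≤ 4 * (∫ k, f k ^ 2 ∂(surf d)) + ∫ k, gammaOne f f k ∂(surf d) := by
    refine le_of_mul_le_mul_right ?_ hpos
    linarith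
  linarith

theorem homExt_sub_const {d : ℕ} (f : Sph d → ℝ) (m : ℝ) {x : Vel d} (hx : x ≠ 0) :
    homExt (fun k => f k - m) x = homExt f x - m := by
  simp only [homExt_of_ne_zero _ hx]

theorem surf_real_univ_pos {d : ℕ} (hd : 1 ≤ d) : 0 < (surf d).real univ := by
  have hdim : Module.finrank ℝ (Vel d) = d := by simp
  have : Nontrivial (Vel d) := Module.nontrivial_of_finrank_pos (R := ℝ) (by omega)
  unfold surf
  rw [Measure.real, ENNReal.toReal_pos_iff]
  exact ⟨Measure.measure_univ_pos.mpr (Measure.toSphere_ne_zero _), measure_lt_top _ _⟩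

/-- Poincaré inequality for even functions on the sphere. -/
theorem sphere_poincare_even {d : ℕ} (hd : 1 ≤ d) {r : ℕ∞} (hr : 1 ≤ r)
    {f : Sph d → ℝ} (hf : IsCkOnSphere r f) (heven : ∀ k, f (-k) = f k) :
    2 * d * ((surf d).real univ * (∫ k, f k ^ 2 ∂(surf d)) - (∫ k, f k ∂(surf d)) ^ 2)
      ≤ (surf d).real univ * ∫ k, gammaOne f f k ∂(surf d) := by
  have hS := surf_real_univ_pos hd
  set S := (surf d).real univ with hSdef
  set m := (∫ k, f k ∂(surf d)) / S with hm
  have hfc := hf.continuous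
  have hmS : ∫ k, f k ∂(surf d) = m * S := by rw [hm]; field_simp
  have hf0 : IsCkOnSphere r fun k => f k - m := by
    have h1 : ContDiffOn ℝ (r : WithTop ℕ∞) (fun x : Vel d => homExt f x - m) {0}ᶜ :=
      ContDiffOn.sub hf contDiffOn_const
    exact h1.congr fun x hx => homExt_sub_const f m hx
  have hmean : ∫ k, (f k - m) ∂(surf d) = 0 := by
    rw [integral_sub (integrable_surf_of_continuous hfc) (integrable_const _), integral_const,
      hmS, smul_eq_mul, ← hSdef]
    ring
  have key := sphere_poincare_even_of_mean_zero hd hr hf0 (fun k => by rw [heven]) hmean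
  have e1 : ∫ k, (f k - m) ^ 2 ∂(surf d) = (∫ k, f k ^ 2 ∂(surf d)) - m ^ 2 * S := by
    have e : ∀ k, (f k - m) ^ 2 = f k ^ 2 - 2 * m * f k + m ^ 2 := fun k => by ring
    simp_rw [e]
    have i1 : Integrable (fun k => f k ^ 2) (surf d) := integrable_surf_of_continuous (hfc.pow 2)
    have i2 : Integrable (fun k => 2 * m * f k) (surf d) :=
      (integrable_surf_of_continuous hfc).const_mul _
    have i3 : Integrable (fun k => f k ^ 2 - 2 * m * f k) (surf d) := i1.sub i2
    rw [integral_add i3 (integrable_const _), integral_sub i1 i2, integral_const_mul, hmS,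
      integral_const, smul_eq_mul, ← hSdef]
    ring
  have e2 : gammaOne (fun k => f k - m) (fun k => f k - m) = gammaOne f f := by
    funext k
    have : sphGrad (fun k => f k - m) k = sphGrad f k := by
      unfold sphGrad
      have h1 : HasGradientAt (homExt f) (gradient (homExt f) (k : Vel d)) (k : Vel d) :=
        (hf.differentiableAt hr (sph_ne_zero k)).hasGradientAt
      have h2 : HasGradientAt (fun x => homExt f x - m) (gradient (homExt f) (k : Vel d))
          (k : Vel d) := by
        rw [hasGradientAt_iff_hasFDerivAt] at h1 ⊢
        exact h1.sub_const m
      refine (h2.congr_of_eventuallyEq ?_).gradient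
      filter_upwards [isOpen_compl_singleton.mem_nhds (sph_ne_zero k)] with x hx
      exact homExt_sub_const f m hx
    rw [gammaOne, this, gammaOne]
  rw [e1, e2] at key
  rw [hmS]
  have := mul_le_mul_of_nonneg_left key hS.le
  linarith

/-! ### Constant angular kernels -/

theorem IsCkOnSphere.sqrt {d : ℕ} {r : ℕ∞} {F : Sph d → ℝ} (hF : IsCkOnSphere r F)
    (hpos : ∀ k, 0 < F k) : IsCkOnSphere r fun k => Real.sqrt (F k) := by
  have h1 : ContDiffOn ℝ (r : WithTop ℕ∞) (fun x => Real.sqrt (homExt F x)) {0}ᶜ :=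
    ContDiffOn.sqrt hF fun x hx => by
      rw [homExt_of_ne_zero F hx]; exact (hpos _).ne'
  exact h1.congr fun x hx => by simp only [homExt_of_ne_zero _ hx]

/-- Chain rule for the intrinsic gradient. -/
theorem sphGrad_comp {d : ℕ} {F : Sph d → ℝ} {φ : ℝ → ℝ} {φ' : ℝ} {k : Sph d}
    (hF : DifferentiableAt ℝ (homExt F) (k : Vel d)) (hφ : HasDerivAt φ φ' (F k)) :
    HasGradientAt (homExt fun σ => φ (F σ)) (φ' • sphGrad F k) (k : Vel d) := by
  have h1 : HasDerivAt φ φ' (homExt F (k : Vel d)) := by rwa [homExt_coe]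
  have h2 := h1.comp_hasFDerivAt (k : Vel d) hF.hasFDerivAt
  rw [hasGradientAt_iff_hasFDerivAt]
  refine (h2.congr_of_eventuallyEq ?_).congr_fderiv ?_
  · filter_upwards [isOpen_compl_singleton.mem_nhds (sph_ne_zero k)] with x hx
    simp only [homExt_of_ne_zero _ hx, Function.comp_apply]
  · ext y
    simp [sphGrad]

theorem linBoltz_const {d : ℕ} (c : ℝ) {f : Sph d → ℝ} (hf : Continuous f) (k : Sph d) :
    linBoltz (fun _ => c) f k = c * ((∫ σ, f σ ∂(surf d)) - (surf d).real univ * f k) := by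
  rw [linBoltz, integral_mul_const, integral_sub (integrable_surf_of_continuous hf)
    (integrable_const _), integral_const, smul_eq_mul]
  ring

theorem continuous_gammaOne {d : ℕ} {f : Sph d → ℝ} (hf : Continuous (sphGrad f)) :
    Continuous (gammaOne f f) := by
  unfold gammaOne; exact hf.inner hf

/-- For a constant kernel the iterated carré du champ contains, besides a nonnegative average, a
multiple of `Γ₁`. -/
theorem gammaOneB_const {d : ℕ} (c : ℝ) {f : Sph d → ℝ} (hf : Continuous f)
    (hfd : ∀ k : Sph d, DifferentiableAt ℝ (homExt f) (k : Vel d)) (hg : Continuous (sphGrad f))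
    (k : Sph d) :
    gammaOneB (linBoltz fun _ => c) f k = c / 2 *
      ((∫ σ, gammaOne f f σ ∂(surf d)) + (surf d).real univ * gammaOne f f k) := by
  have h1 : sphGrad (linBoltz (fun _ => c) f) k = (-(c * (surf d).real univ)) • sphGrad f k := by
    have e : linBoltz (fun _ => c) f
        = fun σ => (fun t => c * ((∫ σ, f σ ∂(surf d)) - (surf d).real univ * t)) (f σ) := by
      funext σ; exact linBoltz_const c hf σ
    rw [e, sphGrad]
    refine (sphGrad_comp (φ := fun t => c * ((∫ σ, f σ ∂(surf d)) - (surf d).real univ * t))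
      (hfd k) ?_).gradient
    have := (((hasDerivAt_id (f k)).const_mul ((surf d).real univ)).const_sub
      (∫ σ, f σ ∂(surf d))).const_mul c
    refine this.congr_deriv ?_
    ring
  have h2 : gammaOne f (linBoltz (fun _ => c) f) k = -(c * (surf d).real univ) * gammaOne f f k := by
    rw [gammaOne, h1, inner_smul_right, gammaOne]
  rw [gammaOneB, h2, linBoltz_const c (continuous_gammaOne hg)]
  ring

theorem critDen_const {d : ℕ} (c : ℝ) {F : Sph d → ℝ} (hF : Continuous F) (hpos : ∀ k, 0 < F k) :
    critDen (linBoltz fun _ => c) F = c * ((surf d).real univ * (∫ k, F k ∂(surf d))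
      - (∫ k, Real.sqrt (F k) ∂(surf d)) ^ 2) := by
  have hs : Continuous fun k => Real.sqrt (F k) := hF.sqrt
  have e : ∀ k, gammaB (linBoltz fun _ => c) (fun σ => Real.sqrt (F σ)) k
      = c / 2 * ((∫ σ, F σ ∂(surf d)) + (surf d).real univ * F k)
        - c * (∫ σ, Real.sqrt (F σ) ∂(surf d)) * Real.sqrt (F k) := fun k => by
    rw [gammaB, linBoltz_const c (f := fun σ => Real.sqrt (F σ) ^ 2) (hs.pow 2), linBoltz_const c hs]
    have h2 : ∀ k, Real.sqrt (F k) ^ 2 = F k := fun k => Real.sq_sqrt (hpos k).le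
    simp_rw [h2]
    linear_combination c * (surf d).real univ * h2 k
  rw [critDen]
  simp_rw [e]
  have iF := integrable_surf_of_continuous hF
  have i1 : Integrable (fun k => (∫ σ, F σ ∂(surf d)) + (surf d).real univ * F k) (surf d) :=
    (integrable_const _).add (iF.const_mul _)
  rw [integral_sub (i1.const_mul _) ((integrable_surf_of_continuous hs).const_mul _),
    integral_const_mul, integral_const_mul, integral_add (integrable_const _) (iF.const_mul _),
    integral_const, integral_const_mul, smul_eq_mul]
  ring

/-- The Poincaré inequality for `√F` bounds the numerator of the criterion from below. -/
theorem critDen_le_critNum_const {d : ℕ} (hd : 1 ≤ d) {r : ℕ∞} (hr : 1 ≤ r) {c : ℝ} (hc : 0 < c)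
    {F : Sph d → ℝ} (hF : IsEvenDensity r F) :
    4 * d * critDen (linBoltz fun _ => c) F ≤ critNum (linBoltz fun _ => c) F := by
  have hFc := hF.regular.continuous
  have hFg := hF.regular.continuous_sphGrad hr
  have hFd : ∀ k : Sph d, DifferentiableAt ℝ (homExt F) (k : Vel d) := fun k =>
    hF.regular.differentiableAt hr (sph_ne_zero k)
  have hSpos := surf_real_univ_pos hd
  set S := (surf d).real univ with hS
  have hlogd : ∀ k : Sph d, HasGradientAt (homExt fun σ => Real.log (F σ))
      ((F k)⁻¹ • sphGrad F k) (k : Vel d) := fun k =>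
    sphGrad_comp (hFd k) (Real.hasDerivAt_log (hF.pos k).ne')
  have hlogg : sphGrad (fun σ => Real.log (F σ)) = fun k => (F k)⁻¹ • sphGrad F k :=
    funext fun k => (hlogd k).gradient
  have hlogc : Continuous (sphGrad fun σ => Real.log (F σ)) := by
    rw [hlogg]; exact (hFc.inv₀ fun k => (hF.pos k).ne').smul hFg
  have hnum : critNum (linBoltz fun _ => c) F = c / 2 *
      ((∫ k, F k ∂(surf d)) * (∫ k, gammaOne (fun σ => Real.log (F σ))
        (fun σ => Real.log (F σ)) k ∂(surf d)) + S * ∫ k, F k * gammaOne (fun σ => Real.log (F σ))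
        (fun σ => Real.log (F σ)) k ∂(surf d)) := by
    rw [critNum]
    simp_rw [gammaOneB_const c (hFc.log fun k => (hF.pos k).ne')
      (fun k => (hlogd k).differentiableAt) hlogc]
    have hγ := continuous_gammaOne hlogc
    have e : ∀ k, F k * (c / 2 * ((∫ σ, gammaOne (fun σ => Real.log (F σ))
        (fun σ => Real.log (F σ)) σ ∂(surf d)) + (surf d).real univ * gammaOne
        (fun σ => Real.log (F σ)) (fun σ => Real.log (F σ)) k))
        = c / 2 * (F k * (∫ σ, gammaOne (fun σ => Real.log (F σ)) (fun σ => Real.log (F σ)) σ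
          ∂(surf d)) + S * (F k * gammaOne (fun σ => Real.log (F σ))
          (fun σ => Real.log (F σ)) k)) := fun k => by rw [hS]; ring
    simp_rw [e]
    have i1 : Integrable (fun k => F k * gammaOne (fun σ => Real.log (F σ))
        (fun σ => Real.log (F σ)) k) (surf d) := integrable_surf_of_continuous (hFc.mul hγ)
    rw [integral_const_mul, integral_add ((integrable_surf_of_continuous hFc).mul_const _)
      (i1.const_mul _), integral_mul_const, integral_const_mul]
  have hsq : ∀ k, gammaOne (fun σ => Real.sqrt (F σ)) (fun σ => Real.sqrt (F σ)) k
      = 4⁻¹ * (F k * gammaOne (fun σ => Real.log (F σ)) (fun σ => Real.log (F σ)) k) := fun k => by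
    have hp := hF.pos k
    have h1 : sphGrad (fun σ => Real.sqrt (F σ)) k = (1 / (2 * Real.sqrt (F k))) • sphGrad F k :=
      (sphGrad_comp (hFd k) (Real.hasDerivAt_sqrt hp.ne')).gradient
    rw [gammaOne, gammaOne, h1, hlogg, inner_smul_left, inner_smul_right, inner_smul_left,
      inner_smul_right]
    have h2 : Real.sqrt (F k) ^ 2 = F k := Real.sq_sqrt hp.le
    have h3 : Real.sqrt (F k) ≠ 0 := (Real.sqrt_pos.mpr hp).ne'
    simp only [conj_trivial]
    field_simp
    rw [h2]
    ring
  have hpoin := sphere_poincare_even hd hr (hF.regular.sqrt hF.pos) fun k => by rw [hF.even]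
  simp_rw [hsq] at hpoin
  rw [integral_const_mul] at hpoin
  simp_rw [fun k => Real.sq_sqrt (hF.pos k).le] at hpoin
  rw [critDen_const c hFc hF.pos, hnum]
  have hnn : 0 ≤ (∫ k, F k ∂(surf d)) * (∫ k, gammaOne (fun σ => Real.log (F σ))
        (fun σ => Real.log (F σ)) k ∂(surf d)) :=
    mul_nonneg (integral_nonneg fun k => (hF.pos k).le)
      (integral_nonneg fun k => real_inner_self_nonneg)
  have := mul_le_mul_of_nonneg_left hpoin (by positivity : 0 ≤ 2 * c)
  have := mul_nonneg (by positivity : 0 ≤ c / 2) hnn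
  linarith

theorem le_critInf_of_forall {d : ℕ} {L : (Sph d → ℝ) → Sph d → ℝ} {r : ℕ∞} {K : ℝ}
    (h0 : ∀ F, IsEvenDensity r F → 0 ≤ critDen L F)
    (h : ∀ F, IsEvenDensity r F → K * critDen L F ≤ critNum L F) : (K : EReal) ≤ critInf L r := by
  refine le_sInf ?_
  rintro q ⟨F, hF, hne, rfl⟩
  rw [EReal.coe_le_coe_iff, le_div_iff₀ (lt_of_le_of_ne (h0 F hF) hne.symm)]
  exact h F hF

theorem critDen_const_nonneg {d : ℕ} (hd : 1 ≤ d) {r : ℕ∞} {c : ℝ} (hc : 0 < c)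
    {F : Sph d → ℝ} (hF : IsEvenDensity r F) : 0 ≤ critDen (linBoltz fun _ => c) F := by
  have hs : Continuous fun k => Real.sqrt (F k) := hF.regular.continuous.sqrt
  rw [critDen_const c hF.regular.continuous hF.pos]
  refine mul_nonneg hc.le (sub_nonneg.mpr ?_)
  -- Cauchy-Schwarz, from the nonnegativity of `∫ (S √F - ∫ √F)²`
  set S := (surf d).real univ with hS
  set I := ∫ k, Real.sqrt (F k) ∂(surf d) with hI
  have h0 : 0 ≤ ∫ k, (S * Real.sqrt (F k) - I) ^ 2 ∂(surf d) := integral_nonneg fun k => sq_nonneg _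
  have e : ∀ k, (S * Real.sqrt (F k) - I) ^ 2
      = S ^ 2 * F k - 2 * S * I * Real.sqrt (F k) + I ^ 2 := fun k => by
    linear_combination S ^ 2 * Real.sq_sqrt (hF.pos k).le
  simp_rw [e] at h0
  have i1 : Integrable (fun k => S ^ 2 * F k) (surf d) :=
    (integrable_surf_of_continuous hF.regular.continuous).const_mul _
  have i2 : Integrable (fun k => 2 * S * I * Real.sqrt (F k)) (surf d) :=
    (integrable_surf_of_continuous hs).const_mul _
  have i3 : Integrable (fun k => S ^ 2 * F k - 2 * S * I * Real.sqrt (F k)) (surf d) := i1.sub i2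
  rw [integral_add i3 (integrable_const _), integral_sub i1 i2, integral_const_mul,
    integral_const_mul, integral_const, smul_eq_mul, ← hS, ← hI] at h0
  refine le_of_mul_le_mul_left ?_ (surf_real_univ_pos hd)
  linarith

theorem le_critInf_const {d : ℕ} (hd : 1 ≤ d) {r : ℕ∞} (hr : 1 ≤ r) {c : ℝ} (hc : 0 < c) :
    ((4 * (d : ℝ) : ℝ) : EReal) ≤ critInf (linBoltz (d := d) (fun _ => c)) r :=
  le_critInf_of_forall (fun _ hF => critDen_const_nonneg hd hc hF)
    fun _ hF => critDen_le_critNum_const hd hr hc hF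

/-! ### The criterion for hard spheres in the plane -/

theorem continuous_hsAngular : Continuous hsAngular := by
  unfold hsAngular
  exact Real.continuous_sin.comp (Real.continuous_arccos.div_const 2)

theorem continuous_hsSym : Continuous hsSym := by
  unfold hsSym
  exact (continuous_hsAngular.add (continuous_hsAngular.comp continuous_neg)).div_const 2

theorem hsSym_eq (s : ℝ) :
    hsSym s = (Real.sin (Real.arccos s / 2) + Real.cos (Real.arccos s / 2)) / 2 := by
  rw [hsSym, hsAngular, hsAngular, Real.arccos_neg, sub_div, Real.sin_pi_div_two_sub]

theorem hsSym_bounds (s : ℝ) : 1 / 2 ≤ hsSym s ∧ hsSym s ≤ Real.sqrt 2 / 2 := by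
  have h0 := Real.arccos_nonneg s
  have h1 := Real.arccos_le_pi s
  have hs : 0 ≤ Real.sin (Real.arccos s / 2) :=
    Real.sin_nonneg_of_nonneg_of_le_pi (by linarith) (by linarith)
  have hc : 0 ≤ Real.cos (Real.arccos s / 2) :=
    Real.cos_nonneg_of_neg_pi_div_two_le_of_le (by linarith) (by linarith)
  have hsc := Real.sin_sq_add_cos_sq (Real.arccos s / 2)
  rw [hsSym_eq]
  constructor
  · nlinarith [mul_nonneg hs hc]
  · have : Real.sin (Real.arccos s / 2) + Real.cos (Real.arccos s / 2) ≤ Real.sqrt 2 := by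
      refine Real.le_sqrt_of_sq_le ?_
      nlinarith [sq_nonneg (Real.sin (Real.arccos s / 2) - Real.cos (Real.arccos s / 2))]
    linarith

/-- The measure `β(cos a) da` on `(-π, π]` of an angular kernel. -/
def kernelMeasure (β : ℝ → ℝ) : Measure ℝ :=
  (volume.restrict (Ioc (-Real.pi) Real.pi)).withDensity fun a => ENNReal.ofReal (β (Real.cos a))

theorem isFiniteMeasure_kernelMeasure {β : ℝ → ℝ} (hβ : Continuous β) :
    IsFiniteMeasure (kernelMeasure β) := by
  refine isFiniteMeasure_withDensity_ofReal (Integrable.hasFiniteIntegral ?_)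
  have h : Continuous fun a => β (Real.cos a) := hβ.comp Real.continuous_cos
  exact (h.integrableOn_Icc (a := -Real.pi) (b := Real.pi)).mono_set Ioc_subset_Icc_self

theorem integral_kernelMeasure {β : ℝ → ℝ} (hβ : Continuous β) (hβ0 : ∀ s, 0 ≤ β s) (φ : ℝ → ℝ) :
    ∫ a, φ a ∂(kernelMeasure β) = ∫ a in (-Real.pi)..Real.pi, β (Real.cos a) * φ a := by
  have h : Continuous fun a => β (Real.cos a) := hβ.comp Real.continuous_cos
  rw [kernelMeasure, integral_withDensity_eq_integral_toReal_smul
    (f := fun a => ENNReal.ofReal (β (Real.cos a)))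
    (ENNReal.measurable_ofReal.comp h.measurable) (Filter.Eventually.of_forall fun a =>
      ENNReal.ofReal_lt_top), intervalIntegral.integral_of_le (by linarith [Real.pi_pos])]
  refine integral_congr_ae (Filter.Eventually.of_forall fun a => ?_)
  simp only [ENNReal.toReal_ofReal (hβ0 _), smul_eq_mul]

theorem linBoltz_two_eq {β : ℝ → ℝ} (hβ : Continuous β) (hβ0 : ∀ s, 0 ≤ β s) (g : Sph 2 → ℝ)
    (hg : Continuous g) : linBoltz β g = rotAverage (kernelMeasure β) g := by
  funext k
  have h : Continuous fun σ : Sph 2 => (g σ - g k) * β (inner ℝ (k : Vel 2) (σ : Vel 2)) := by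
    have h1 : Continuous fun σ : Sph 2 => (inner ℝ (k : Vel 2) (σ : Vel 2) : ℝ) :=
      continuous_const.inner continuous_subtype_val
    exact (hg.sub continuous_const).mul (hβ.comp h1)
  rw [linBoltz, integral_surf_two h k, rotAverage, integral_kernelMeasure hβ hβ0]
  refine intervalIntegral.integral_congr fun a _ => ?_
  simp only [inner_rot]
  ring

/-- In dimension two both sides of the criterion are monotone in the kernel. -/
theorem integral_kernelMeasure_mono {β₁ β₂ : ℝ → ℝ} (h1 : Continuous β₁) (h2 : Continuous β₂)
    (h10 : ∀ s, 0 ≤ β₁ s) (h20 : ∀ s, 0 ≤ β₂ s) (hle : ∀ s, β₁ s ≤ β₂ s) {φ : ℝ → ℝ}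
    (hφ : Continuous φ) (hφ0 : ∀ a, 0 ≤ φ a) :
    ∫ a, φ a ∂(kernelMeasure β₁) ≤ ∫ a, φ a ∂(kernelMeasure β₂) := by
  rw [integral_kernelMeasure h1 h10, integral_kernelMeasure h2 h20]
  refine intervalIntegral.integral_mono (by linarith [Real.pi_pos])
    (((h1.comp Real.continuous_cos).mul hφ).intervalIntegrable _ _)
    (((h2.comp Real.continuous_cos).mul hφ).intervalIntegrable _ _) fun a => ?_
  exact mul_le_mul_of_nonneg_right (hle _) (hφ0 a)

theorem critDen_mono {r : ℕ∞} {β₁ β₂ : ℝ → ℝ} (h1 : Continuous β₁) (h2 : Continuous β₂)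
    (h10 : ∀ s, 0 ≤ β₁ s) (h20 : ∀ s, 0 ≤ β₂ s) (hle : ∀ s, β₁ s ≤ β₂ s) {F : Sph 2 → ℝ}
    (hF : IsEvenDensity r F) : critDen (linBoltz β₁) F ≤ critDen (linBoltz β₂) F := by
  have := isFiniteMeasure_kernelMeasure h1
  have := isFiniteMeasure_kernelMeasure h2
  have hc := hF.regular.continuous.sqrt
  rw [critDen_eq (linBoltz_two_eq h1 h10) hF.regular.continuous,
    critDen_eq (linBoltz_two_eq h2 h20) hF.regular.continuous]
  refine integral_mono
    (integrable_surf_of_continuous ((continuous_integral_sq_sub hc).div_const 2))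
    (integrable_surf_of_continuous ((continuous_integral_sq_sub hc).div_const 2)) fun k => ?_
  have := integral_kernelMeasure_mono h1 h2 h10 h20 hle
    (((hc.comp (continuous_rot_left k)).sub (continuous_const (y := Real.sqrt (F k)))).pow 2)
    fun a => sq_nonneg _
  exact div_le_div_of_nonneg_right this (by norm_num)

theorem critNum_mono {r : ℕ∞} (hr : 1 ≤ r) {β₁ β₂ : ℝ → ℝ} (h1 : Continuous β₁)
    (h2 : Continuous β₂) (h10 : ∀ s, 0 ≤ β₁ s) (h20 : ∀ s, 0 ≤ β₂ s) (hle : ∀ s, β₁ s ≤ β₂ s)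
    {F : Sph 2 → ℝ} (hF : IsEvenDensity r F) :
    critNum (linBoltz β₁) F ≤ critNum (linBoltz β₂) F := by
  have := isFiniteMeasure_kernelMeasure h1
  have := isFiniteMeasure_kernelMeasure h2
  obtain ⟨F', hF'c, hF't⟩ := hF.regular.exists_tanDeriv hr
  have hFc := hF.regular.continuous
  have hc : Continuous fun k => F' k / F k := hF'c.div hFc fun k => (hF.pos k).ne'
  rw [critNum_eq (linBoltz_two_eq h1 h10) hFc hF.pos hc (hF't.log hF.pos),
    critNum_eq (linBoltz_two_eq h2 h20) hFc hF.pos hc (hF't.log hF.pos)]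
  refine integral_mono
    (integrable_surf_of_continuous (hFc.mul ((continuous_integral_sq_sub hc).div_const 2)))
    (integrable_surf_of_continuous (hFc.mul ((continuous_integral_sq_sub hc).div_const 2)))
    fun k => ?_
  have := integral_kernelMeasure_mono h1 h2 h10 h20 hle
    (((hc.comp (continuous_rot_left k)).sub (continuous_const (y := F' k / F k))).pow 2)
    fun a => sq_nonneg _
  exact mul_le_mul_of_nonneg_left (div_le_div_of_nonneg_right this (by norm_num)) (hF.pos k).le

theorem critDen_hsSym_nonneg {r : ℕ∞} {F : Sph 2 → ℝ} (hF : IsEvenDensity r F) :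
    0 ≤ critDen (linBoltz hsSym) F := by
  have := isFiniteMeasure_kernelMeasure continuous_hsSym
  rw [critDen_eq (linBoltz_two_eq continuous_hsSym fun s => by linarith [(hsSym_bounds s).1])
    hF.regular.continuous]
  exact integral_nonneg fun k => div_nonneg (integral_nonneg fun a => sq_nonneg _) (by norm_num)

/-- The kernel of hard spheres lies between the constants `1/2` and `√2/2`, and the bound for
constant kernels is lost only by the ratio of these constants. -/
theorem le_critInf_hsSym {r : ℕ∞} (hr : 1 ≤ r) :
    ((4 * Real.sqrt 2 : ℝ) : EReal) ≤ critInf (linBoltz (d := 2) hsSym) r := by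
  refine le_critInf_of_forall (fun F hF => critDen_hsSym_nonneg hF) fun F hF => ?_
  have hs2 : Real.sqrt 2 ^ 2 = 2 := Real.sq_sqrt (by norm_num)
  have hs0 : 0 < Real.sqrt 2 := by positivity
  have hsym0 : ∀ s, 0 ≤ hsSym s := fun s => by linarith [(hsSym_bounds s).1]
  have hnum := critNum_mono hr (β₁ := fun _ => (1 / 2 : ℝ)) continuous_const continuous_hsSym
    (fun _ => by norm_num) hsym0 (fun s => (hsSym_bounds s).1) hF
  have hden := critDen_mono (β₂ := fun _ => Real.sqrt 2 / 2) continuous_hsSym continuous_const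
    hsym0 (fun _ => by positivity) (fun s => (hsSym_bounds s).2) hF
  have hmain := critDen_le_critNum_const (d := 2) (by norm_num) hr
    (by norm_num : (0 : ℝ) < 1 / 2) hF
  rw [critDen_const _ hF.regular.continuous hF.pos] at hmain hden
  push_cast at hmain
  set V := (surf 2).real univ * (∫ k, F k ∂(surf 2)) - (∫ k, Real.sqrt (F k) ∂(surf 2)) ^ 2
  calc 4 * Real.sqrt 2 * critDen (linBoltz hsSym) F
      ≤ 4 * Real.sqrt 2 * (Real.sqrt 2 / 2 * V) := by gcongr
    _ = 4 * 2 * (1 / 2 * V) := by linear_combination 2 * V * hs2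
    _ ≤ critNum (linBoltz hsSym) F := hmain.trans hnum

/-! ### Collisions in the plane -/

/-- The weight `(1 + |v|²)⁻⁵` used to regularise densities. -/
def wt (v : Vel 2) : ℝ := ((1 + ‖v‖ ^ 2) ^ 5)⁻¹

/-- The collision invariant weight `(1 + |v|² + |w|²)⁻⁵`. -/
def pairWt (p : Vel 2 × Vel 2) : ℝ := ((1 + ‖p.1‖ ^ 2 + ‖p.2‖ ^ 2) ^ 5)⁻¹

/-- The integrable function `(1 + |v|²)⁻²`. -/
def intWt (v : Vel 2) : ℝ := ((1 + ‖v‖ ^ 2) ^ 2)⁻¹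

theorem wt_pos (v : Vel 2) : 0 < wt v := by unfold wt; positivity

theorem pairWt_pos (p : Vel 2 × Vel 2) : 0 < pairWt p := by unfold pairWt; positivity

theorem continuous_wt : Continuous wt := by
  unfold wt
  exact Continuous.inv₀ (by fun_prop) fun v => by positivity

theorem continuous_pairWt : Continuous pairWt := by
  unfold pairWt
  exact Continuous.inv₀ (by fun_prop) fun v => by positivity

theorem wt_mul_wt_le (v w : Vel 2) : wt v * wt w ≤ pairWt (v, w) := by
  unfold wt pairWt
  rw [← mul_inv, ← mul_pow]
  refine inv_anti₀ (by positivity) (pow_le_pow_left₀ (by positivity) ?_ 5)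
  nlinarith [mul_nonneg (sq_nonneg ‖v‖) (sq_nonneg ‖w‖)]

theorem wt_le_intWt (v : Vel 2) : wt v ≤ intWt v := by
  unfold wt intWt
  refine inv_anti₀ (by positivity) (pow_le_pow_right₀ ?_ (by norm_num))
  nlinarith [sq_nonneg ‖v‖]

theorem one_add_dist_mul_pairWt_le (p : Vel 2 × Vel 2) :
    (1 + ‖p.1 - p.2‖) * pairWt p ≤ 2 * (intWt p.1 * intWt p.2) := by
  obtain ⟨v, w⟩ := p
  have hr : 1 + ‖v - w‖ ≤ 2 * (1 + ‖v‖ ^ 2 + ‖w‖ ^ 2) := by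
    have := norm_sub_le v w
    nlinarith [sq_nonneg (‖v‖ - 1), sq_nonneg (‖w‖ - 1)]
  have h0 : 0 < 1 + ‖v‖ ^ 2 + ‖w‖ ^ 2 := by positivity
  have hmul : (1 + ‖v‖ ^ 2) * (1 + ‖w‖ ^ 2) ≤ (1 + ‖v‖ ^ 2 + ‖w‖ ^ 2) ^ 2 := by
    nlinarith [sq_nonneg ‖v‖, sq_nonneg ‖w‖, mul_nonneg (sq_nonneg ‖v‖) (sq_nonneg ‖w‖)]
  have h4 : ((1 + ‖v‖ ^ 2) * (1 + ‖w‖ ^ 2)) ^ 2 ≤ (1 + ‖v‖ ^ 2 + ‖w‖ ^ 2) ^ 4 := by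
    calc _ ≤ ((1 + ‖v‖ ^ 2 + ‖w‖ ^ 2) ^ 2) ^ 2 := pow_le_pow_left₀ (by positivity) hmul 2
      _ = _ := by ring
  unfold pairWt intWt
  simp only
  calc (1 + ‖v - w‖) * ((1 + ‖v‖ ^ 2 + ‖w‖ ^ 2) ^ 5)⁻¹
      ≤ 2 * (1 + ‖v‖ ^ 2 + ‖w‖ ^ 2) * ((1 + ‖v‖ ^ 2 + ‖w‖ ^ 2) ^ 5)⁻¹ := by gcongr
    _ = 2 * ((1 + ‖v‖ ^ 2 + ‖w‖ ^ 2) ^ 4)⁻¹ := by field_simp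
    _ ≤ 2 * (((1 + ‖v‖ ^ 2) * (1 + ‖w‖ ^ 2)) ^ 2)⁻¹ := by gcongr
    _ = _ := by rw [mul_pow, mul_inv]

theorem integrable_intWt : Integrable intWt := by
  have h := integrable_rpow_neg_one_add_norm_sq (E := Vel 2) (μ := volume) (r := 4) (by simp; norm_num)
  refine h.congr (Filter.Eventually.of_forall fun v => ?_)
  simp only [intWt]
  rw [show (-4 / 2 : ℝ) = -((2 : ℕ) : ℝ) by norm_num, Real.rpow_neg (by positivity),
    Real.rpow_natCast]

theorem integrable_wt : Integrable wt :=
  integrable_intWt.mono' continuous_wt.aestronglyMeasurable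
    (Filter.Eventually.of_forall fun v => by
      rw [Real.norm_of_nonneg (wt_pos v).le]; exact wt_le_intWt v)

theorem continuous_one_add_dist_mul_pairWt :
    Continuous fun p : Vel 2 × Vel 2 => (1 + ‖p.1 - p.2‖) * pairWt p :=
  Continuous.mul (by fun_prop) continuous_pairWt

theorem one_add_dist_mul_pairWt_nonneg (p : Vel 2 × Vel 2) :
    0 ≤ (1 + ‖p.1 - p.2‖) * pairWt p :=
  mul_nonneg (by positivity) (pairWt_pos p).le

theorem integrable_one_add_dist_mul_pairWt :
    Integrable fun p : Vel 2 × Vel 2 => (1 + ‖p.1 - p.2‖) * pairWt p :=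
  ((integrable_intWt.mul_prod integrable_intWt).const_mul 2).mono'
    continuous_one_add_dist_mul_pairWt.aestronglyMeasurable
    (Filter.Eventually.of_forall fun p => by
      rw [Real.norm_of_nonneg (one_add_dist_mul_pairWt_nonneg p)]
      exact one_add_dist_mul_pairWt_le p)

/-- The gradient of the weight `wt`. -/
def wtGrad (v : Vel 2) : Vel 2 := (-10 * ((1 + ‖v‖ ^ 2) ^ 6)⁻¹) • v

/-- The Hessian of the weight `wt`. -/
def wtHess (v : Vel 2) : Vel 2 →L[ℝ] Vel 2 :=
  (-10 * ((1 + ‖v‖ ^ 2) ^ 6)⁻¹) • ContinuousLinearMap.id ℝ (Vel 2) +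
    ((120 * ((1 + ‖v‖ ^ 2) ^ 7)⁻¹) • innerSL ℝ v).smulRight v

theorem hasFDerivAt_one_add_norm_sq_inv_pow (n : ℕ) (v : Vel 2) :
    HasFDerivAt (fun v : Vel 2 => ((1 + ‖v‖ ^ 2) ^ n)⁻¹)
      ((-2 * (n : ℝ) * ((1 + ‖v‖ ^ 2) ^ (n + 1))⁻¹ : ℝ) • innerSL ℝ v) v := by
  have h1 : HasFDerivAt (fun v : Vel 2 => 1 + ‖v‖ ^ 2) (2 • innerSL ℝ v) v :=
    (hasStrictFDerivAt_norm_sq v).hasFDerivAt.const_add 1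
  have hne : (1 + ‖v‖ ^ 2) ≠ 0 := by positivity
  have h2 : HasDerivAt (fun s : ℝ => (s ^ n)⁻¹) (-(n * (1 + ‖v‖ ^ 2) ^ (n - 1)) /
      ((1 + ‖v‖ ^ 2) ^ n) ^ 2) (1 + ‖v‖ ^ 2) :=
    (hasDerivAt_pow n _).fun_inv (pow_ne_zero n hne)
  refine (h2.comp_hasFDerivAt v h1).congr_fderiv ?_
  rw [← Nat.cast_smul_eq_nsmul ℝ 2, smul_smul]
  congr 1
  rcases n with - | n
  · simp
  · simp only [Nat.add_sub_cancel]
    push_cast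
    field_simp
    ring

theorem hasGradientAt_wt (v : Vel 2) : HasGradientAt wt (wtGrad v) v := by
  rw [hasGradientAt_iff_hasFDerivAt]
  refine (hasFDerivAt_one_add_norm_sq_inv_pow 5 v).congr_fderiv ?_
  ext y
  simp [wtGrad]
  norm_num

theorem hasFDerivAt_wtGrad (v : Vel 2) : HasFDerivAt wtGrad (wtHess v) v := by
  have h := ((hasFDerivAt_one_add_norm_sq_inv_pow 6 v).const_mul (-10)).fun_smul (hasFDerivAt_id v)
  refine h.congr_fderiv ?_
  ext y : 1
  simp [wtHess]
  congr 1
  norm_num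
  ring

theorem continuous_wtHess : Continuous wtHess := by
  have h : ∀ n : ℕ, Continuous fun v : Vel 2 => ((1 + ‖v‖ ^ 2) ^ n)⁻¹ := fun n =>
    Continuous.inv₀ (by fun_prop) fun v => by positivity
  have h6 := h 6
  have h7 := h 7
  unfold wtHess
  refine Continuous.add (by fun_prop) ?_
  have : Continuous fun v : Vel 2 => (120 * ((1 + ‖v‖ ^ 2) ^ 7)⁻¹) • innerSL ℝ v := by
    have := (innerSL ℝ (E := Vel 2)).continuous
    fun_prop
  exact (ContinuousLinearMap.smulRightL ℝ (Vel 2) (Vel 2)).continuous₂.comp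
    (this.prodMk continuous_id)

theorem norm_wtGrad_le (v : Vel 2) : ‖wtGrad v‖ ≤ 130 * wt v := by
  unfold wtGrad wt
  rw [norm_smul, norm_mul, Real.norm_of_nonneg (by positivity : 0 ≤ ((1 + ‖v‖ ^ 2) ^ 6)⁻¹)]
  have h0 : 0 < 1 + ‖v‖ ^ 2 := by positivity
  have h1 : ‖v‖ ≤ 1 + ‖v‖ ^ 2 := by nlinarith [sq_nonneg (‖v‖ - 1), norm_nonneg v]
  calc ‖(-10 : ℝ)‖ * ((1 + ‖v‖ ^ 2) ^ 6)⁻¹ * ‖v‖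
      ≤ 10 * ((1 + ‖v‖ ^ 2) ^ 6)⁻¹ * (1 + ‖v‖ ^ 2) := by norm_num; gcongr
    _ = 10 * ((1 + ‖v‖ ^ 2) ^ 5)⁻¹ := by field_simp
    _ ≤ _ := by gcongr; norm_num

theorem norm_wtHess_le (v : Vel 2) : ‖wtHess v‖ ≤ 130 * wt v := by
  have h0 : 0 < 1 + ‖v‖ ^ 2 := by positivity
  unfold wtHess wt
  refine (norm_add_le _ _).trans ?_
  rw [ContinuousLinearMap.norm_smulRight_apply, norm_smul, norm_smul, norm_mul, norm_mul,
    innerSL_apply_norm, Real.norm_of_nonneg (by positivity : 0 ≤ ((1 + ‖v‖ ^ 2) ^ 6)⁻¹),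
    Real.norm_of_nonneg (by positivity : 0 ≤ ((1 + ‖v‖ ^ 2) ^ 7)⁻¹)]
  have e1 : ((1 + ‖v‖ ^ 2) ^ 6)⁻¹ ≤ ((1 + ‖v‖ ^ 2) ^ 5)⁻¹ :=
    inv_anti₀ (by positivity) (pow_le_pow_right₀ (by nlinarith [sq_nonneg ‖v‖]) (by norm_num))
  have e2 : ((1 + ‖v‖ ^ 2) ^ 7)⁻¹ * ‖v‖ * ‖v‖ ≤ ((1 + ‖v‖ ^ 2) ^ 5)⁻¹ := by
    calc ((1 + ‖v‖ ^ 2) ^ 7)⁻¹ * ‖v‖ * ‖v‖ = ((1 + ‖v‖ ^ 2) ^ 7)⁻¹ * ‖v‖ ^ 2 := by ring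
      _ ≤ ((1 + ‖v‖ ^ 2) ^ 7)⁻¹ * (1 + ‖v‖ ^ 2) ^ 2 := by
        gcongr; nlinarith [sq_nonneg ‖v‖]
      _ = _ := by field_simp
  have e3 : ‖ContinuousLinearMap.id ℝ (Vel 2)‖ ≤ 1 := ContinuousLinearMap.norm_id_le
  have e4 : 0 ≤ ((1 + ‖v‖ ^ 2) ^ 6)⁻¹ := by positivity
  norm_num
  nlinarith

/-- The binary collision of angle `a`: the relative velocity is rotated by the angle `a`. -/
def coll (a : ℝ) : Vel 2 × Vel 2 →ₗ[ℝ] Vel 2 × Vel 2 where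
  toFun p := ((2⁻¹ : ℝ) • (p.1 + p.2) + (2⁻¹ : ℝ) • planeRot a (p.1 - p.2),
    (2⁻¹ : ℝ) • (p.1 + p.2) - (2⁻¹ : ℝ) • planeRot a (p.1 - p.2))
  map_add' p q := by ext1 <;> simp only [Prod.fst_add, Prod.snd_add, map_add, map_sub] <;> module
  map_smul' c p := by
    ext1 <;> simp only [Prod.smul_fst, Prod.smul_snd, map_sub, map_smul, RingHom.id_apply] <;> module

theorem coll_fst (a : ℝ) (p : Vel 2 × Vel 2) :
    (coll a p).1 = (2⁻¹ : ℝ) • (p.1 + p.2) + (2⁻¹ : ℝ) • planeRot a (p.1 - p.2) := rfl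

theorem coll_snd (a : ℝ) (p : Vel 2 × Vel 2) :
    (coll a p).2 = (2⁻¹ : ℝ) • (p.1 + p.2) - (2⁻¹ : ℝ) • planeRot a (p.1 - p.2) := rfl

theorem coll_fst_sub_snd (a : ℝ) (p : Vel 2 × Vel 2) :
    (coll a p).1 - (coll a p).2 = planeRot a (p.1 - p.2) := by
  rw [coll_fst, coll_snd]; module

theorem coll_fst_add_snd (a : ℝ) (p : Vel 2 × Vel 2) :
    (coll a p).1 + (coll a p).2 = p.1 + p.2 := by
  rw [coll_fst, coll_snd]; module

theorem coll_add (a b : ℝ) (p : Vel 2 × Vel 2) : coll (a + b) p = coll a (coll b p) := by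
  ext1
  · rw [coll_fst, coll_fst a, coll_fst_sub_snd, coll_fst_add_snd, planeRot_add]
  · rw [coll_snd, coll_snd a, coll_fst_sub_snd, coll_fst_add_snd, planeRot_add]

@[simp] theorem coll_zero (p : Vel 2 × Vel 2) : coll 0 p = p := by
  ext1
  · rw [coll_fst, planeRot_zero]; module
  · rw [coll_snd, planeRot_zero]; module

@[simp] theorem coll_neg_coll (a : ℝ) (p : Vel 2 × Vel 2) : coll (-a) (coll a p) = p := by
  rw [← coll_add]; simp

theorem coll_swap (a : ℝ) (p : Vel 2 × Vel 2) : coll a p.swap = (coll a p).swap := by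
  have h : planeRot a (p.2 - p.1) = -planeRot a (p.1 - p.2) := by rw [← map_neg, neg_sub]
  ext1
  · rw [coll_fst, Prod.fst_swap, Prod.snd_swap, Prod.fst_swap, coll_snd, h]; module
  · rw [coll_snd, Prod.fst_swap, Prod.snd_swap, Prod.snd_swap, coll_fst, h]; module

theorem coll_add_pi (a : ℝ) (p : Vel 2 × Vel 2) : coll (a + Real.pi) p = (coll a p).swap := by
  rw [coll_add]
  have h : coll Real.pi p = p.swap := by
    ext1
    · rw [coll_fst, planeRot_pi, Prod.fst_swap]; module
    · rw [coll_snd, planeRot_pi, Prod.snd_swap]; module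
  rw [h, coll_swap]

@[simp] theorem norm_coll_sub (a : ℝ) (p : Vel 2 × Vel 2) :
    ‖(coll a p).1 - (coll a p).2‖ = ‖p.1 - p.2‖ := by
  rw [coll_fst_sub_snd, norm_planeRot]

theorem coll_norm_sq (a : ℝ) (p : Vel 2 × Vel 2) :
    ‖(coll a p).1‖ ^ 2 + ‖(coll a p).2‖ ^ 2 = ‖p.1‖ ^ 2 + ‖p.2‖ ^ 2 := by
  have h1 := parallelogram_law_with_norm ℝ (coll a p).1 (coll a p).2
  have h2 := parallelogram_law_with_norm ℝ p.1 p.2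
  rw [coll_fst_add_snd, norm_coll_sub] at h1
  linarith

@[simp] theorem pairWt_coll (a : ℝ) (p : Vel 2 × Vel 2) : pairWt (coll a p) = pairWt p := by
  unfold pairWt
  rw [add_assoc, coll_norm_sq, ← add_assoc]

theorem coll_diag (a : ℝ) (v : Vel 2) : coll a (v, v) = (v, v) := by
  ext1
  · rw [coll_fst]; simp; module
  · rw [coll_snd]; simp; module

theorem continuous_coll : Continuous fun q : ℝ × (Vel 2 × Vel 2) => coll q.1 q.2 := by
  have h : Continuous fun q : ℝ × (Vel 2 × Vel 2) => planeRot q.1 (q.2.1 - q.2.2) := by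
    simp only [planeRot_apply]; fun_prop
  have h2 : Continuous fun q : ℝ × (Vel 2 × Vel 2) => (2⁻¹ : ℝ) • (q.2.1 + q.2.2) := by fun_prop
  exact (h2.add (h.const_smul (2⁻¹ : ℝ))).prodMk (h2.sub (h.const_smul (2⁻¹ : ℝ)))

theorem continuous_coll_right (a : ℝ) : Continuous (coll a) :=
  LinearMap.continuous_of_finiteDimensional _

theorem measurePreserving_coll (a : ℝ) :
    MeasurePreserving (coll a) (volume : Measure (Vel 2 × Vel 2)) volume :=
  measurePreserving_of_norm_sq_add (coll a) (coll_norm_sq a)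

/-- The change of variables between pre- and post-collisional velocities. -/
theorem integral_comp_coll (a : ℝ) (H : Vel 2 × Vel 2 → ℝ) :
    ∫ p, H (coll a p) = ∫ p, H p := by
  refine (measurePreserving_coll a).integral_comp ?_ H
  let e : (Vel 2 × Vel 2) ≃ₜ (Vel 2 × Vel 2) :=
    { toFun := coll a
      invFun := coll (-a)
      left_inv := fun p => coll_neg_coll a p
      right_inv := fun p => by simpa using coll_neg_coll (-a) p
      continuous_toFun := continuous_coll_right a
      continuous_invFun := continuous_coll_right (-a) }
  exact e.measurableEmbedding

theorem integral_comp_swap (H : Vel 2 × Vel 2 → ℝ) : ∫ p : Vel 2 × Vel 2, H p.swap = ∫ p, H p :=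
  integral_prod_swap H

/-! ### Differentiation and integration by parts along collisions -/

/-- The direction `(v - w) / |v - w|` of the relative velocity of a pair, `0` on the diagonal. -/
def relDir (p : Vel 2 × Vel 2) : Vel 2 := ‖p.1 - p.2‖⁻¹ • (p.1 - p.2)

theorem measurable_relDir : Measurable relDir := by
  unfold relDir; fun_prop

theorem norm_relDir_le (p : Vel 2 × Vel 2) : ‖relDir p‖ ≤ 1 := by
  unfold relDir
  rw [norm_smul, norm_inv, norm_norm]
  exact inv_mul_le_one

theorem norm_relDir {p : Vel 2 × Vel 2} (h : p.1 ≠ p.2) : ‖relDir p‖ = 1 := by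
  unfold relDir
  rw [norm_smul, norm_inv, norm_norm]
  exact inv_mul_cancel₀ (norm_ne_zero_iff.mpr (sub_ne_zero.mpr h))

theorem relDir_coll (a : ℝ) (p : Vel 2 × Vel 2) : relDir (coll a p) = planeRot a (relDir p) := by
  unfold relDir
  rw [norm_coll_sub, coll_fst_sub_snd, map_smul]

theorem relDir_swap (p : Vel 2 × Vel 2) : relDir p.swap = -relDir p := by
  unfold relDir
  rw [Prod.fst_swap, Prod.snd_swap, norm_sub_rev, ← smul_neg, neg_sub]

/-- `H1` and `H2` are the gradients of `H` in the first and in the second velocity. -/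
def HasPairGrad (H : Vel 2 × Vel 2 → ℝ) (H1 H2 : Vel 2 × Vel 2 → Vel 2) : Prop :=
  ∀ p, HasFDerivAt H ((innerSL ℝ (H1 p)).comp (ContinuousLinearMap.fst ℝ (Vel 2) (Vel 2)) +
    (innerSL ℝ (H2 p)).comp (ContinuousLinearMap.snd ℝ (Vel 2) (Vel 2))) p

/-- The gradient in the first velocity of `H ∘ coll a`, in terms of the gradients of `H`. -/
def pullGrad (a : ℝ) (H1 H2 : Vel 2 × Vel 2 → Vel 2) (p : Vel 2 × Vel 2) : Vel 2 :=
  (2⁻¹ : ℝ) • (H1 (coll a p) + H2 (coll a p) + planeRot (-a) (H1 (coll a p) - H2 (coll a p)))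

theorem HasPairGrad.hasGradientAt_fst {H : Vel 2 × Vel 2 → ℝ} {H1 H2 : Vel 2 × Vel 2 → Vel 2}
    (h : HasPairGrad H H1 H2) (v w : Vel 2) : HasGradientAt (fun v => H (v, w)) (H1 (v, w)) v := by
  rw [hasGradientAt_iff_hasFDerivAt]
  refine ((h (v, w)).comp v ((hasFDerivAt_id v).prodMk (hasFDerivAt_const w v))).congr_fderiv ?_
  ext y; simp

theorem HasPairGrad.hasGradientAt_coll {H : Vel 2 × Vel 2 → ℝ} {H1 H2 : Vel 2 × Vel 2 → Vel 2}
    (h : HasPairGrad H H1 H2) (a : ℝ) (v w : Vel 2) :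
    HasGradientAt (fun v => H (coll a (v, w))) (pullGrad a H1 H2 (v, w)) v := by
  rw [hasGradientAt_iff_hasFDerivAt]
  have hs : HasFDerivAt (fun v : Vel 2 => (2⁻¹ : ℝ) • (v + w))
      ((2⁻¹ : ℝ) • ContinuousLinearMap.id ℝ (Vel 2)) v :=
    ((hasFDerivAt_id v).add_const w).const_smul (2⁻¹ : ℝ)
  have hd : HasFDerivAt (fun v : Vel 2 => (2⁻¹ : ℝ) • planeRot a (v - w))
      ((2⁻¹ : ℝ) • planeRot a) v := by
    have := ((planeRot a).hasFDerivAt (x := v - w)).comp v ((hasFDerivAt_id v).sub_const w)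
    exact (this.const_smul (2⁻¹ : ℝ))
  have hc : HasFDerivAt (fun v : Vel 2 => coll a (v, w))
      (((2⁻¹ : ℝ) • ContinuousLinearMap.id ℝ (Vel 2) + (2⁻¹ : ℝ) • planeRot a).prod
        ((2⁻¹ : ℝ) • ContinuousLinearMap.id ℝ (Vel 2) - (2⁻¹ : ℝ) • planeRot a)) v :=
    (hs.fun_add hd).prodMk (hs.fun_sub hd)
  refine ((h (coll a (v, w))).comp v hc).congr_fderiv ?_
  ext y
  have e : ∀ z : Vel 2, inner ℝ (planeRot (-a) z) y = inner ℝ z (planeRot a y) := fun z => by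
    rw [inner_planeRot_left, neg_neg]
  simp only [ContinuousLinearMap.comp_apply, add_apply,
    ContinuousLinearMap.prod_apply, ContinuousLinearMap.coe_fst', ContinuousLinearMap.coe_snd',
    innerSL_apply_apply, smul_apply, sub_apply,
    ContinuousLinearMap.id_apply, InnerProductSpace.toDual_apply_apply, pullGrad,
    real_inner_smul_left, inner_add_left, inner_add_right, inner_sub_right, real_inner_smul_right,
    e, inner_sub_left]
  ring

/-- Differentiation of `|v - w| m(v)` when `m` vanishes at `w`; on the diagonal the gradient is
zero, in accordance with the convention for `relDir`. -/
theorem hasGradientAt_dist_mul {m : Vel 2 → ℝ} {m' : Vel 2} {v w : Vel 2}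
    (hm : HasGradientAt m m' v) (hw : m w = 0) :
    HasGradientAt (fun v => ‖v - w‖ * m v) (m v • relDir (v, w) + ‖v - w‖ • m') v := by
  rw [hasGradientAt_iff_hasFDerivAt] at hm ⊢
  rcases eq_or_ne v w with rfl | hne
  · simp only [hw, sub_self, norm_zero, zero_smul, add_zero, map_zero]
    rw [hasFDerivAt_iff_isLittleO]
    simp only [sub_self, norm_zero, zero_mul, zero_apply, sub_zero]
    have h1 : m =O[nhds v] fun x => x - v := by
      have := hm.isBigO_sub
      simpa [hw] using this
    have h2 : (fun x : Vel 2 => ‖x - v‖) =o[nhds v] fun _ => (1 : ℝ) := by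
      rw [Asymptotics.isLittleO_one_iff]
      have : Continuous fun x : Vel 2 => ‖x - v‖ := by fun_prop
      simpa using this.tendsto v
    have h3 := h2.mul_isBigO h1.norm_right
    simpa using h3.norm_right
  · have hne' : v - w ≠ 0 := sub_ne_zero.mpr hne
    have hn : HasFDerivAt (fun v : Vel 2 => ‖v - w‖) (innerSL ℝ (relDir (v, w))) v := by
      have h1 : HasFDerivAt (fun v : Vel 2 => ‖v - w‖ ^ 2) (2 • innerSL ℝ (v - w)) v := by
        have h0 : HasFDerivAt (fun v : Vel 2 => v - w) (ContinuousLinearMap.id ℝ (Vel 2)) v :=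
          (hasFDerivAt_id v).sub_const w
        refine ((hasStrictFDerivAt_norm_sq (v - w)).hasFDerivAt.comp v h0).congr_fderiv ?_
        ext y; simp
      have h2 := h1.sqrt (pow_ne_zero 2 (norm_ne_zero_iff.mpr hne'))
      simp only [Real.sqrt_sq (norm_nonneg _)] at h2
      refine h2.congr_fderiv ?_
      ext y
      simp [relDir]
      ring
    refine (hn.fun_mul hm).congr_fderiv ?_
    ext y
    simp
    ring

/-- The trace of an endomorphism of the plane. -/
def planeTrace (A : Vel 2 →L[ℝ] Vel 2) : ℝ :=
  ∑ i : Fin 2, A (EuclideanSpace.single i 1) i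

theorem abs_planeTrace_le (A : Vel 2 →L[ℝ] Vel 2) : |planeTrace A| ≤ 2 * ‖A‖ := by
  unfold planeTrace
  have h : ∀ i : Fin 2, |A (EuclideanSpace.single i 1) i| ≤ ‖A‖ := fun i => by
    have h1 := PiLp.norm_apply_le (A (EuclideanSpace.single i 1)) i
    have h2 := A.le_opNorm (EuclideanSpace.single i (1 : ℝ))
    simp only [PiLp.norm_single, norm_one, mul_one] at h2
    rw [← Real.norm_eq_abs]
    exact h1.trans h2
  rw [Fin.sum_univ_two]
  refine (abs_add_le _ _).trans ?_
  linarith [h 0, h 1]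

theorem continuous_planeTrace : Continuous planeTrace := by
  unfold planeTrace
  refine continuous_finsetSum _ fun i _ => ?_
  fun_prop

/-- The divergence theorem `∫ ⟨X, ∇h⟩ = - ∫ (div X) h` for bounded vector fields of class `C¹`. -/
theorem integral_inner_grad {X : Vel 2 → Vel 2} {X' : Vel 2 → Vel 2 →L[ℝ] Vel 2} {M : ℝ}
    (hX : ∀ v, HasFDerivAt X (X' v) v) (hX' : Continuous X') (hM : ∀ v, ‖X v‖ ≤ M)
    (hM' : ∀ v, ‖X' v‖ ≤ M) {h : Vel 2 → ℝ} {h' : Vel 2 → Vel 2}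
    (hh : ∀ v, HasGradientAt h (h' v) v) (hi : Integrable h) (hi' : Integrable h') :
    ∫ v, inner ℝ (X v) (h' v) = -∫ v, planeTrace (X' v) * h v := by
  have hXc : Continuous X := continuous_iff_continuousAt.mpr fun v => (hX v).continuousAt
  have hXi : ∀ i : Fin 2, ∀ v, HasFDerivAt (fun v => X v i)
      ((EuclideanSpace.proj i : Vel 2 →L[ℝ] ℝ).comp (X' v)) v := fun i v =>
    (EuclideanSpace.proj i : Vel 2 →L[ℝ] ℝ).hasFDerivAt.comp v (hX v)
  have hf : ∀ v, HasFDerivAt h (InnerProductSpace.toDual ℝ (Vel 2) (h' v)) v := fun v =>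
    (hh v).hasFDerivAt
  have hcoord : ∀ i : Fin 2, ∀ z : Vel 2, inner ℝ z (EuclideanSpace.single i (1 : ℝ)) = z i :=
    fun i z => by simp [EuclideanSpace.inner_single_right]
  have hI1 : ∀ i : Fin 2, Integrable (fun v => X' v (EuclideanSpace.single i 1) i * h v) := by
    intro i
    refine hi.bdd_mul (c := M) ?_ (Filter.Eventually.of_forall fun v => ?_)
    · exact Continuous.aestronglyMeasurable (by fun_prop)
    · have h1 := PiLp.norm_apply_le (X' v (EuclideanSpace.single i 1)) i
      have h2 := (X' v).le_opNorm (EuclideanSpace.single i (1 : ℝ))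
      simp only [PiLp.norm_single, norm_one, mul_one] at h2
      exact h1.trans (h2.trans (hM' v))
  have hI2 : ∀ i : Fin 2, Integrable (fun v => X v i * h' v i) := by
    intro i
    have hint : Integrable fun v => h' v i :=
      (EuclideanSpace.proj i : Vel 2 →L[ℝ] ℝ).integrable_comp hi'
    refine hint.bdd_mul (c := M) ?_ (Filter.Eventually.of_forall fun v => ?_)
    · exact Continuous.aestronglyMeasurable (by fun_prop)
    · exact (PiLp.norm_apply_le (X v) i).trans (hM v)
  have hI3 : ∀ i : Fin 2, Integrable (fun v => X v i * h v) := by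
    intro i
    refine hi.bdd_mul (c := M) ?_ (Filter.Eventually.of_forall fun v => ?_)
    · exact Continuous.aestronglyMeasurable (by fun_prop)
    · exact (PiLp.norm_apply_le (X v) i).trans (hM v)
  have key : ∀ i : Fin 2, ∫ v, X v i * h' v i
      = -∫ v, X' v (EuclideanSpace.single i 1) i * h v := by
    intro i
    have e1 : ∀ v, fderiv ℝ (fun v => X v i) v (EuclideanSpace.single i 1)
        = X' v (EuclideanSpace.single i 1) i := fun v => by rw [(hXi i v).fderiv]; rfl
    have e2 : ∀ v, fderiv ℝ h v (EuclideanSpace.single i 1) = h' v i := fun v => by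
      rw [(hf v).fderiv, InnerProductSpace.toDual_apply_apply, hcoord]
    have := integral_mul_fderiv_eq_neg_fderiv_mul_of_integrable (μ := (volume : Measure (Vel 2)))
      (f := fun v => X v i) (g := h) (v := EuclideanSpace.single i 1)
      (by simpa only [e1] using hI1 i) (by simpa only [e2] using hI2 i) (hI3 i)
      (fun v _ => (hXi i v).differentiableAt) (fun v _ => (hf v).differentiableAt)
    simpa only [e1, e2] using this
  simp only [inner_two, planeTrace, Fin.sum_univ_two, add_mul]
  rw [integral_add (hI2 0) (hI2 1), integral_add (hI1 0) (hI1 1), key 0, key 1]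
  ring

/-! ### The dissipation of the Fisher information in weak form -/

/-- The variation of `H` along the collision of angle `q.1` of the pair `q.2`. -/
def jump (H : Vel 2 × Vel 2 → ℝ) (q : ℝ × (Vel 2 × Vel 2)) : ℝ := H (coll q.1 q.2) - H q.2

/-- `H` is a `C¹` function of pairs of velocities which is controlled, together with its
gradients `H1` and `H2`, by `A` times the collision invariant weight. -/
structure PairBounds (A : ℝ) (H : Vel 2 × Vel 2 → ℝ) (H1 H2 : Vel 2 × Vel 2 → Vel 2) : Prop where
  grad : HasPairGrad H H1 H2
  cont1 : Continuous H1
  cont2 : Continuous H2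
  abs_le : ∀ p, |H p| ≤ A * pairWt p
  norm1_le : ∀ p, ‖H1 p‖ ≤ A * pairWt p
  norm2_le : ∀ p, ‖H2 p‖ ≤ A * pairWt p

/-- Measurable functions of an angle and a pair of velocities that are bounded by a multiple of
`(1 + |v - w|) (1 + |v|² + |w|²)⁻⁵`. -/
structure Tame (H : ℝ × (Vel 2 × Vel 2) → ℝ) : Prop where
  meas : Measurable H
  bound : ∃ M, ∀ q, |H q| ≤ M * ((1 + ‖q.2.1 - q.2.2‖) * pairWt q.2)

namespace Tame

theorem integrable_right {H : ℝ × (Vel 2 × Vel 2) → ℝ} (h : Tame H) (a : ℝ) :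
    Integrable fun p => H (a, p) := by
  obtain ⟨M, hM⟩ := h.bound
  exact (integrable_one_add_dist_mul_pairWt.const_mul M).mono'
    (h.meas.comp measurable_prodMk_left).aestronglyMeasurable
    (Filter.Eventually.of_forall fun p => hM (a, p))

theorem integrable {H : ℝ × (Vel 2 × Vel 2) → ℝ} (h : Tame H) (μ : Measure ℝ)
    [IsFiniteMeasure μ] : Integrable H (μ.prod volume) := by
  obtain ⟨M, hM⟩ := h.bound
  refine ((integrable_const (1 : ℝ)).mul_prod
    (integrable_one_add_dist_mul_pairWt.const_mul M)).mono' h.meas.aestronglyMeasurable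
    (Filter.Eventually.of_forall fun q => ?_)
  rw [one_mul]
  exact hM q

theorem add {H K : ℝ × (Vel 2 × Vel 2) → ℝ} (h : Tame H) (k : Tame K) :
    Tame fun q => H q + K q := by
  obtain ⟨M, hM⟩ := h.bound
  obtain ⟨N, hN⟩ := k.bound
  refine ⟨h.meas.add k.meas, M + N, fun q => ?_⟩
  rw [add_mul]
  exact (abs_add_le _ _).trans (add_le_add (hM q) (hN q))

theorem bdd_mul {H φ : ℝ × (Vel 2 × Vel 2) → ℝ} {B : ℝ} (h : Tame H) (hφ : Measurable φ)
    (hB : ∀ q, |φ q| ≤ B) : Tame fun q => φ q * H q := by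
  obtain ⟨M, hM⟩ := h.bound
  refine ⟨hφ.mul h.meas, B * M, fun q => ?_⟩
  rw [abs_mul, mul_assoc]
  exact mul_le_mul (hB q) (hM q) (abs_nonneg _) ((abs_nonneg _).trans (hB q))

theorem const_mul {H : ℝ × (Vel 2 × Vel 2) → ℝ} (h : Tame H) (c : ℝ) :
    Tame fun q => c * H q :=
  h.bdd_mul (B := |c|) measurable_const fun _ => le_rfl

theorem integrable_integral {H : ℝ × (Vel 2 × Vel 2) → ℝ} (h : Tame H) (μ : Measure ℝ)
    [IsFiniteMeasure μ] : Integrable (fun a => ∫ p, H (a, p)) μ :=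
  (h.integrable μ).integral_prod_left

end Tame

section

variable {A : ℝ} {H : Vel 2 × Vel 2 → ℝ} {H1 H2 : Vel 2 × Vel 2 → Vel 2}

theorem PairBounds.continuous (h : PairBounds A H H1 H2) : Continuous H :=
  continuous_iff_continuousAt.mpr fun p => (h.grad p).continuousAt

theorem PairBounds.const_nonneg (h : PairBounds A H H1 H2) : 0 ≤ A := by
  have := (abs_nonneg _).trans (h.abs_le 0)
  exact nonneg_of_mul_nonneg_left this (pairWt_pos 0)

theorem continuous_jump (hH : Continuous H) : Continuous (jump H) := by
  unfold jump
  exact (hH.comp continuous_coll).sub (hH.comp continuous_snd)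

theorem PairBounds.abs_jump_le (h : PairBounds A H H1 H2) (q : ℝ × (Vel 2 × Vel 2)) :
    |jump H q| ≤ 2 * A * pairWt q.2 := by
  unfold jump
  have h1 := h.abs_le (coll q.1 q.2)
  rw [pairWt_coll] at h1
  refine (abs_sub _ _).trans ?_
  linarith [h.abs_le q.2]

theorem PairBounds.norm_pullGrad_le (h : PairBounds A H H1 H2) (a : ℝ) (p : Vel 2 × Vel 2) :
    ‖pullGrad a H1 H2 p‖ ≤ 2 * A * pairWt p := by
  unfold pullGrad
  have h1 := h.norm1_le (coll a p)
  have h2 := h.norm2_le (coll a p)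
  rw [pairWt_coll] at h1 h2
  rw [norm_smul, Real.norm_of_nonneg (by norm_num : (0 : ℝ) ≤ 2⁻¹)]
  have h3 := norm_add_le (H1 (coll a p) + H2 (coll a p))
    (planeRot (-a) (H1 (coll a p) - H2 (coll a p)))
  rw [norm_planeRot] at h3
  have h4 := norm_add_le (H1 (coll a p)) (H2 (coll a p))
  have h5 := norm_sub_le (H1 (coll a p)) (H2 (coll a p))
  linarith

theorem continuous_planeRot_comp {Z : Type*} [TopologicalSpace Z] {a : Z → ℝ} {k : Z → Vel 2}
    (ha : Continuous a) (hk : Continuous k) : Continuous fun x => planeRot (a x) (k x) := by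
  simp only [planeRot_apply]
  fun_prop

theorem PairBounds.continuous_pullGrad (h : PairBounds A H H1 H2) :
    Continuous fun q : ℝ × (Vel 2 × Vel 2) => pullGrad q.1 H1 H2 q.2 := by
  unfold pullGrad
  have h1 := h.cont1.comp continuous_coll
  have h2 := h.cont2.comp continuous_coll
  have h3 : Continuous fun q : ℝ × (Vel 2 × Vel 2) =>
      planeRot (-q.1) (H1 (coll q.1 q.2) - H2 (coll q.1 q.2)) :=
    continuous_planeRot_comp continuous_fst.neg (h1.sub h2)
  exact ((h1.add h2).add h3).const_smul (2⁻¹ : ℝ)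

/-- The gradient in the first velocity of `|v - w|` times the jump of `H`. -/
def jumpGrad (H : Vel 2 × Vel 2 → ℝ) (H1 H2 : Vel 2 × Vel 2 → Vel 2)
    (q : ℝ × (Vel 2 × Vel 2)) : Vel 2 :=
  jump H q • relDir q.2 + ‖q.2.1 - q.2.2‖ • (pullGrad q.1 H1 H2 q.2 - H1 q.2)

theorem PairBounds.measurable_jumpGrad (h : PairBounds A H H1 H2) :
    Measurable (jumpGrad H H1 H2) := by
  unfold jumpGrad
  have h1 := (continuous_jump h.continuous).measurable
  have h2 : Measurable fun q : ℝ × (Vel 2 × Vel 2) => relDir q.2 :=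
    measurable_relDir.comp measurable_snd
  have h3 := (h.continuous_pullGrad.sub (h.cont1.comp continuous_snd)).measurable
  have h4 : Measurable fun q : ℝ × (Vel 2 × Vel 2) => ‖q.2.1 - q.2.2‖ := by fun_prop
  exact (h1.smul h2).add (h4.smul h3)

theorem PairBounds.norm_jumpGrad_le (h : PairBounds A H H1 H2) (q : ℝ × (Vel 2 × Vel 2)) :
    ‖jumpGrad H H1 H2 q‖ ≤ 3 * A * ((1 + ‖q.2.1 - q.2.2‖) * pairWt q.2) := by
  unfold jumpGrad
  have h1 := h.abs_jump_le q
  have h2 := h.norm_pullGrad_le q.1 q.2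
  have h3 := h.norm1_le q.2
  have hA := h.const_nonneg
  have hp := (pairWt_pos q.2).le
  have h4 : ‖pullGrad q.1 H1 H2 q.2 - H1 q.2‖ ≤ 3 * A * pairWt q.2 :=
    (norm_sub_le _ _).trans (by linarith)
  have h5 : ‖jump H q • relDir q.2‖ ≤ 2 * A * pairWt q.2 := by
    rw [norm_smul, Real.norm_eq_abs]
    calc |jump H q| * ‖relDir q.2‖ ≤ |jump H q| * 1 :=
          mul_le_mul_of_nonneg_left (norm_relDir_le _) (abs_nonneg _)
      _ ≤ _ := by linarith
  have h6 : ‖‖q.2.1 - q.2.2‖ • (pullGrad q.1 H1 H2 q.2 - H1 q.2)‖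
      ≤ ‖q.2.1 - q.2.2‖ * (3 * A * pairWt q.2) := by
    rw [norm_smul, norm_norm]
    exact mul_le_mul_of_nonneg_left h4 (norm_nonneg _)
  refine (norm_add_le _ _).trans ?_
  nlinarith [mul_nonneg hA hp]

/-- The density of the dissipation of the Fisher information, for a logarithmic gradient `X` and a
function of pairs `H`, along the collision of angle `q.1` of the pair `q.2`. -/
def fisherFlux (X : Vel 2 → Vel 2) (H : Vel 2 × Vel 2 → ℝ) (H1 H2 : Vel 2 × Vel 2 → Vel 2)
    (q : ℝ × (Vel 2 × Vel 2)) : ℝ :=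
  2 * inner ℝ (X q.2.1) (jumpGrad H H1 H2 q) -
    ‖X q.2.1‖ ^ 2 * (‖q.2.1 - q.2.2‖ * jump H q)

theorem PairBounds.abs_fisherFlux_le (h : PairBounds A H H1 H2) (X : Vel 2 → Vel 2)
    (q : ℝ × (Vel 2 × Vel 2)) :
    |fisherFlux X H H1 H2 q| ≤
      6 * A * (‖X q.2.1‖ + ‖X q.2.1‖ ^ 2) * ((1 + ‖q.2.1 - q.2.2‖) * pairWt q.2) := by
  unfold fisherFlux
  have h1 := h.norm_jumpGrad_le q
  have h2 := h.abs_jump_le q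
  have h3 := abs_real_inner_le_norm (X q.2.1) (jumpGrad H H1 H2 q)
  have hA := h.const_nonneg
  have hp := (pairWt_pos q.2).le
  set r := ‖q.2.1 - q.2.2‖
  have hr : 0 ≤ r := norm_nonneg _
  have h4 : |r * jump H q| ≤ 2 * A * ((1 + r) * pairWt q.2) := by
    rw [abs_mul, abs_of_nonneg hr]
    calc r * |jump H q| ≤ r * (2 * A * pairWt q.2) := mul_le_mul_of_nonneg_left h2 hr
      _ ≤ _ := by nlinarith [mul_nonneg hA hp]
  have hW : 0 ≤ (1 + r) * pairWt q.2 := by positivity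
  have h5 : |2 * inner ℝ (X q.2.1) (jumpGrad H H1 H2 q)|
      ≤ 2 * (‖X q.2.1‖ * (3 * A * ((1 + r) * pairWt q.2))) := by
    rw [abs_mul, abs_two]
    gcongr
    exact h3.trans (by gcongr)
  have h6 : |‖X q.2.1‖ ^ 2 * (r * jump H q)| ≤ ‖X q.2.1‖ ^ 2 * (2 * A * ((1 + r) * pairWt q.2)) := by
    rw [abs_mul, abs_of_nonneg (by positivity : 0 ≤ ‖X q.2.1‖ ^ 2)]
    gcongr
  refine (abs_sub _ _).trans ?_
  have h7 : 0 ≤ ‖X q.2.1‖ ^ 2 * (A * ((1 + r) * pairWt q.2)) := by positivity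
  nlinarith

theorem PairBounds.tame_fisherFlux (h : PairBounds A H H1 H2) {X : Vel 2 → Vel 2}
    (hX : Continuous X) {M : ℝ} (hM : ∀ v, ‖X v‖ ≤ M) : Tame (fisherFlux X H H1 H2) := by
  refine ⟨?_, 6 * A * (M + M ^ 2), fun q => (h.abs_fisherFlux_le X q).trans ?_⟩
  · unfold fisherFlux
    have h1 : Measurable fun q : ℝ × (Vel 2 × Vel 2) => X q.2.1 :=
      (hX.comp (by fun_prop)).measurable
    have h2 := h.measurable_jumpGrad
    have h3 := (continuous_jump h.continuous).measurable
    have h4 : Measurable fun q : ℝ × (Vel 2 × Vel 2) => ‖q.2.1 - q.2.2‖ := by fun_prop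
    exact ((h1.inner h2).const_mul 2).sub ((h1.norm.pow_const 2).mul (h4.mul h3))
  · have hA := h.const_nonneg
    have := hM q.2.1
    have hW := one_add_dist_mul_pairWt_nonneg q.2
    gcongr

/-- The functional derivative `-2 div X - |X|²` of the Fisher information at a density with
logarithmic gradient `X`, where `X'` is the derivative of `X`. -/
def fisherDeriv (X : Vel 2 → Vel 2) (X' : Vel 2 → Vel 2 →L[ℝ] Vel 2) (v : Vel 2) : ℝ :=
  -(2 * planeTrace (X' v)) - ‖X v‖ ^ 2

theorem PairBounds.integral_fisherDeriv_mul (h : PairBounds A H H1 H2) {X : Vel 2 → Vel 2}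
    {X' : Vel 2 → Vel 2 →L[ℝ] Vel 2} {M : ℝ} (hX : ∀ v, HasFDerivAt X (X' v) v)
    (hX' : Continuous X') (hM : ∀ v, ‖X v‖ ≤ M) (hM' : ∀ v, ‖X' v‖ ≤ M) (a : ℝ) :
    ∫ p : Vel 2 × Vel 2, fisherDeriv X X' p.1 * (‖p.1 - p.2‖ * jump H (a, p))
      = ∫ p, fisherFlux X H H1 H2 (a, p) := by
  have hXc : Continuous X := continuous_iff_continuousAt.mpr fun v => (hX v).continuousAt
  have hT := (h.tame_fisherFlux hXc hM).integrable_right a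
  have hM0 : 0 ≤ M := (norm_nonneg _).trans (hM 0)
  have hA := h.const_nonneg
  have hjm : Measurable fun p : Vel 2 × Vel 2 => ‖p.1 - p.2‖ * jump H (a, p) := by
    have h4 : Measurable fun q : Vel 2 × Vel 2 => ‖q.1 - q.2‖ := by fun_prop
    exact h4.mul ((continuous_jump h.continuous).measurable.comp measurable_prodMk_left)
  have hjb : ∀ p : Vel 2 × Vel 2, ‖‖p.1 - p.2‖ * jump H (a, p)‖
      ≤ 2 * A * ((1 + ‖p.1 - p.2‖) * pairWt p) := by
    intro p
    rw [norm_mul, norm_norm, Real.norm_eq_abs]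
    calc ‖p.1 - p.2‖ * |jump H (a, p)| ≤ ‖p.1 - p.2‖ * (2 * A * pairWt p) :=
          mul_le_mul_of_nonneg_left (h.abs_jump_le (a, p)) (norm_nonneg _)
      _ ≤ _ := by nlinarith [mul_nonneg hA (pairWt_pos p).le]
  have hj : Integrable fun p : Vel 2 × Vel 2 => ‖p.1 - p.2‖ * jump H (a, p) :=
    (integrable_one_add_dist_mul_pairWt.const_mul (2 * A)).mono' hjm.aestronglyMeasurable
      (Filter.Eventually.of_forall hjb)
  have hΦc : Continuous (fisherDeriv X X') := by
    unfold fisherDeriv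
    have := continuous_planeTrace.comp hX'
    exact ((this.const_mul 2).neg).sub (hXc.norm.pow 2)
  have hΦ : ∀ v, ‖fisherDeriv X X' v‖ ≤ 4 * M + M ^ 2 := by
    intro v
    unfold fisherDeriv
    rw [Real.norm_eq_abs]
    have h1 := abs_planeTrace_le (X' v)
    have h2 : ‖X v‖ ^ 2 ≤ M ^ 2 := by gcongr; exact hM v
    refine (abs_sub _ _).trans ?_
    rw [abs_neg, abs_mul, abs_two, abs_of_nonneg (sq_nonneg ‖X v‖)]
    linarith [hM' v]
  have hI : Integrable fun p : Vel 2 × Vel 2 =>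
      fisherDeriv X X' p.1 * (‖p.1 - p.2‖ * jump H (a, p)) :=
    hj.bdd_mul (hΦc.comp continuous_fst).aestronglyMeasurable
      (Filter.Eventually.of_forall fun p => hΦ p.1)
  rw [Measure.volume_eq_prod] at hI hT ⊢
  rw [integral_prod_symm _ hI, integral_prod_symm _ hT]
  refine integral_congr_ae (Filter.Eventually.of_forall fun w => ?_)
  have hdom : ∀ v, (1 + ‖v - w‖) * pairWt (v, w) ≤ 2 * intWt w * intWt v := fun v => by
    have := one_add_dist_mul_pairWt_le (v, w)
    simp only at this
    linarith
  have hgrad : ∀ v, HasGradientAt (fun v => ‖v - w‖ * jump H (a, (v, w)))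
      (jumpGrad H H1 H2 (a, (v, w))) v := fun v => by
    refine hasGradientAt_dist_mul (m := fun v => jump H (a, (v, w))) ?_ ?_
    · have h1 := (h.grad.hasGradientAt_coll a v w).hasFDerivAt
      have h2 := (h.grad.hasGradientAt_fst v w).hasFDerivAt
      rw [hasGradientAt_iff_hasFDerivAt, map_sub]
      exact h1.fun_sub h2
    · simp [jump, coll_diag]
  have hi : Integrable fun v => ‖v - w‖ * jump H (a, (v, w)) := by
    refine (integrable_intWt.const_mul (2 * A * (2 * intWt w))).mono'
      (hjm.comp measurable_prodMk_right).aestronglyMeasurable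
      (Filter.Eventually.of_forall fun v => (hjb (v, w)).trans ?_)
    rw [mul_assoc (2 * A)]
    exact mul_le_mul_of_nonneg_left (hdom v) (by positivity)
  have hi' : Integrable fun v => jumpGrad H H1 H2 (a, (v, w)) := by
    refine (integrable_intWt.const_mul (3 * A * (2 * intWt w))).mono'
      (h.measurable_jumpGrad.comp
        (measurable_prodMk_left.comp measurable_prodMk_right)).aestronglyMeasurable
      (Filter.Eventually.of_forall fun v => (h.norm_jumpGrad_le (a, (v, w))).trans ?_)
    rw [mul_assoc (3 * A)]
    exact mul_le_mul_of_nonneg_left (hdom v) (by positivity)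
  have key := integral_inner_grad hX hX' hM hM' hgrad hi hi'
  have hia : Integrable fun v => planeTrace (X' v) * (‖v - w‖ * jump H (a, (v, w))) := by
    refine hi.bdd_mul (c := 2 * M) (continuous_planeTrace.comp hX').aestronglyMeasurable
      (Filter.Eventually.of_forall fun v => ?_)
    rw [Real.norm_eq_abs]
    exact (abs_planeTrace_le _).trans (by linarith [hM' v])
  have hib : Integrable fun v => ‖X v‖ ^ 2 * (‖v - w‖ * jump H (a, (v, w))) := by
    refine hi.bdd_mul (c := M ^ 2) (hXc.norm.pow 2).aestronglyMeasurable
      (Filter.Eventually.of_forall fun v => ?_)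
    rw [Real.norm_of_nonneg (by positivity)]
    gcongr; exact hM v
  have hic : Integrable fun v => inner ℝ (X v) (jumpGrad H H1 H2 (a, (v, w))) := by
    refine (hi'.norm.const_mul M).mono' ?_ (Filter.Eventually.of_forall fun v => ?_)
    · exact hXc.aestronglyMeasurable.inner hi'.aestronglyMeasurable
    · exact (norm_inner_le_norm _ _).trans (mul_le_mul_of_nonneg_right (hM v) (norm_nonneg _))
  show ∫ v, (-(2 * planeTrace (X' v)) - ‖X v‖ ^ 2) * (‖v - w‖ * jump H (a, (v, w)))
    = ∫ v, (2 * inner ℝ (X v) (jumpGrad H H1 H2 (a, (v, w))) -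
      ‖X v‖ ^ 2 * (‖v - w‖ * jump H (a, (v, w))))
  rw [integral_sub (hic.const_mul 2) hib, integral_const_mul, key, ← integral_neg,
    ← integral_const_mul]
  have hia' : Integrable fun v => 2 * -(planeTrace (X' v) * (‖v - w‖ * jump H (a, (v, w)))) :=
    hia.neg.const_mul 2
  rw [← integral_sub hia' hib]
  refine integral_congr_ae (Filter.Eventually.of_forall fun v => ?_)
  ring

end

/-! ### Symmetrization of the dissipation -/

theorem Tame.intervalIntegrable {H : ℝ × (Vel 2 × Vel 2) → ℝ} (h : Tame H) (s t : ℝ) :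
    IntervalIntegrable (fun a => ∫ p, H (a, p)) volume s t :=
  ⟨h.integrable_integral _, h.integrable_integral _⟩

/-- The relative logarithmic gradient `X(v) - X(w)` of a pair. -/
def relGrad (X : Vel 2 → Vel 2) (p : Vel 2 × Vel 2) : Vel 2 := X p.1 - X p.2

/-- The variation of the relative logarithmic gradient along a collision, in the frame which
follows the relative velocity. -/
def twist (X : Vel 2 → Vel 2) (q : ℝ × (Vel 2 × Vel 2)) : Vel 2 :=
  planeRot (-q.1) (relGrad X (coll q.1 q.2)) - relGrad X q.2

/-- The flux after the exchange of the two velocities. -/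
def symFlux (X : Vel 2 → Vel 2) (G : Vel 2 × Vel 2 → ℝ) (q : ℝ × (Vel 2 × Vel 2)) : ℝ :=
  2 * inner ℝ (relDir q.2) (relGrad X q.2) * jump G q -
    2⁻¹ * ‖twist X q‖ ^ 2 * (‖q.2.1 - q.2.2‖ * G (coll q.1 q.2))

/-- The flux after the exchange of the two velocities and of a collision with its inverse. -/
def revFlux (X : Vel 2 → Vel 2) (G : Vel 2 × Vel 2 → ℝ) (q : ℝ × (Vel 2 × Vel 2)) : ℝ :=
  -(2 * inner ℝ (relDir q.2) (twist X q) * jump G q) -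
    2⁻¹ * ‖twist X q‖ ^ 2 * (‖q.2.1 - q.2.2‖ * (G q.2 + G (coll q.1 q.2)))

theorem twist_neg_coll (X : Vel 2 → Vel 2) (a : ℝ) (p : Vel 2 × Vel 2) :
    twist X (-a, coll a p) = -planeRot a (twist X (a, p)) := by
  unfold twist
  simp only [neg_neg, coll_neg_coll, map_sub, planeRot_planeRot_neg, neg_sub]

theorem symFlux_add_symFlux_neg (X : Vel 2 → Vel 2) (G : Vel 2 × Vel 2 → ℝ) (a : ℝ)
    (p : Vel 2 × Vel 2) :
    symFlux X G (a, p) + symFlux X G (-a, coll a p) = revFlux X G (a, p) := by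
  have h1 : inner ℝ (relDir (coll a p)) (relGrad X (coll a p))
      = inner ℝ (relDir p) (twist X (a, p)) + inner ℝ (relDir p) (relGrad X p) := by
    rw [relDir_coll, inner_planeRot_left, ← inner_add_right, twist, sub_add_cancel]
  simp only [symFlux, revFlux, twist_neg_coll, norm_neg, norm_planeRot, norm_coll_sub, h1, jump,
    coll_neg_coll]
  ring

theorem twist_add_pi (X : Vel 2 → Vel 2) (a : ℝ) (p : Vel 2 × Vel 2) :
    twist X (a + Real.pi, p) = twist X (a, p) := by
  have h1 : relGrad X (coll a p).swap = -relGrad X (coll a p) := by simp [relGrad]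
  have h2 : ∀ z, planeRot (-(a + Real.pi)) z = -planeRot (-a) z := fun z => by
    simp only [planeRot_apply, Real.cos_neg, Real.sin_neg, Real.cos_add_pi, Real.sin_add_pi]
    module
  simp only [twist, coll_add_pi, h1, h2, map_neg, neg_neg]

theorem revFlux_add_pi (X : Vel 2 → Vel 2) {G : Vel 2 × Vel 2 → ℝ} (hG : ∀ p, G p.swap = G p)
    (a : ℝ) (p : Vel 2 × Vel 2) : revFlux X G (a + Real.pi, p) = revFlux X G (a, p) := by
  simp only [revFlux, twist_add_pi, jump, coll_add_pi, hG]

/-- A symmetric positive function of pairs with logarithmic gradient `(X(v), X(w))`, where `X`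
is bounded. -/
structure SymPair (A M : ℝ) (X : Vel 2 → Vel 2) (G : Vel 2 × Vel 2 → ℝ) : Prop where
  bounds : PairBounds A G (fun p => G p • X p.1) (fun p => G p • X p.2)
  swap : ∀ p, G p.swap = G p
  pos : ∀ p, 0 < G p
  cont : Continuous X
  norm_le : ∀ v, ‖X v‖ ≤ M

section

variable {A M : ℝ} {X : Vel 2 → Vel 2} {G : Vel 2 × Vel 2 → ℝ}

/-- The exchange of the two velocities bounds the flux from above by `symFlux`, up to a quantity
which the collision transports. -/
theorem fisherFlux_add_swap_le (h : SymPair A M X G) (a : ℝ) (p : Vel 2 × Vel 2) :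
    fisherFlux X G (fun p => G p • X p.1) (fun p => G p • X p.2) (a, p) +
        fisherFlux X G (fun p => G p • X p.1) (fun p => G p • X p.2) (a, p.swap) ≤
      symFlux X G (a, p) +
        ((‖X (coll a p).1‖ ^ 2 + ‖X (coll a p).2‖ ^ 2) * (‖p.1 - p.2‖ * G (coll a p)) -
        (‖X p.1‖ ^ 2 + ‖X p.2‖ ^ 2) * (‖p.1 - p.2‖ * G p)) := by
  have hr : ‖p.2 - p.1‖ = ‖p.1 - p.2‖ := norm_sub_rev _ _
  have hG' := h.pos (coll a p)
  simp only [fisherFlux, jumpGrad, symFlux, jump, coll_swap, h.swap, relDir_swap, pullGrad,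
    Prod.fst_swap, Prod.snd_swap, hr, twist, relGrad]
  have hz : ∀ z, ‖planeRot (-a) z‖ ^ 2 = ‖z‖ ^ 2 := fun z => by rw [norm_planeRot]
  have e1 := hz (X (coll a p).1 - X (coll a p).2)
  rw [← smul_sub, ← smul_sub, ← neg_sub (X (coll a p).1) (X (coll a p).2), map_smul,
    map_smul, map_neg]
  have hr0 : 0 ≤ ‖p.1 - p.2‖ := norm_nonneg _
  generalize planeRot (-a) (X (coll a p).1 - X (coll a p).2) = z at *
  generalize G (coll a p) = g' at *
  generalize X (coll a p).1 = y1 at *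
  generalize X (coll a p).2 = y2 at *
  generalize X p.1 = x1 at *
  generalize X p.2 = x2 at *
  generalize relDir p = n at *
  generalize ‖p.1 - p.2‖ = r at *
  generalize G p = g at *
  have key : 0 ≤ 2⁻¹ * (r * g') * ‖x1 + x2 - (y1 + y2)‖ ^ 2 := by positivity
  rw [← sub_nonneg]
  refine key.trans_eq ?_
  simp only [inner_two, norm_sq_two, PiLp.add_apply, PiLp.sub_apply, PiLp.smul_apply,
    PiLp.neg_apply, smul_eq_mul] at e1 ⊢
  linear_combination (r * g' * 2⁻¹) * e1

theorem continuous_relGrad (hX : Continuous X) : Continuous (relGrad X) := by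
  unfold relGrad
  exact (hX.comp continuous_fst).sub (hX.comp continuous_snd)

theorem continuous_twist (hX : Continuous X) : Continuous (twist X) := by
  unfold twist
  exact (continuous_planeRot_comp continuous_fst.neg
    ((continuous_relGrad hX).comp continuous_coll)).sub ((continuous_relGrad hX).comp continuous_snd)

theorem SymPair.norm_relGrad_le (h : SymPair A M X G) (p : Vel 2 × Vel 2) :
    ‖relGrad X p‖ ≤ 2 * M := by
  refine (norm_sub_le _ _).trans ?_
  linarith [h.norm_le p.1, h.norm_le p.2]

theorem SymPair.norm_twist_le (h : SymPair A M X G) (q : ℝ × (Vel 2 × Vel 2)) :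
    ‖twist X q‖ ≤ 4 * M := by
  refine (norm_sub_le _ _).trans ?_
  rw [norm_planeRot]
  linarith [h.norm_relGrad_le (coll q.1 q.2), h.norm_relGrad_le q.2]

theorem PairBounds.tame_jump {H : Vel 2 × Vel 2 → ℝ} {H1 H2 : Vel 2 × Vel 2 → Vel 2}
    (h : PairBounds A H H1 H2) : Tame (jump H) := by
  refine ⟨(continuous_jump h.continuous).measurable, 2 * A, fun q => (h.abs_jump_le q).trans ?_⟩
  have := h.const_nonneg
  have := (pairWt_pos q.2).le
  refine mul_le_mul_of_nonneg_left ?_ (by positivity)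
  nlinarith [norm_nonneg (q.2.1 - q.2.2)]

theorem PairBounds.tame_dist_mul {H : Vel 2 × Vel 2 → ℝ} {H1 H2 : Vel 2 × Vel 2 → Vel 2}
    (h : PairBounds A H H1 H2) : Tame fun q => ‖q.2.1 - q.2.2‖ * H q.2 := by
  refine ⟨Continuous.measurable ?_, A, fun q => ?_⟩
  · have := h.continuous.comp (continuous_snd (X := ℝ))
    exact Continuous.mul (by fun_prop) this
  · have := h.const_nonneg
    have := (pairWt_pos q.2).le
    rw [abs_mul, abs_of_nonneg (norm_nonneg _)]
    calc ‖q.2.1 - q.2.2‖ * |H q.2| ≤ ‖q.2.1 - q.2.2‖ * (A * pairWt q.2) := by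
          gcongr; exact h.abs_le _
      _ ≤ A * ((1 + ‖q.2.1 - q.2.2‖) * pairWt q.2) := by nlinarith [mul_nonneg h.const_nonneg this]

theorem PairBounds.tame_dist_mul_coll {H : Vel 2 × Vel 2 → ℝ} {H1 H2 : Vel 2 × Vel 2 → Vel 2}
    (h : PairBounds A H H1 H2) : Tame fun q => ‖q.2.1 - q.2.2‖ * H (coll q.1 q.2) := by
  refine ⟨Continuous.measurable ?_, A, fun q => ?_⟩
  · have := h.continuous.comp continuous_coll
    exact Continuous.mul (by fun_prop) this
  · have := h.const_nonneg
    have := (pairWt_pos q.2).le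
    have h1 := h.abs_le (coll q.1 q.2)
    rw [pairWt_coll] at h1
    rw [abs_mul, abs_of_nonneg (norm_nonneg _)]
    calc ‖q.2.1 - q.2.2‖ * |H (coll q.1 q.2)| ≤ ‖q.2.1 - q.2.2‖ * (A * pairWt q.2) := by gcongr
      _ ≤ A * ((1 + ‖q.2.1 - q.2.2‖) * pairWt q.2) := by nlinarith [mul_nonneg h.const_nonneg this]

theorem SymPair.tame_symFlux (h : SymPair A M X G) : Tame (symFlux X G) := by
  have hY : Continuous fun q : ℝ × (Vel 2 × Vel 2) => relGrad X q.2 :=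
    (continuous_relGrad h.cont).comp continuous_snd
  have hn : Measurable fun q : ℝ × (Vel 2 × Vel 2) => relDir q.2 :=
    measurable_relDir.comp measurable_snd
  have h1 := h.bounds.tame_jump.bdd_mul (B := 2 * (2 * M))
    (φ := fun q => 2 * inner ℝ (relDir q.2) (relGrad X q.2)) ((hn.inner hY.measurable).const_mul 2)
    (fun q => by
      rw [abs_mul, abs_two]
      refine mul_le_mul_of_nonneg_left ((abs_real_inner_le_norm _ _).trans ?_) zero_le_two
      have := mul_le_mul (norm_relDir_le q.2) (h.norm_relGrad_le q.2) (norm_nonneg _) zero_le_one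
      linarith)
  have h2 := h.bounds.tame_dist_mul_coll.bdd_mul (B := 2⁻¹ * (4 * M) ^ 2)
    (φ := fun q => 2⁻¹ * ‖twist X q‖ ^ 2)
    (((continuous_twist h.cont).norm.pow 2).const_mul 2⁻¹).measurable
    (fun q => by
      rw [abs_of_nonneg (by positivity)]
      gcongr
      exact h.norm_twist_le q)
  have h3 := h1.add (h2.const_mul (-1))
  refine ⟨?_, ?_⟩
  · convert h3.meas using 2 with q
    simp only [symFlux]; ring
  · convert h3.bound using 5 with M q
    simp only [symFlux]; ring

theorem SymPair.tame_revFlux (h : SymPair A M X G) : Tame (revFlux X G) := by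
  have hn : Measurable fun q : ℝ × (Vel 2 × Vel 2) => relDir q.2 :=
    measurable_relDir.comp measurable_snd
  have h1 := h.bounds.tame_jump.bdd_mul (B := 2 * (4 * M))
    (φ := fun q => 2 * inner ℝ (relDir q.2) (twist X q))
    ((hn.inner (continuous_twist h.cont).measurable).const_mul 2)
    (fun q => by
      rw [abs_mul, abs_two]
      refine mul_le_mul_of_nonneg_left ((abs_real_inner_le_norm _ _).trans ?_) zero_le_two
      have := mul_le_mul (norm_relDir_le q.2) (h.norm_twist_le q) (norm_nonneg _) zero_le_one
      linarith)
  have h2 := (h.bounds.tame_dist_mul.add h.bounds.tame_dist_mul_coll).bdd_mul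
    (B := 2⁻¹ * (4 * M) ^ 2) (φ := fun q => 2⁻¹ * ‖twist X q‖ ^ 2)
    (((continuous_twist h.cont).norm.pow 2).const_mul 2⁻¹).measurable
    (fun q => by
      rw [abs_of_nonneg (by positivity)]
      gcongr
      exact h.norm_twist_le q)
  have h3 := (h1.add h2).const_mul (-1)
  refine ⟨?_, ?_⟩
  · convert h3.meas using 2 with q
    simp only [revFlux]; ring
  · convert h3.bound using 5 with M q
    simp only [revFlux]; ring

theorem SymPair.integral_fisherFlux_le (h : SymPair A M X G) (a : ℝ) :
    2 * ∫ p, fisherFlux X G (fun p => G p • X p.1) (fun p => G p • X p.2) (a, p) ≤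
      ∫ p, symFlux X G (a, p) := by
  have hF := (h.bounds.tame_fisherFlux h.cont h.norm_le).integrable_right a
  have hFs : Integrable fun p : Vel 2 × Vel 2 =>
      fisherFlux X G (fun p => G p • X p.1) (fun p => G p • X p.2) (a, p.swap) := hF.swap
  have hb : ∀ p : Vel 2 × Vel 2, ‖X p.1‖ ^ 2 + ‖X p.2‖ ^ 2 ≤ M ^ 2 + M ^ 2 := fun p => by
    gcongr <;> exact h.norm_le _
  have hc : Continuous fun p : Vel 2 × Vel 2 => ‖X p.1‖ ^ 2 + ‖X p.2‖ ^ 2 := by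
    have := h.cont
    fun_prop
  have hE : Integrable fun p : Vel 2 × Vel 2 =>
      (‖X p.1‖ ^ 2 + ‖X p.2‖ ^ 2) * (‖p.1 - p.2‖ * G p) :=
    (h.bounds.tame_dist_mul.bdd_mul (B := M ^ 2 + M ^ 2)
      (φ := fun q => ‖X q.2.1‖ ^ 2 + ‖X q.2.2‖ ^ 2) (hc.comp continuous_snd).measurable
      (fun q => by rw [abs_of_nonneg (by positivity)]; exact hb q.2)).integrable_right a
  have hE' : Integrable fun p : Vel 2 × Vel 2 =>
      (‖X (coll a p).1‖ ^ 2 + ‖X (coll a p).2‖ ^ 2) * (‖p.1 - p.2‖ * G (coll a p)) :=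
    (h.bounds.tame_dist_mul_coll.bdd_mul (B := M ^ 2 + M ^ 2)
      (φ := fun q => ‖X (coll q.1 q.2).1‖ ^ 2 + ‖X (coll q.1 q.2).2‖ ^ 2)
      (hc.comp continuous_coll).measurable
      (fun q => by rw [abs_of_nonneg (by positivity)]; exact hb _)).integrable_right a
  have e : ∫ p : Vel 2 × Vel 2,
      (‖X (coll a p).1‖ ^ 2 + ‖X (coll a p).2‖ ^ 2) * (‖p.1 - p.2‖ * G (coll a p))
      = ∫ p : Vel 2 × Vel 2, (‖X p.1‖ ^ 2 + ‖X p.2‖ ^ 2) * (‖p.1 - p.2‖ * G p) := by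
    rw [← integral_comp_coll a fun p => (‖X p.1‖ ^ 2 + ‖X p.2‖ ^ 2) * (‖p.1 - p.2‖ * G p)]
    simp only [norm_coll_sub]
  have hD : Integrable fun p : Vel 2 × Vel 2 =>
      (‖X (coll a p).1‖ ^ 2 + ‖X (coll a p).2‖ ^ 2) * (‖p.1 - p.2‖ * G (coll a p)) -
        (‖X p.1‖ ^ 2 + ‖X p.2‖ ^ 2) * (‖p.1 - p.2‖ * G p) := hE'.sub hE
  have hsw := integral_comp_swap
    fun p => fisherFlux X G (fun p => G p • X p.1) (fun p => G p • X p.2) (a, p)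
  have hS := h.tame_symFlux.integrable_right a
  calc 2 * ∫ p, fisherFlux X G (fun p => G p • X p.1) (fun p => G p • X p.2) (a, p)
      = ∫ p : Vel 2 × Vel 2, (fisherFlux X G (fun p => G p • X p.1) (fun p => G p • X p.2) (a, p) +
        fisherFlux X G (fun p => G p • X p.1) (fun p => G p • X p.2) (a, p.swap)) := by
        rw [integral_add hF hFs, hsw]; ring
    _ ≤ ∫ p : Vel 2 × Vel 2, (symFlux X G (a, p) +
        ((‖X (coll a p).1‖ ^ 2 + ‖X (coll a p).2‖ ^ 2) * (‖p.1 - p.2‖ * G (coll a p)) -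
        (‖X p.1‖ ^ 2 + ‖X p.2‖ ^ 2) * (‖p.1 - p.2‖ * G p))) :=
        integral_mono (hF.add hFs) (hS.add hD) fun p => fisherFlux_add_swap_le h a p
    _ = _ := by rw [integral_add hS hD, integral_sub hE' hE, e]; ring

theorem SymPair.integral_symFlux_add_neg (h : SymPair A M X G) (a : ℝ) :
    (∫ p, symFlux X G (a, p)) + ∫ p, symFlux X G (-a, p) = ∫ p, revFlux X G (a, p) := by
  have hS := h.tame_symFlux.integrable_right
  have e := integral_comp_coll a fun p => symFlux X G (-a, p)
  have hS' : Integrable fun p => symFlux X G (-a, coll a p) :=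
    (measurePreserving_coll a).integrable_comp_of_integrable (hS (-a))
  rw [← e, ← integral_add (hS a) hS']
  exact integral_congr_ae (Filter.Eventually.of_forall fun p => symFlux_add_symFlux_neg X G a p)

theorem continuous_hsAngular_cos : Continuous fun a : ℝ => hsAngular (Real.cos a) :=
  continuous_hsAngular.comp Real.continuous_cos

theorem hsAngular_cos_mem (a : ℝ) : 0 ≤ hsAngular (Real.cos a) ∧ hsAngular (Real.cos a) ≤ 1 := by
  unfold hsAngular
  have h0 := Real.arccos_nonneg (Real.cos a)
  have h1 := Real.arccos_le_pi (Real.cos a)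
  exact ⟨Real.sin_nonneg_of_nonneg_of_le_pi (by linarith) (by linarith [Real.pi_pos]),
    Real.sin_le_one _⟩

theorem Tame.angular_mul {H : ℝ × (Vel 2 × Vel 2) → ℝ} (h : Tame H) :
    Tame fun q => hsAngular (Real.cos q.1) * H q :=
  h.bdd_mul (B := 1) (continuous_hsAngular_cos.comp continuous_fst).measurable fun q => by
    rw [abs_of_nonneg (hsAngular_cos_mem q.1).1]; exact (hsAngular_cos_mem q.1).2

theorem Tame.angular_intervalIntegrable {H : ℝ × (Vel 2 × Vel 2) → ℝ} (h : Tame H) (s t : ℝ) :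
    IntervalIntegrable (fun a => hsAngular (Real.cos a) * ∫ p, H (a, p)) volume s t := by
  have := h.angular_mul.intervalIntegrable s t
  simpa only [integral_const_mul] using this

/-- The symmetrization of the dissipation: exchanging the particles, then the collisions with
their inverses, then replacing the angle by its opposite. -/
theorem SymPair.integral_angular_fisherFlux_le (h : SymPair A M X G) :
    ∫ a in (-Real.pi)..Real.pi, hsAngular (Real.cos a) *
        ∫ p, fisherFlux X G (fun p => G p • X p.1) (fun p => G p • X p.2) (a, p) ≤
      2⁻¹ * ∫ a in (-(Real.pi / 2))..(Real.pi / 2),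
        hsSym (Real.cos a) * ∫ p, revFlux X G (a, p) := by
  have hpi := Real.pi_pos
  have hF := (h.bounds.tame_fisherFlux h.cont h.norm_le).angular_intervalIntegrable
  have hS := h.tame_symFlux.angular_intervalIntegrable
  have hR := h.tame_revFlux.angular_intervalIntegrable
  set κ : ℝ → ℝ := fun a => ∫ p, revFlux X G (a, p) with hκ
  set ν : ℝ → ℝ := fun a => ∫ p, symFlux X G (a, p) with hν
  have hκp : ∀ a, κ (a + Real.pi) = κ a := fun a => by
    simp only [hκ, revFlux_add_pi X h.swap]
  -- the exchange of the particles
  have h1 : ∫ a in (-Real.pi)..Real.pi, hsAngular (Real.cos a) *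
        ∫ p, fisherFlux X G (fun p => G p • X p.1) (fun p => G p • X p.2) (a, p) ≤
      ∫ a in (-Real.pi)..Real.pi, 2⁻¹ * (hsAngular (Real.cos a) * ν a) := by
    refine intervalIntegral.integral_mono_on (by linarith) (hF _ _) ((hS _ _).const_mul _)
      fun a _ => ?_
    have := mul_le_mul_of_nonneg_left (h.integral_fisherFlux_le a) (hsAngular_cos_mem a).1
    simp only [hν]
    linarith
  -- the opposite angle
  have h2 : ∫ a in (-Real.pi)..Real.pi, hsAngular (Real.cos a) * ν a
      = ∫ a in (-Real.pi)..Real.pi, hsAngular (Real.cos a) * ν (-a) := by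
    have := intervalIntegral.integral_comp_neg (a := -Real.pi) (b := Real.pi)
      fun a => hsAngular (Real.cos a) * ν a
    simp only [Real.cos_neg, neg_neg] at this
    exact this.symm
  have hS' : IntervalIntegrable (fun a => hsAngular (Real.cos a) * ν (-a)) volume
      (-Real.pi) Real.pi := by
    have := (hS Real.pi (-Real.pi)).comp_sub_left 0
    simpa [Real.cos_neg] using this
  have h3 : 2 * ∫ a in (-Real.pi)..Real.pi, hsAngular (Real.cos a) * ν a
      = ∫ a in (-Real.pi)..Real.pi, hsAngular (Real.cos a) * κ a := by
    rw [two_mul]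
    nth_rewrite 2 [h2]
    rw [← intervalIntegral.integral_add (hS _ _) hS']
    refine intervalIntegral.integral_congr fun a _ => ?_
    simp only [hκ, hν, ← h.integral_symFlux_add_neg a]
    ring
  -- the opposite direction
  have h4 : ∫ a in (-Real.pi)..Real.pi, hsAngular (Real.cos a) * κ a
      = ∫ a in (-(Real.pi / 2))..(Real.pi / 2), 2 * (hsSym (Real.cos a) * κ a) := by
    have hper : Function.Periodic (fun a => hsAngular (Real.cos a) * κ a) (2 * Real.pi) := by
      intro a
      have : κ (a + 2 * Real.pi) = κ a := by
        rw [show a + 2 * Real.pi = a + Real.pi + Real.pi by ring, hκp, hκp]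
      simp only [Real.cos_add_two_pi, this]
    have e1 := hper.intervalIntegral_add_eq (-Real.pi) (-(Real.pi / 2))
    rw [show -Real.pi + 2 * Real.pi = Real.pi by ring,
      show -(Real.pi / 2) + 2 * Real.pi = Real.pi / 2 + Real.pi by ring] at e1
    have e2 : ∫ a in (Real.pi / 2)..(Real.pi / 2 + Real.pi), hsAngular (Real.cos a) * κ a
        = ∫ a in (-(Real.pi / 2))..(Real.pi / 2), hsAngular (-Real.cos a) * κ a := by
      have := intervalIntegral.integral_comp_add_right (a := -(Real.pi / 2)) (b := Real.pi / 2)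
        (fun a => hsAngular (Real.cos a) * κ a) Real.pi
      rw [show -(Real.pi / 2) + Real.pi = Real.pi / 2 by ring] at this
      rw [← this]
      simp only [Real.cos_add_pi, hκp]
    have hR' : IntervalIntegrable (fun a => hsAngular (-Real.cos a) * κ a) volume
        (-(Real.pi / 2)) (Real.pi / 2) := by
      have := (hR (Real.pi / 2) (Real.pi / 2 + Real.pi)).comp_add_right Real.pi
      simp only [Real.cos_add_pi] at this
      convert this using 2
      · exact congrArg _ (hκp _).symm
      · ring
      · ring
    rw [e1, ← intervalIntegral.integral_add_adjacent_intervals (hR _ (Real.pi / 2)) (hR _ _), e2,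
      ← intervalIntegral.integral_add (hR _ _) hR']
    refine intervalIntegral.integral_congr fun a _ => ?_
    simp only [hsSym]
    ring
  rw [intervalIntegral.integral_const_mul] at h1
  rw [intervalIntegral.integral_const_mul] at h4
  simp only [hν, hκ] at *
  linarith

end

/-! ### An inequality on the circle of collisions -/

theorem intervalIntegral_swap_of_continuous {φ : ℝ → ℝ → ℝ}
    (hφ : Continuous (Function.uncurry φ)) {a b c d : ℝ} (hab : a ≤ b) (hcd : c ≤ d) :
    ∫ x in a..b, ∫ y in c..d, φ x y = ∫ y in c..d, ∫ x in a..b, φ x y := by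
  simp only [intervalIntegral.integral_of_le hab, intervalIntegral.integral_of_le hcd]
  refine integral_integral_swap ?_
  rw [Measure.prod_restrict]
  have h := hφ.continuousOn.integrableOn_compact
    (μ := (volume : Measure ℝ).prod (volume : Measure ℝ))
    ((isCompact_Icc (a := a) (b := b)).prod (isCompact_Icc (a := c) (b := d)))
  exact h.mono_set (prod_mono Ioc_subset_Icc_self Ioc_subset_Icc_self)

section

variable {U u : ℝ → ℝ}

/-- The increments of a periodic function over an angle at most the half period. -/
theorem sq_increment_le {S s : ℝ → ℝ} {P : ℝ} (hS : ∀ x, HasDerivAt S (s x) x)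
    (hs : Continuous s) (hp : Function.Periodic s P) (x : ℝ) {a : ℝ} (ha : |a| ≤ P) :
    (S (x + a) - S x) ^ 2 ≤ |a| * ∫ y in (0 : ℝ)..P, s y ^ 2 := by
  have hint : ∀ α β : ℝ, IntervalIntegrable (fun y => s y ^ 2) volume α β := fun α β =>
    (hs.pow 2).intervalIntegrable _ _
  have hperiod : ∀ α : ℝ, ∫ y in α..α + P, s y ^ 2 = ∫ y in (0 : ℝ)..P, s y ^ 2 := by
    intro α
    have hp2 : Function.Periodic (fun y => s y ^ 2) P := fun y => by simp only [hp y]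
    have := hp2.intervalIntegral_add_eq α 0
    rwa [zero_add] at this
  -- the Cauchy-Schwarz inequality on an interval of length `l`
  have key : ∀ α l : ℝ, 0 ≤ l → l ≤ P →
      (S (α + l) - S α) ^ 2 ≤ l * ∫ y in (0 : ℝ)..P, s y ^ 2 := by
    intro α l hl hlP
    rcases hl.eq_or_lt with rfl | hl
    · simp
    have h1 : ∫ y in α..α + l, s y = S (α + l) - S α :=
      intervalIntegral.integral_eq_sub_of_hasDerivAt (fun y _ => hS y) (hs.intervalIntegrable _ _)
    set δ := S (α + l) - S α with hδ
    have h2 : 0 ≤ ∫ y in α..α + l, (s y - δ / l) ^ 2 :=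
      intervalIntegral.integral_nonneg (by linarith) fun y _ => sq_nonneg _
    have h3 : ∫ y in α..α + l, (s y - δ / l) ^ 2
        = (∫ y in α..α + l, s y ^ 2) - δ ^ 2 / l := by
      have e : ∀ y, (s y - δ / l) ^ 2 = s y ^ 2 - (2 * (δ / l) * s y - (δ / l) ^ 2) := fun y => by
        ring
      simp only [e]
      rw [intervalIntegral.integral_sub (hint _ _)
        (Continuous.intervalIntegrable (by fun_prop) _ _),
        intervalIntegral.integral_sub (Continuous.intervalIntegrable (by fun_prop) _ _)
          (continuous_const.intervalIntegrable _ _), intervalIntegral.integral_const_mul, h1,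
        intervalIntegral.integral_const]
      rw [add_sub_cancel_left, smul_eq_mul]
      field_simp
      ring
    have h4 : ∫ y in α..α + l, s y ^ 2 ≤ ∫ y in α..α + P, s y ^ 2 := by
      rw [← intervalIntegral.integral_add_adjacent_intervals (hint α (α + l)) (hint _ (α + P))]
      have : 0 ≤ ∫ y in (α + l)..(α + P), s y ^ 2 :=
        intervalIntegral.integral_nonneg (by linarith) fun y _ => sq_nonneg _
      linarith
    rw [hperiod] at h4
    have h5 : δ ^ 2 / l ≤ ∫ y in (0 : ℝ)..P, s y ^ 2 := by linarith
    rwa [div_le_iff₀ hl, mul_comm] at h5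
  rcases le_total 0 a with h | h
  · rw [abs_of_nonneg h] at ha ⊢
    exact key x a h ha
  · rw [abs_of_nonpos h] at ha ⊢
    have := key (x + a) (-a) (by linarith) ha
    rw [show x + a + -a = x by ring] at this
    calc _ = (S x - S (x + a)) ^ 2 := by ring
      _ ≤ _ := this

/-- For a `π`-periodic `U` with derivative `u` and `S = exp (U / 2)`, the increments of `S` are
dominated by those of `u`. The constants leave room: `√2 π² ≤ 16` is what is needed. -/
theorem integral_circle_le (hU : ∀ x, HasDerivAt U (u x) x) (hu : Continuous u)
    (hp : Function.Periodic U Real.pi) :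
    ∫ a in (-(Real.pi / 2))..(Real.pi / 2), ∫ x in (0 : ℝ)..Real.pi,
      (Real.sqrt 2 * (Real.exp (U (x + a) / 2) - Real.exp (U x / 2)) ^ 2 -
        2⁻¹ * ((Real.exp (U x / 2) ^ 2 + Real.exp (U (x + a) / 2) ^ 2) * (u (x + a) - u x) ^ 2))
      ≤ 0 := by
  have hpi := Real.pi_pos
  have hUc : Continuous U := continuous_iff_continuousAt.mpr fun x => (hU x).continuousAt
  have hpu : Function.Periodic u Real.pi := by
    intro x
    have h1 : HasDerivAt (fun y => U (y + Real.pi)) (u (x + Real.pi)) x := (hU _).comp_add_const x _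
    rw [show (fun y => U (y + Real.pi)) = U from funext hp] at h1
    exact h1.unique (hU x)
  set S : ℝ → ℝ := fun x => Real.exp (U x / 2) with hSdef
  have hS : ∀ x, HasDerivAt S (Real.exp (U x / 2) * (u x / 2)) x := fun x =>
    ((hU x).div_const 2).exp
  have hSc : Continuous S := continuous_iff_continuousAt.mpr fun x => (hS x).continuousAt
  have hSp : Function.Periodic S Real.pi := fun x => by simp only [hSdef, hp x]
  set I : ℝ := ∫ y in (0 : ℝ)..Real.pi, (S y * (u y / 2)) ^ 2 with hI
  have hI0 : 0 ≤ I := intervalIntegral.integral_nonneg hpi.le fun y _ => sq_nonneg _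
  -- the increments of `S`
  have hA : ∫ a in (-(Real.pi / 2))..(Real.pi / 2), ∫ x in (0 : ℝ)..Real.pi, (S (x + a) - S x) ^ 2
      ≤ Real.pi ^ 3 / 4 * I := by
    have h1 : ∀ a ∈ Icc (-(Real.pi / 2)) (Real.pi / 2),
        ∫ x in (0 : ℝ)..Real.pi, (S (x + a) - S x) ^ 2 ≤ |a| * (Real.pi * I) := by
      intro a ha
      have ha' : |a| ≤ Real.pi := abs_le.mpr ⟨by linarith [ha.1], by linarith [ha.2]⟩
      have : ∫ x in (0 : ℝ)..Real.pi, (S (x + a) - S x) ^ 2 ≤ ∫ x in (0 : ℝ)..Real.pi, |a| * I := by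
        refine intervalIntegral.integral_mono_on hpi.le
          (Continuous.intervalIntegrable (by fun_prop) _ _)
          (continuous_const.intervalIntegrable _ _) fun x _ => ?_
        refine sq_increment_le hS (by fun_prop) ?_ x ha'
        intro y
        simp only [hp y, hpu y]
      rw [intervalIntegral.integral_const, smul_eq_mul, sub_zero] at this
      linarith
    have h2 : ∫ a in (-(Real.pi / 2))..(Real.pi / 2), |a| = Real.pi ^ 2 / 4 := by
      rw [← intervalIntegral.integral_add_adjacent_intervals (b := 0)
        (continuous_abs.intervalIntegrable _ _) (continuous_abs.intervalIntegrable _ _)]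
      have e1 : ∫ a in (-(Real.pi / 2))..0, |a| = ∫ a in (-(Real.pi / 2))..0, -a :=
        intervalIntegral.integral_congr fun a ha => by
          rw [uIcc_of_le (by linarith)] at ha
          exact abs_of_nonpos ha.2
      have e2 : ∫ a in (0 : ℝ)..(Real.pi / 2), |a| = ∫ a in (0 : ℝ)..(Real.pi / 2), a :=
        intervalIntegral.integral_congr fun a ha => by
          rw [uIcc_of_le (by linarith)] at ha
          exact abs_of_nonneg ha.1
      rw [e1, e2, intervalIntegral.integral_neg, integral_id, integral_id]
      ring
    calc _ ≤ ∫ a in (-(Real.pi / 2))..(Real.pi / 2), |a| * (Real.pi * I) := by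
          refine intervalIntegral.integral_mono_on (by linarith)
            (Continuous.intervalIntegrable ?_ _ _)
            (Continuous.intervalIntegrable (by fun_prop) _ _) h1
          exact intervalIntegral.continuous_parametric_intervalIntegral_of_continuous'
            (by fun_prop) _ _
      _ = _ := by rw [intervalIntegral.integral_mul_const, h2]; ring
  -- the increments of `u`
  have hshift : ∀ a, ∫ x in (0 : ℝ)..Real.pi, S (x + a) ^ 2 * (u (x + a) - u x) ^ 2
      = ∫ x in (0 : ℝ)..Real.pi, S x ^ 2 * (u (x + -a) - u x) ^ 2 := by
    intro a
    have hper : Function.Periodic (fun x => S x ^ 2 * (u (x + -a) - u x) ^ 2) Real.pi := by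
      intro x
      simp only [hSp x, hpu x, show x + Real.pi + -a = x + -a + Real.pi by ring, hpu (x + -a)]
    have h1 := hper.intervalIntegral_add_eq 0 (0 + a)
    have h2 := intervalIntegral.integral_comp_add_right (a := 0) (b := Real.pi)
      (fun x => S x ^ 2 * (u (x + -a) - u x) ^ 2) a
    rw [show (0 : ℝ) + a + Real.pi = Real.pi + a by ring, ← h2] at h1
    rw [zero_add] at h1
    rw [h1]
    refine intervalIntegral.integral_congr fun x _ => ?_
    simp only [show x + a + -a = x by ring]
    ring
  have hB : 2 * Real.pi * ∫ x in (0 : ℝ)..Real.pi, (S x * u x) ^ 2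
      ≤ ∫ a in (-(Real.pi / 2))..(Real.pi / 2), ∫ x in (0 : ℝ)..Real.pi,
        (S x ^ 2 + S (x + a) ^ 2) * (u (x + a) - u x) ^ 2 := by
    have hc1 : Continuous (Function.uncurry fun a x : ℝ => S x ^ 2 * (u (x + a) - u x) ^ 2) := by
      simp only [Function.uncurry_def]; fun_prop
    have hc2 : Continuous fun a => ∫ x in (0 : ℝ)..Real.pi, S x ^ 2 * (u (x + a) - u x) ^ 2 :=
      intervalIntegral.continuous_parametric_intervalIntegral_of_continuous' hc1 _ _
    have e1 : ∀ a, ∫ x in (0 : ℝ)..Real.pi, (S x ^ 2 + S (x + a) ^ 2) * (u (x + a) - u x) ^ 2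
        = (∫ x in (0 : ℝ)..Real.pi, S x ^ 2 * (u (x + a) - u x) ^ 2) +
          ∫ x in (0 : ℝ)..Real.pi, S x ^ 2 * (u (x + -a) - u x) ^ 2 := by
      intro a
      rw [← hshift a, ← intervalIntegral.integral_add
        (Continuous.intervalIntegrable (by fun_prop) _ _)
        (Continuous.intervalIntegrable (by fun_prop) _ _)]
      refine intervalIntegral.integral_congr fun x _ => ?_
      ring
    have e2 : ∫ a in (-(Real.pi / 2))..(Real.pi / 2), ∫ x in (0 : ℝ)..Real.pi,
          S x ^ 2 * (u (x + -a) - u x) ^ 2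
        = ∫ a in (-(Real.pi / 2))..(Real.pi / 2), ∫ x in (0 : ℝ)..Real.pi,
          S x ^ 2 * (u (x + a) - u x) ^ 2 := by
      have := intervalIntegral.integral_comp_neg (a := -(Real.pi / 2)) (b := Real.pi / 2)
        fun a => ∫ x in (0 : ℝ)..Real.pi, S x ^ 2 * (u (x + a) - u x) ^ 2
      rwa [neg_neg] at this
    have hc2' : Continuous fun a => ∫ x in (0 : ℝ)..Real.pi, S x ^ 2 * (u (x + -a) - u x) ^ 2 :=
      hc2.comp continuous_neg
    simp only [e1]
    rw [intervalIntegral.integral_add (hc2.intervalIntegrable _ _)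
      (hc2'.intervalIntegrable _ _), e2,
      intervalIntegral_swap_of_continuous hc1 (by linarith) hpi.le, ← two_mul, mul_assoc]
    refine mul_le_mul_of_nonneg_left ?_ zero_le_two
    rw [← intervalIntegral.integral_const_mul]
    refine intervalIntegral.integral_mono_on hpi.le
      (Continuous.intervalIntegrable (by fun_prop) _ _) (Continuous.intervalIntegrable ?_ _ _)
      fun x _ => ?_
    · refine intervalIntegral.continuous_parametric_intervalIntegral_of_continuous' ?_ _ _
      simp only [Function.uncurry_def]; fun_prop
    -- expand the square: the mean of `u` vanishes
    rw [intervalIntegral.integral_const_mul, mul_pow]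
    have h1 : ∫ a in (-(Real.pi / 2))..(Real.pi / 2), u (x + a) = 0 := by
      rw [intervalIntegral.integral_comp_add_left (fun y => u y),
        intervalIntegral.integral_eq_sub_of_hasDerivAt (fun y _ => hU y)
          (hu.intervalIntegrable _ _)]
      rw [show x + Real.pi / 2 = x + -(Real.pi / 2) + Real.pi by ring, hp, sub_self]
    have h2 : Real.pi * u x ^ 2 ≤ ∫ a in (-(Real.pi / 2))..(Real.pi / 2), (u (x + a) - u x) ^ 2 := by
      have e : ∀ a, (u (x + a) - u x) ^ 2 = u (x + a) ^ 2 + (u x ^ 2 - 2 * u x * u (x + a)) :=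
        fun a => by ring
      simp only [e]
      rw [intervalIntegral.integral_add (Continuous.intervalIntegrable (by fun_prop) _ _)
        (Continuous.intervalIntegrable (by fun_prop) _ _),
        intervalIntegral.integral_sub (continuous_const.intervalIntegrable _ _)
        (Continuous.intervalIntegrable (by fun_prop) _ _), intervalIntegral.integral_const_mul, h1,
        intervalIntegral.integral_const, smul_eq_mul]
      have : 0 ≤ ∫ a in (-(Real.pi / 2))..(Real.pi / 2), u (x + a) ^ 2 :=
        intervalIntegral.integral_nonneg (by linarith) fun y _ => sq_nonneg _
      linarith
    nlinarith [mul_le_mul_of_nonneg_left h2 (sq_nonneg (S x))]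
  have hI4 : ∫ x in (0 : ℝ)..Real.pi, (S x * u x) ^ 2 = 4 * I := by
    rw [hI, ← intervalIntegral.integral_const_mul]
    refine intervalIntegral.integral_congr fun x _ => ?_
    ring
  rw [hI4] at hB
  have hc3 : Continuous (Function.uncurry fun a x : ℝ => (S (x + a) - S x) ^ 2) := by
    simp only [Function.uncurry_def]; fun_prop
  have hc4 : Continuous (Function.uncurry fun a x : ℝ =>
      (S x ^ 2 + S (x + a) ^ 2) * (u (x + a) - u x) ^ 2) := by
    simp only [Function.uncurry_def]; fun_prop
  have e : ∀ a, ∫ x in (0 : ℝ)..Real.pi, (Real.sqrt 2 * (S (x + a) - S x) ^ 2 -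
        2⁻¹ * ((S x ^ 2 + S (x + a) ^ 2) * (u (x + a) - u x) ^ 2))
      = Real.sqrt 2 * (∫ x in (0 : ℝ)..Real.pi, (S (x + a) - S x) ^ 2) -
        2⁻¹ * ∫ x in (0 : ℝ)..Real.pi, (S x ^ 2 + S (x + a) ^ 2) * (u (x + a) - u x) ^ 2 := by
    intro a
    rw [intervalIntegral.integral_sub (Continuous.intervalIntegrable (by fun_prop) _ _)
      (Continuous.intervalIntegrable (by fun_prop) _ _), intervalIntegral.integral_const_mul,
      intervalIntegral.integral_const_mul]
  show ∫ a in (-(Real.pi / 2))..(Real.pi / 2), ∫ x in (0 : ℝ)..Real.pi,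
    (Real.sqrt 2 * (S (x + a) - S x) ^ 2 -
      2⁻¹ * ((S x ^ 2 + S (x + a) ^ 2) * (u (x + a) - u x) ^ 2)) ≤ 0
  simp only [e]
  rw [intervalIntegral.integral_sub
    (((intervalIntegral.continuous_parametric_intervalIntegral_of_continuous' hc3 _ _
      ).intervalIntegrable _ _).const_mul _)
    (((intervalIntegral.continuous_parametric_intervalIntegral_of_continuous' hc4 _ _
      ).intervalIntegrable _ _).const_mul _), intervalIntegral.integral_const_mul,
    intervalIntegral.integral_const_mul]
  have hconst : Real.sqrt 2 * (Real.pi ^ 3 / 4) ≤ 4 * Real.pi := by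
    have h1 : Real.sqrt 2 ≤ 1.42 := by
      rw [Real.sqrt_le_left (by norm_num)]; norm_num
    have h2 : Real.pi ^ 2 ≤ 3.15 ^ 2 := by
      gcongr; exact Real.pi_lt_d2.le
    have h3 : Real.sqrt 2 * Real.pi ^ 2 ≤ 1.42 * 3.15 ^ 2 := by gcongr
    nlinarith
  have h6 := mul_le_mul_of_nonneg_left hA (Real.sqrt_nonneg 2)
  have h7 := mul_le_mul_of_nonneg_right hconst hI0
  linarith

end

section

variable {A M : ℝ} {X : Vel 2 → Vel 2} {G : Vel 2 × Vel 2 → ℝ}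

theorem continuous_coll_comp {Z : Type*} [TopologicalSpace Z] {a : Z → ℝ}
    {k : Z → Vel 2 × Vel 2} (ha : Continuous a) (hk : Continuous k) :
    Continuous fun x => coll (a x) (k x) :=
  continuous_coll.comp (f := fun x => (a x, k x)) (ha.prodMk hk)

theorem hasDerivAt_planeRot (z : Vel 2) (θ : ℝ) :
    HasDerivAt (fun θ => planeRot θ z) (quarter (planeRot θ z)) θ := by
  have h1 := (Real.hasDerivAt_cos θ).smul_const z
  have h2 := (Real.hasDerivAt_sin θ).smul_const (quarter z)
  have h3 := h1.fun_add h2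
  simp only [planeRot_apply]
  refine h3.congr_deriv ?_
  rw [map_add, map_smul, map_smul, quarter_quarter]
  module

/-- The derivative of `log G` along the circle of collisions of a pair. -/
theorem SymPair.hasDerivAt_log (h : SymPair A M X G) (p : Vel 2 × Vel 2) (θ : ℝ) :
    HasDerivAt (fun θ => Real.log (G (coll θ p)))
      (2⁻¹ * inner ℝ (quarter (planeRot θ (p.1 - p.2))) (relGrad X (coll θ p))) θ := by
  have h1 := (hasDerivAt_planeRot (p.1 - p.2) θ).const_smul (2⁻¹ : ℝ)
  have h2 : HasDerivAt (fun θ => coll θ p)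
      ((2⁻¹ : ℝ) • quarter (planeRot θ (p.1 - p.2)),
        -((2⁻¹ : ℝ) • quarter (planeRot θ (p.1 - p.2)))) θ :=
    (h1.const_add _).prodMk (h1.const_sub _)
  have h3 := ((h.bounds.grad (coll θ p)).comp_hasDerivAt θ h2).log (h.pos _).ne'
  refine h3.congr_deriv ?_
  have := (h.pos (coll θ p)).ne'
  simp only [add_apply, ContinuousLinearMap.comp_apply, Function.comp_apply,
    ContinuousLinearMap.coe_fst', ContinuousLinearMap.coe_snd', innerSL_apply_apply,
    real_inner_smul_left, real_inner_smul_right, inner_neg_right, relGrad, inner_sub_right]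
  rw [real_inner_comm (X (coll θ p).1), real_inner_comm (X (coll θ p).2)]
  field_simp
  ring

theorem quadratic_flux_le {r s₁ s₂ x δ : ℝ} (hr : 0 < r) (h₁ : 0 < s₁) (h₂ : 0 < s₂) :
    -(2 * x * (s₂ ^ 2 - s₁ ^ 2)) - 2⁻¹ * (x ^ 2 + (2 / r * δ) ^ 2) * (r * (s₁ ^ 2 + s₂ ^ 2)) ≤
      2 / r * (2 * (s₂ - s₁) ^ 2 - (s₁ ^ 2 + s₂ ^ 2) * δ ^ 2) := by
  set s := s₁ ^ 2 + s₂ ^ 2 with hs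
  have hs0 : 0 < s := by positivity
  have h3 : (s₂ ^ 2 - s₁ ^ 2) ^ 2 ≤ 2 * s * (s₂ - s₁) ^ 2 := by
    have : 2 * s * (s₂ - s₁) ^ 2 - (s₂ ^ 2 - s₁ ^ 2) ^ 2 = (s₂ - s₁) ^ 4 := by rw [hs]; ring
    nlinarith [sq_nonneg ((s₂ - s₁) ^ 2)]
  have h4 : 2 * (s₂ ^ 2 - s₁ ^ 2) ^ 2 / (r * s) ≤ 2 / r * (2 * (s₂ - s₁) ^ 2) := by
    rw [div_le_iff₀ (by positivity)]
    calc 2 * (s₂ ^ 2 - s₁ ^ 2) ^ 2 ≤ 2 * (2 * s * (s₂ - s₁) ^ 2) := by linarith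
      _ = _ := by field_simp
  -- complete the square in `x`
  have h5 : -(2 * x * (s₂ ^ 2 - s₁ ^ 2)) - 2⁻¹ * x ^ 2 * (r * s)
      ≤ 2 * (s₂ ^ 2 - s₁ ^ 2) ^ 2 / (r * s) := by
    rw [le_div_iff₀ (by positivity)]
    nlinarith [sq_nonneg (r * s * x + 2 * (s₂ ^ 2 - s₁ ^ 2))]
  have h6 : 2⁻¹ * (2 / r * δ) ^ 2 * (r * s) = 2 / r * (s * δ ^ 2) := by field_simp
  linarith

theorem revFlux_diag (v : Vel 2) (a : ℝ) : revFlux X G (a, (v, v)) = 0 := by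
  simp [revFlux, relDir]

/-- On the circle of collisions of a pair, the flux is controlled by the increments of `√G` and of
the tangential derivative of `log G`: the component of `twist` along the relative velocity is
eliminated by completing a square. -/
theorem SymPair.hsSym_mul_revFlux_le (h : SymPair A M X G) {p : Vel 2 × Vel 2} (hp : p.1 ≠ p.2)
    (a θ c : ℝ) :
    hsSym c * revFlux X G (a, coll θ p) ≤ 2 / ‖p.1 - p.2‖ *
      (Real.sqrt 2 * (Real.exp (Real.log (G (coll (θ + a) p)) / 2) -
          Real.exp (Real.log (G (coll θ p)) / 2)) ^ 2 -
        2⁻¹ * ((Real.exp (Real.log (G (coll θ p)) / 2) ^ 2 +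
          Real.exp (Real.log (G (coll (θ + a) p)) / 2) ^ 2) *
          (2⁻¹ * inner ℝ (quarter (planeRot (θ + a) (p.1 - p.2))) (relGrad X (coll (θ + a) p)) -
            2⁻¹ * inner ℝ (quarter (planeRot θ (p.1 - p.2))) (relGrad X (coll θ p))) ^ 2)) := by
  have hr : 0 < ‖p.1 - p.2‖ := norm_pos_iff.mpr (sub_ne_zero.mpr hp)
  have hexp : ∀ q, Real.exp (Real.log (G q) / 2) ^ 2 = G q := fun q => by
    rw [← Real.exp_nat_mul]
    push_cast
    rw [mul_div_cancel₀ _ two_ne_zero, Real.exp_log (h.pos q)]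
  set r := ‖p.1 - p.2‖ with hrdef
  set s₁ := Real.exp (Real.log (G (coll θ p)) / 2) with hs₁
  set s₂ := Real.exp (Real.log (G (coll (θ + a) p)) / 2) with hs₂
  set δ := 2⁻¹ * inner ℝ (quarter (planeRot (θ + a) (p.1 - p.2))) (relGrad X (coll (θ + a) p)) -
            2⁻¹ * inner ℝ (quarter (planeRot θ (p.1 - p.2))) (relGrad X (coll θ p)) with hδ
  have hca : coll a (coll θ p) = coll (θ + a) p := by rw [← coll_add, add_comm]
  have hdir : p.1 - p.2 = r • relDir p := by
    rw [relDir, smul_smul, mul_inv_cancel₀ hr.ne', one_smul]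
  set n := relDir (coll θ p) with hn
  have hn1 : ‖n‖ = 1 := by rw [hn, relDir_coll, norm_planeRot, norm_relDir hp]
  set D := twist X (a, coll θ p) with hD
  have hJ : inner ℝ (quarter n) D = 2 / r * δ := by
    have e1 : inner ℝ (quarter n) D = inner ℝ (quarter (planeRot a n)) (relGrad X (coll (θ + a) p))
        - inner ℝ (quarter n) (relGrad X (coll θ p)) := by
      rw [hD, twist, inner_sub_right]
      simp only [hca]
      rw [quarter_planeRot, inner_planeRot_left]
    have e2 : quarter (planeRot (θ + a) (p.1 - p.2)) = r • quarter (planeRot a n) := by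
      rw [hn, relDir_coll, hdir, map_smul, map_smul, add_comm, planeRot_add]
    have e3 : quarter (planeRot θ (p.1 - p.2)) = r • quarter n := by
      rw [hn, relDir_coll, hdir, map_smul, map_smul]
    rw [e1, hδ, e2, e3, real_inner_smul_left, real_inner_smul_left]
    field_simp
  have hnorm : ‖D‖ ^ 2 = inner ℝ n D ^ 2 + (2 / r * δ) ^ 2 := by
    rw [← hJ, ← norm_sq_mul_norm_sq, hn1]; ring
  have hq := quadratic_flux_le (x := inner ℝ n D) (δ := δ) hr (Real.exp_pos _ : 0 < s₁)
    (Real.exp_pos _ : 0 < s₂)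
  have hrev : revFlux X G (a, coll θ p) = -(2 * inner ℝ n D * (s₂ ^ 2 - s₁ ^ 2)) -
      2⁻¹ * (inner ℝ n D ^ 2 + (2 / r * δ) ^ 2) * (r * (s₁ ^ 2 + s₂ ^ 2)) := by
    rw [hs₁, hs₂, hexp, hexp, ← hnorm]
    simp only [revFlux, jump, hca, norm_coll_sub]
    rfl
  rw [← hrev] at hq
  obtain ⟨hb1, hb2⟩ := hsSym_bounds c
  have hmul := mul_le_mul_of_nonneg_left hq (by linarith : 0 ≤ hsSym c)
  refine hmul.trans ?_
  have h2r : 0 ≤ 2 / r := by positivity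
  have h1 : 0 ≤ (s₂ - s₁) ^ 2 := sq_nonneg _
  have h2 : 0 ≤ (s₁ ^ 2 + s₂ ^ 2) * δ ^ 2 := by positivity
  rw [← mul_assoc, mul_comm (hsSym c), mul_assoc]
  refine mul_le_mul_of_nonneg_left ?_ h2r
  nlinarith [mul_le_mul_of_nonneg_right hb2 h1, mul_le_mul_of_nonneg_right hb1 h2]

theorem SymPair.integral_revFlux_circle_nonpos (h : SymPair A M X G) (p : Vel 2 × Vel 2) :
    ∫ a in (-(Real.pi / 2))..(Real.pi / 2), hsSym (Real.cos a) *
      ∫ θ in (0 : ℝ)..Real.pi, revFlux X G (a, coll θ p) ≤ 0 := by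
  have hpi := Real.pi_pos
  rcases eq_or_ne p.1 p.2 with hp | hp
  · obtain ⟨v, w⟩ := p
    obtain rfl : v = w := hp
    simp [coll_diag, revFlux_diag]
  have hr : 0 < ‖p.1 - p.2‖ := norm_pos_iff.mpr (sub_ne_zero.mpr hp)
  set U : ℝ → ℝ := fun θ => Real.log (G (coll θ p)) with hU
  set u : ℝ → ℝ := fun θ =>
    2⁻¹ * inner ℝ (quarter (planeRot θ (p.1 - p.2))) (relGrad X (coll θ p)) with hu
  have hcc : Continuous fun θ => coll θ p :=
    continuous_coll_comp continuous_id continuous_const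
  have huc : Continuous u := by
    have h1 : Continuous fun θ => quarter (planeRot θ (p.1 - p.2)) :=
      quarter.continuous.comp (continuous_planeRot_comp continuous_id continuous_const)
    have h2 : Continuous fun θ => relGrad X (coll θ p) := (continuous_relGrad h.cont).comp hcc
    exact continuous_const.mul (h1.inner h2)
  have hUd : ∀ θ, HasDerivAt U (u θ) θ := h.hasDerivAt_log p
  have hUc : Continuous U := continuous_iff_continuousAt.mpr fun x => (hUd x).continuousAt
  have hUp : Function.Periodic U Real.pi := fun θ => by
    simp only [hU, coll_add_pi, h.swap]
  have key := integral_circle_le hUd huc hUp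
  have hRc : Continuous fun q : ℝ × ℝ => revFlux X G (q.1, coll q.2 p) := by
    have hc2 : Continuous fun q : ℝ × ℝ => coll q.2 p := hcc.comp continuous_snd
    have hc3 : Continuous fun q : ℝ × ℝ => (q.1, coll q.2 p) := continuous_fst.prodMk hc2
    have hD : Continuous fun q : ℝ × ℝ => twist X (q.1, coll q.2 p) :=
      (continuous_twist h.cont).comp hc3
    have hj : Continuous fun q : ℝ × ℝ => jump G (q.1, coll q.2 p) :=
      (continuous_jump h.bounds.continuous).comp hc3
    have hn : Continuous fun q : ℝ × ℝ => relDir (coll q.2 p) := by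
      simp only [relDir_coll]
      exact continuous_planeRot_comp continuous_snd continuous_const
    have hG : Continuous fun q : ℝ × ℝ => G (coll q.2 p) := h.bounds.continuous.comp hc2
    have hG' : Continuous fun q : ℝ × ℝ => G (coll q.1 (coll q.2 p)) :=
      h.bounds.continuous.comp (continuous_coll_comp continuous_fst hc2)
    simp only [revFlux, norm_coll_sub]
    exact (((hn.inner hD).const_mul 2).mul hj).neg.sub
      (((hD.norm.pow 2).const_mul 2⁻¹).mul ((hG.add hG').const_mul _))
  have hinner : ∀ a, hsSym (Real.cos a) * ∫ θ in (0 : ℝ)..Real.pi, revFlux X G (a, coll θ p) ≤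
      2 / ‖p.1 - p.2‖ * ∫ θ in (0 : ℝ)..Real.pi,
      (Real.sqrt 2 * (Real.exp (U (θ + a) / 2) - Real.exp (U θ / 2)) ^ 2 -
        2⁻¹ * ((Real.exp (U θ / 2) ^ 2 + Real.exp (U (θ + a) / 2) ^ 2) *
          (u (θ + a) - u θ) ^ 2)) := by
    intro a
    rw [← intervalIntegral.integral_const_mul, ← intervalIntegral.integral_const_mul]
    have hRa : Continuous fun θ => revFlux X G (a, coll θ p) :=
      hRc.comp (f := fun θ : ℝ => (a, θ)) (continuous_const.prodMk continuous_id)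
    refine intervalIntegral.integral_mono_on hpi.le ((hRa.const_mul _).intervalIntegrable _ _)
      (Continuous.intervalIntegrable (by fun_prop) _ _) fun θ _ => ?_
    exact h.hsSym_mul_revFlux_le hp a θ _
  have hmono : ∫ a in (-(Real.pi / 2))..(Real.pi / 2), hsSym (Real.cos a) *
        ∫ θ in (0 : ℝ)..Real.pi, revFlux X G (a, coll θ p) ≤
      ∫ a in (-(Real.pi / 2))..(Real.pi / 2), 2 / ‖p.1 - p.2‖ * ∫ θ in (0 : ℝ)..Real.pi,
      (Real.sqrt 2 * (Real.exp (U (θ + a) / 2) - Real.exp (U θ / 2)) ^ 2 -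
        2⁻¹ * ((Real.exp (U θ / 2) ^ 2 + Real.exp (U (θ + a) / 2) ^ 2) *
          (u (θ + a) - u θ) ^ 2)) := by
    refine intervalIntegral.integral_mono_on (by linarith) (Continuous.intervalIntegrable ?_ _ _)
      (Continuous.intervalIntegrable ?_ _ _) fun a _ => hinner a
    · exact (continuous_hsSym.comp Real.continuous_cos).mul
        (intervalIntegral.continuous_parametric_intervalIntegral_of_continuous' hRc _ _)
    · refine continuous_const.mul
        (intervalIntegral.continuous_parametric_intervalIntegral_of_continuous' ?_ _ _)
      simp only [Function.uncurry_def]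
      fun_prop
  rw [intervalIntegral.integral_const_mul] at hmono
  exact hmono.trans (mul_nonpos_of_nonneg_of_nonpos (by positivity) key)

/-- The integral of the flux is nonpositive: by invariance it may be averaged over the circle of
collisions of each pair. -/
theorem SymPair.integral_angular_revFlux_nonpos (h : SymPair A M X G) :
    ∫ a in (-(Real.pi / 2))..(Real.pi / 2), hsSym (Real.cos a) * ∫ p, revFlux X G (a, p) ≤ 0 := by
  have hpi := Real.pi_pos
  have hT := h.tame_revFlux
  obtain ⟨B, hB⟩ := hT.bound
  have hm3 : Measurable fun x : ℝ × (ℝ × (Vel 2 × Vel 2)) => revFlux X G (x.2.1, coll x.1 x.2.2) := by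
    refine hT.meas.comp ((measurable_fst.comp measurable_snd).prodMk ?_)
    exact (continuous_coll_comp continuous_fst (by fun_prop)).measurable
  have hb3 : ∀ (θ a : ℝ) (p : Vel 2 × Vel 2),
      |revFlux X G (a, coll θ p)| ≤ B * ((1 + ‖p.1 - p.2‖) * pairWt p) := fun θ a p => by
    have := hB (a, coll θ p)
    simpa only [norm_coll_sub, pairWt_coll] using this
  -- averaging over the circle of collisions
  have havg : ∀ a, Real.pi * ∫ p, revFlux X G (a, p)
      = ∫ p, ∫ θ in (0 : ℝ)..Real.pi, revFlux X G (a, coll θ p) := by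
    intro a
    have ht : Tame fun q => revFlux X G (a, coll q.1 q.2) :=
      ⟨hm3.comp (f := fun q : ℝ × (Vel 2 × Vel 2) => (q.1, (a, q.2))) (by fun_prop), B,
        fun q => hb3 q.1 a q.2⟩
    simp only [intervalIntegral.integral_of_le hpi.le]
    rw [← integral_integral_swap (f := fun θ p => revFlux X G (a, coll θ p)) (ht.integrable _)]
    have e : ∀ θ, ∫ p, revFlux X G (a, coll θ p) = ∫ p, revFlux X G (a, p) := fun θ =>
      integral_comp_coll θ fun p => revFlux X G (a, p)
    simp only [e]
    simp [hpi.le]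
  have hs : ∀ a, |hsSym (Real.cos a)| ≤ 1 := fun a => by
    obtain ⟨h1, h2⟩ := hsSym_bounds (Real.cos a)
    rw [abs_of_nonneg (by linarith)]
    have : Real.sqrt 2 ≤ 2 := by rw [Real.sqrt_le_left (by norm_num)]; norm_num
    linarith
  have htame : Tame fun q => hsSym (Real.cos q.1) *
      ∫ θ in (0 : ℝ)..Real.pi, revFlux X G (q.1, coll θ q.2) := by
    refine Tame.bdd_mul (B := 1) ?_
      ((continuous_hsSym.comp Real.continuous_cos).comp continuous_fst).measurable fun q => hs q.1
    refine ⟨?_, B * Real.pi, fun q => ?_⟩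
    · simp only [intervalIntegral.integral_of_le hpi.le]
      exact (hm3.stronglyMeasurable.integral_prod_left'
        (μ := (volume : Measure ℝ).restrict (Ioc 0 Real.pi))).measurable
    · have := intervalIntegral.norm_integral_le_of_norm_le_const (a := 0) (b := Real.pi)
        (f := fun θ => revFlux X G (q.1, coll θ q.2)) fun θ _ => hb3 θ q.1 q.2
      rw [sub_zero, abs_of_pos hpi] at this
      calc _ ≤ _ := this
        _ = _ := by ring
  have hmain : Real.pi * ∫ a in (-(Real.pi / 2))..(Real.pi / 2),
        hsSym (Real.cos a) * ∫ p, revFlux X G (a, p)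
      = ∫ p, ∫ a in (-(Real.pi / 2))..(Real.pi / 2), hsSym (Real.cos a) *
        ∫ θ in (0 : ℝ)..Real.pi, revFlux X G (a, coll θ p) := by
    rw [← intervalIntegral.integral_const_mul]
    have e : ∀ a, Real.pi * (hsSym (Real.cos a) * ∫ p, revFlux X G (a, p))
        = ∫ p, hsSym (Real.cos a) * ∫ θ in (0 : ℝ)..Real.pi, revFlux X G (a, coll θ p) := by
      intro a
      rw [integral_const_mul, ← havg a]; ring
    simp only [e]
    simp only [intervalIntegral.integral_of_le (by linarith : -(Real.pi / 2) ≤ Real.pi / 2)]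
    exact integral_integral_swap (f := fun a p => hsSym (Real.cos a) *
      ∫ θ in (0 : ℝ)..Real.pi, revFlux X G (a, coll θ p)) (htame.integrable _)
  have hneg : ∫ p, ∫ a in (-(Real.pi / 2))..(Real.pi / 2), hsSym (Real.cos a) *
        ∫ θ in (0 : ℝ)..Real.pi, revFlux X G (a, coll θ p) ≤ 0 :=
    integral_nonpos fun p => h.integral_revFlux_circle_nonpos p
  rw [← hmain] at hneg
  exact nonpos_of_mul_nonpos_right hneg hpi

/-- The dissipation of the Fisher information of the product of two equal densities has a sign. -/
theorem SymPair.integral_angular_fisherFlux_nonpos (h : SymPair A M X G) :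
    ∫ a in (-Real.pi)..Real.pi, hsAngular (Real.cos a) *
      ∫ p, fisherFlux X G (fun p => G p • X p.1) (fun p => G p • X p.2) (a, p) ≤ 0 := by
  have h1 := h.integral_angular_fisherFlux_le
  have h2 := h.integral_angular_revFlux_nonpos
  linarith

end

/-! ### Regularised densities -/

/-- A nonnegative density of class `C²`, with gradient `f'` and Hessian `f''`, that decays like the
weight `wt` together with its derivatives. The last field is the classical inequality
`|∇f|² ≤ 2 f sup |D²f|`, with the decay taken into account. -/
structure DensityBounds (C : ℝ) (f : Vel 2 → ℝ) (f' : Vel 2 → Vel 2)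
    (f'' : Vel 2 → Vel 2 →L[ℝ] Vel 2) : Prop where
  one_le : 1 ≤ C
  nonneg : ∀ v, 0 ≤ f v
  grad : ∀ v, HasGradientAt f (f' v) v
  hess : ∀ v, HasFDerivAt f' (f'' v) v
  cont : Continuous f''
  le : ∀ v, f v ≤ C * wt v
  norm_grad_le : ∀ v, ‖f' v‖ ≤ C * wt v
  norm_hess_le : ∀ v, ‖f'' v‖ ≤ C * wt v
  sq_grad_le : ∀ v, ‖f' v‖ ^ 2 ≤ C * (f v * wt v)

/-- The regularised density `f + ε wt`. -/
def reg (ε : ℝ) (f : Vel 2 → ℝ) (v : Vel 2) : ℝ := f v + ε * wt v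

/-- The gradient of the regularised density. -/
def regGrad (ε : ℝ) (f' : Vel 2 → Vel 2) (v : Vel 2) : Vel 2 := f' v + ε • wtGrad v

/-- The Hessian of the regularised density. -/
def regHess (ε : ℝ) (f'' : Vel 2 → Vel 2 →L[ℝ] Vel 2) (v : Vel 2) : Vel 2 →L[ℝ] Vel 2 :=
  f'' v + ε • wtHess v

/-- The logarithmic gradient of the regularised density. -/
def score (ε : ℝ) (f : Vel 2 → ℝ) (f' : Vel 2 → Vel 2) (v : Vel 2) : Vel 2 :=
  (reg ε f v)⁻¹ • regGrad ε f' v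

/-- The derivative of the logarithmic gradient of the regularised density. -/
def scoreDeriv (ε : ℝ) (f : Vel 2 → ℝ) (f' : Vel 2 → Vel 2) (f'' : Vel 2 → Vel 2 →L[ℝ] Vel 2)
    (v : Vel 2) : Vel 2 →L[ℝ] Vel 2 :=
  (reg ε f v)⁻¹ • regHess ε f'' v +
    ((-(reg ε f v ^ 2)⁻¹) • innerSL ℝ (regGrad ε f' v)).smulRight (regGrad ε f' v)

/-- The product `f(v) f(w)`. -/
def tens (f : Vel 2 → ℝ) (p : Vel 2 × Vel 2) : ℝ := f p.1 * f p.2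

theorem hasPairGrad_tens {f : Vel 2 → ℝ} {f' : Vel 2 → Vel 2} (hf : ∀ v, HasGradientAt f (f' v) v) :
    HasPairGrad (tens f) (fun p => f p.2 • f' p.1) (fun p => f p.1 • f' p.2) := by
  intro p
  have h1 : HasFDerivAt (fun p : Vel 2 × Vel 2 => f p.1) _ p :=
    (hf p.1).hasFDerivAt.comp p hasFDerivAt_fst
  have h2 : HasFDerivAt (fun p : Vel 2 × Vel 2 => f p.2) _ p :=
    (hf p.2).hasFDerivAt.comp p hasFDerivAt_snd
  refine (h1.fun_mul h2).congr_fderiv ?_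
  ext y <;> simp

theorem HasPairGrad.sub {F G : Vel 2 × Vel 2 → ℝ} {F1 F2 G1 G2 : Vel 2 × Vel 2 → Vel 2}
    (hG : HasPairGrad G G1 G2) (hF : HasPairGrad F F1 F2) :
    HasPairGrad (fun p => G p - F p) (fun p => G1 p - F1 p) (fun p => G2 p - F2 p) := by
  intro p
  refine ((hG p).fun_sub (hF p)).congr_fderiv ?_
  ext y <;> simp

theorem fisherFlux_sub (X : Vel 2 → Vel 2) (F G : Vel 2 × Vel 2 → ℝ)
    (F1 F2 G1 G2 : Vel 2 × Vel 2 → Vel 2) (q : ℝ × (Vel 2 × Vel 2)) :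
    fisherFlux X (fun p => G p - F p) (fun p => G1 p - F1 p) (fun p => G2 p - F2 p) q =
      fisherFlux X G G1 G2 q - fisherFlux X F F1 F2 q := by
  simp only [fisherFlux, jumpGrad, jump, pullGrad, map_sub, inner_add_right, inner_sub_right,
    real_inner_smul_right]
  ring

namespace DensityBounds

variable {C ε : ℝ} {f : Vel 2 → ℝ} {f' : Vel 2 → Vel 2} {f'' : Vel 2 → Vel 2 →L[ℝ] Vel 2}

theorem continuous (h : DensityBounds C f f' f'') : Continuous f :=
  continuous_iff_continuousAt.mpr fun v => (h.grad v).hasFDerivAt.continuousAt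

theorem continuous_grad (h : DensityBounds C f f' f'') : Continuous f' :=
  continuous_iff_continuousAt.mpr fun v => (h.hess v).continuousAt

theorem reg_pos (h : DensityBounds C f f' f'') (hε : 0 < ε) (v : Vel 2) : 0 < reg ε f v :=
  add_pos_of_nonneg_of_pos (h.nonneg v) (mul_pos hε (wt_pos v))

theorem le_reg (h : DensityBounds C f f' f'') (v : Vel 2) : ε * wt v ≤ reg ε f v :=
  le_add_of_nonneg_left (h.nonneg v)

theorem reg_le (h : DensityBounds C f f' f'') (hε1 : ε ≤ 1) (v : Vel 2) :
    reg ε f v ≤ 2 * C * wt v := by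
  unfold reg
  have := wt_pos v
  nlinarith [h.le v, h.one_le, mul_le_mul_of_nonneg_right hε1 this.le,
    mul_le_mul_of_nonneg_right h.one_le this.le]

theorem continuous_reg (h : DensityBounds C f f' f'') : Continuous (reg ε f) :=
  h.continuous.add (continuous_wt.const_mul ε)

theorem hasGradientAt_reg (h : DensityBounds C f f' f'') (v : Vel 2) :
    HasGradientAt (reg ε f) (regGrad ε f' v) v := by
  have h1 := (h.grad v).hasFDerivAt.fun_add ((hasGradientAt_wt v).hasFDerivAt.const_mul ε)
  rw [hasGradientAt_iff_hasFDerivAt]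
  refine h1.congr_fderiv ?_
  ext y; simp [regGrad]

theorem hasFDerivAt_regGrad (h : DensityBounds C f f' f'') (v : Vel 2) :
    HasFDerivAt (regGrad ε f') (regHess ε f'' v) v :=
  (h.hess v).fun_add ((hasFDerivAt_wtGrad v).fun_const_smul ε)

theorem continuous_regGrad (h : DensityBounds C f f' f'') : Continuous (regGrad ε f') :=
  continuous_iff_continuousAt.mpr fun v => (h.hasFDerivAt_regGrad v).continuousAt

theorem norm_regGrad_le (h : DensityBounds C f f' f'') (hε : 0 < ε) (hε1 : ε ≤ 1) (v : Vel 2) :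
    ‖regGrad ε f' v‖ ≤ 131 * C * wt v := by
  unfold regGrad
  refine (norm_add_le _ _).trans ?_
  rw [norm_smul, Real.norm_of_nonneg hε.le]
  have h1 := norm_wtGrad_le v
  have hw := wt_pos v
  have h2 : ε * ‖wtGrad v‖ ≤ 1 * (130 * wt v) := mul_le_mul hε1 h1 (norm_nonneg _) zero_le_one
  nlinarith [h.norm_grad_le v, mul_le_mul_of_nonneg_right h.one_le hw.le]

theorem norm_regHess_le (h : DensityBounds C f f' f'') (hε : 0 < ε) (hε1 : ε ≤ 1) (v : Vel 2) :
    ‖regHess ε f'' v‖ ≤ 131 * C * wt v := by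
  unfold regHess
  refine (norm_add_le _ _).trans ?_
  rw [norm_smul, Real.norm_of_nonneg hε.le]
  have h1 := norm_wtHess_le v
  have hw := wt_pos v
  have h2 : ε * ‖wtHess v‖ ≤ 1 * (130 * wt v) := mul_le_mul hε1 h1 (norm_nonneg _) zero_le_one
  nlinarith [h.norm_hess_le v, mul_le_mul_of_nonneg_right h.one_le hw.le]

theorem hasFDerivAt_score (h : DensityBounds C f f' f'') (hε : 0 < ε) (v : Vel 2) :
    HasFDerivAt (score ε f f') (scoreDeriv ε f f' f'' v) v := by
  have h1 := (hasDerivAt_inv (h.reg_pos hε v).ne').comp_hasFDerivAt v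
    (h.hasGradientAt_reg (ε := ε) v).hasFDerivAt
  refine (h1.fun_smul (h.hasFDerivAt_regGrad v)).congr_fderiv ?_
  ext y : 1
  simp [scoreDeriv]

theorem continuous_score (h : DensityBounds C f f' f'') (hε : 0 < ε) : Continuous (score ε f f') :=
  continuous_iff_continuousAt.mpr fun v => (h.hasFDerivAt_score hε v).continuousAt

theorem continuous_scoreDeriv (h : DensityBounds C f f' f'') (hε : 0 < ε) :
    Continuous (scoreDeriv ε f f' f'') := by
  have h1 : Continuous fun v => (reg ε f v)⁻¹ := h.continuous_reg.inv₀ fun v => (h.reg_pos hε v).ne'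
  have h2 : Continuous fun v => -(reg ε f v ^ 2)⁻¹ :=
    ((h.continuous_reg.pow 2).inv₀ fun v => pow_ne_zero 2 (h.reg_pos hε v).ne').neg
  have h3 : Continuous (regHess ε f'') := h.cont.add (continuous_wtHess.const_smul ε)
  have h4 : Continuous fun v => (-(reg ε f v ^ 2)⁻¹) • innerSL ℝ (regGrad ε f' v) :=
    h2.smul ((innerSL ℝ (E := Vel 2)).continuous.comp h.continuous_regGrad)
  unfold scoreDeriv
  exact (h1.smul h3).add ((ContinuousLinearMap.smulRightL ℝ (Vel 2) (Vel 2)).continuous₂.comp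
    (h4.prodMk h.continuous_regGrad))

theorem norm_score_le (h : DensityBounds C f f' f'') (hε : 0 < ε) (hε1 : ε ≤ 1) (v : Vel 2) :
    ‖score ε f f' v‖ ≤ 131 * C / ε := by
  have hw := wt_pos v
  unfold score
  rw [norm_smul, norm_inv, Real.norm_of_nonneg (h.reg_pos hε v).le]
  calc (reg ε f v)⁻¹ * ‖regGrad ε f' v‖ ≤ (ε * wt v)⁻¹ * (131 * C * wt v) := by
        gcongr
        · exact h.le_reg v
        · exact h.norm_regGrad_le hε hε1 v
    _ = _ := by field_simp

theorem norm_scoreDeriv_le (h : DensityBounds C f f' f'') (hε : 0 < ε) (hε1 : ε ≤ 1) (v : Vel 2) :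
    ‖scoreDeriv ε f f' f'' v‖ ≤ 131 * C / ε + (131 * C / ε) ^ 2 := by
  have hw := wt_pos v
  have hg := h.reg_pos hε v
  have hC := h.one_le
  unfold scoreDeriv
  refine (norm_add_le _ _).trans (add_le_add ?_ ?_)
  · rw [norm_smul, norm_inv, Real.norm_of_nonneg hg.le]
    calc (reg ε f v)⁻¹ * ‖regHess ε f'' v‖ ≤ (ε * wt v)⁻¹ * (131 * C * wt v) := by
          gcongr
          · exact h.le_reg v
          · exact h.norm_regHess_le hε hε1 v
      _ = _ := by field_simp
  · rw [ContinuousLinearMap.norm_smulRight_apply, norm_smul, innerSL_apply_norm, norm_neg, norm_inv,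
      Real.norm_of_nonneg (by positivity)]
    have := h.norm_score_le hε hε1 v
    unfold score at this
    rw [norm_smul, norm_inv, Real.norm_of_nonneg hg.le] at this
    calc (reg ε f v ^ 2)⁻¹ * ‖regGrad ε f' v‖ * ‖regGrad ε f' v‖
        = ((reg ε f v)⁻¹ * ‖regGrad ε f' v‖) ^ 2 := by ring
      _ ≤ _ := by gcongr

/-- A bound for the logarithmic gradient and its derivative. -/
theorem norm_score_le' (h : DensityBounds C f f' f'') (hε : 0 < ε) (hε1 : ε ≤ 1) (v : Vel 2) :
    ‖score ε f f' v‖ ≤ 131 * C / ε + (131 * C / ε) ^ 2 :=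
  (h.norm_score_le hε hε1 v).trans (le_add_of_nonneg_right (sq_nonneg _))

theorem sq_norm_regGrad_le (h : DensityBounds C f f' f'') (hε : 0 ≤ ε) (v : Vel 2) :
    ‖regGrad ε f' v‖ ^ 2 ≤ 2 * (C * (f v * wt v)) + 33800 * (ε * wt v) ^ 2 := by
  have h2 : ‖ε • wtGrad v‖ ≤ 130 * (ε * wt v) := by
    rw [norm_smul, Real.norm_of_nonneg hε]
    nlinarith [mul_le_mul_of_nonneg_left (norm_wtGrad_le v) hε]
  have h3 : ‖ε • wtGrad v‖ ^ 2 ≤ (130 * (ε * wt v)) ^ 2 := by gcongr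
  have h4 : ‖regGrad ε f' v‖ ^ 2 ≤ (‖f' v‖ + ‖ε • wtGrad v‖) ^ 2 := by
    gcongr; exact norm_add_le _ _
  nlinarith [h.sq_grad_le v, sq_nonneg (‖f' v‖ - ‖ε • wtGrad v‖)]

/-- The sharp bound on the logarithmic gradient, with constants that do not depend on `ε`. -/
theorem mul_sq_norm_score_le (h : DensityBounds C f f' f'') (hε : 0 < ε) (v : Vel 2) :
    ε * ‖score ε f f' v‖ ^ 2 ≤ 2 * C * (ε * (f v * wt v) / reg ε f v ^ 2) + 33800 * ε := by
  have hw := wt_pos v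
  have hg := h.reg_pos hε v
  have h1 := h.sq_norm_regGrad_le hε.le v
  have h5 : (ε * wt v) ^ 2 / reg ε f v ^ 2 ≤ 1 := by
    rw [div_le_one (by positivity)]
    gcongr
    exact h.le_reg v
  unfold score
  rw [norm_smul, norm_inv, Real.norm_of_nonneg hg.le]
  calc ε * ((reg ε f v)⁻¹ * ‖regGrad ε f' v‖) ^ 2
      = ε * (‖regGrad ε f' v‖ ^ 2 / reg ε f v ^ 2) := by field_simp
    _ ≤ ε * ((2 * (C * (f v * wt v)) + 33800 * (ε * wt v) ^ 2) / reg ε f v ^ 2) := by gcongr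
    _ = 2 * C * (ε * (f v * wt v) / reg ε f v ^ 2) +
        33800 * ε * ((ε * wt v) ^ 2 / reg ε f v ^ 2) := by ring
    _ ≤ 2 * C * (ε * (f v * wt v) / reg ε f v ^ 2) + 33800 * ε * 1 := by gcongr
    _ = _ := by ring

end DensityBounds

/-- The density of the error due to the regularisation; it is bounded and tends to zero with `ε`. -/
def errDensity (ε : ℝ) (f : Vel 2 → ℝ) (v : Vel 2) : ℝ :=
  Real.sqrt ε + ε * (f v * wt v) / reg ε f v ^ 2

/-- The error due to the regularisation. -/
def regErr (ε : ℝ) (f : Vel 2 → ℝ) : ℝ :=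
  ∫ p : Vel 2 × Vel 2, errDensity ε f p.1 * ((1 + ‖p.1 - p.2‖) * pairWt p)

namespace DensityBounds

variable {C ε : ℝ} {f : Vel 2 → ℝ} {f' : Vel 2 → Vel 2} {f'' : Vel 2 → Vel 2 →L[ℝ] Vel 2}

theorem errDensity_nonneg (h : DensityBounds C f f' f'') (hε : 0 < ε) (v : Vel 2) :
    0 ≤ errDensity ε f v := by
  have := h.nonneg v
  have := (wt_pos v).le
  unfold errDensity
  positivity

theorem errDensity_le (h : DensityBounds C f f' f'') (hε : 0 < ε) (hε1 : ε ≤ 1) (v : Vel 2) :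
    errDensity ε f v ≤ 2 := by
  unfold errDensity
  have h1 : Real.sqrt ε ≤ 1 := by
    rw [Real.sqrt_le_left zero_le_one]; simpa using hε1
  have h2 : ε * (f v * wt v) / reg ε f v ^ 2 ≤ 1 := by
    rw [div_le_one (pow_pos (h.reg_pos hε v) 2)]
    unfold reg
    have := mul_nonneg (mul_nonneg hε.le (h.nonneg v)) (wt_pos v).le
    nlinarith [sq_nonneg (f v), sq_nonneg (ε * wt v)]
  linarith

theorem mul_norm_score_add_sq_le (h : DensityBounds C f f' f'') (hε : 0 < ε) (hε1 : ε ≤ 1)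
    (v : Vel 2) :
    ε * (‖score ε f f' v‖ + ‖score ε f f' v‖ ^ 2) ≤ 60000 * C * errDensity ε f v := by
  have h1 := h.mul_sq_norm_score_le hε v
  have hC := h.one_le
  set s := Real.sqrt ε with hs
  have hs2 : s ^ 2 = ε := Real.sq_sqrt hε.le
  have hs0 : 0 ≤ s := Real.sqrt_nonneg _
  have hs1 : s ≤ 1 := by
    rw [hs, Real.sqrt_le_left zero_le_one]; simpa using hε1
  have hse : ε ≤ s := by rw [← hs2]; nlinarith
  set x := ‖score ε f f' v‖
  have hx : 0 ≤ x := norm_nonneg _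
  have h2 : ε * x ≤ 2⁻¹ * s + 2⁻¹ * (ε * x ^ 2) := by
    have : s * (s * x) ^ 2 ≤ 1 * (s * x) ^ 2 := mul_le_mul_of_nonneg_right hs1 (sq_nonneg _)
    have h3 : 0 ≤ s * (1 - s * x) ^ 2 := by positivity
    rw [← hs2]
    nlinarith
  have hζ : 0 ≤ ε * (f v * wt v) / reg ε f v ^ 2 := by
    have := h.nonneg v
    have := (wt_pos v).le
    positivity
  unfold errDensity
  rw [← hs]
  nlinarith [mul_le_mul_of_nonneg_right hC hs0, mul_le_mul_of_nonneg_right hC hζ]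

theorem pairBounds (h : DensityBounds C f f' f'') :
    PairBounds (C ^ 2) (tens f) (fun p => f p.2 • f' p.1) (fun p => f p.1 • f' p.2) := by
  have hC : 0 ≤ C := zero_le_one.trans h.one_le
  have hww : ∀ p : Vel 2 × Vel 2, (C * wt p.1) * (C * wt p.2) ≤ C ^ 2 * pairWt p := fun p => by
    calc _ = C ^ 2 * (wt p.1 * wt p.2) := by ring
      _ ≤ _ := by gcongr; exact wt_mul_wt_le p.1 p.2
  refine ⟨hasPairGrad_tens h.grad, ?_, ?_, fun p => ?_, fun p => ?_, fun p => ?_⟩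
  · exact (h.continuous.comp continuous_snd).smul (h.continuous_grad.comp continuous_fst)
  · exact (h.continuous.comp continuous_fst).smul (h.continuous_grad.comp continuous_snd)
  · rw [tens, abs_of_nonneg (mul_nonneg (h.nonneg _) (h.nonneg _))]
    refine le_trans ?_ (hww p)
    have := wt_pos p.1
    gcongr
    · exact h.nonneg _
    · exact h.le _
    · exact h.le _
  · rw [norm_smul, Real.norm_of_nonneg (h.nonneg _), mul_comm]
    refine le_trans ?_ (hww p)
    have := wt_pos p.1
    gcongr
    · exact h.nonneg _
    · exact h.norm_grad_le _
    · exact h.le _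
  · rw [norm_smul, Real.norm_of_nonneg (h.nonneg _)]
    refine le_trans ?_ (hww p)
    have := wt_pos p.1
    gcongr
    · exact h.le _
    · exact h.norm_grad_le _

theorem pairBounds_reg_sub (h : DensityBounds C f f' f'') (hε : 0 < ε) (hε1 : ε ≤ 1) :
    PairBounds (261 * C * ε) (fun p => tens (reg ε f) p - tens f p)
      (fun p => reg ε f p.2 • regGrad ε f' p.1 - f p.2 • f' p.1)
      (fun p => reg ε f p.1 • regGrad ε f' p.2 - f p.1 • f' p.2) := by
  have hC := h.one_le
  have hvec : ∀ v w : Vel 2, ‖reg ε f w • regGrad ε f' v - f w • f' v‖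
      ≤ 261 * C * ε * (wt v * wt w) := by
    intro v w
    have e : reg ε f w • regGrad ε f' v - f w • f' v
        = (ε * wt w) • f' v + (ε * reg ε f w) • wtGrad v := by
      simp only [reg, regGrad]; module
    have hv := wt_pos v
    have hw := wt_pos w
    have hr := h.reg_pos hε w
    rw [e]
    refine (norm_add_le _ _).trans ?_
    rw [norm_smul, norm_smul, Real.norm_of_nonneg (by positivity),
      Real.norm_of_nonneg (by positivity)]
    calc ε * wt w * ‖f' v‖ + ε * reg ε f w * ‖wtGrad v‖
        ≤ ε * wt w * (C * wt v) + ε * (2 * C * wt w) * (130 * wt v) := by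
          gcongr
          · exact h.norm_grad_le v
          · exact h.reg_le hε1 w
          · exact norm_wtGrad_le v
      _ = _ := by ring
  have hA : 0 ≤ 261 * C * ε := by positivity
  refine ⟨(hasPairGrad_tens h.hasGradientAt_reg).sub (hasPairGrad_tens h.grad), ?_, ?_,
    fun p => ?_, fun p => ?_, fun p => ?_⟩
  · exact ((h.continuous_reg.comp continuous_snd).smul (h.continuous_regGrad.comp continuous_fst)
      ).sub ((h.continuous.comp continuous_snd).smul (h.continuous_grad.comp continuous_fst))
  · exact ((h.continuous_reg.comp continuous_fst).smul (h.continuous_regGrad.comp continuous_snd)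
      ).sub ((h.continuous.comp continuous_fst).smul (h.continuous_grad.comp continuous_snd))
  · have e : tens (reg ε f) p - tens f p
        = ε * (f p.1 * wt p.2) + ε * (wt p.1 * reg ε f p.2) := by
      simp only [reg, tens]; ring
    have h1 := wt_pos p.1
    have h2 := wt_pos p.2
    have h3 := h.nonneg p.1
    have h4 := h.reg_pos hε p.2
    rw [e, abs_of_nonneg (by positivity)]
    calc ε * (f p.1 * wt p.2) + ε * (wt p.1 * reg ε f p.2)
        ≤ ε * (C * wt p.1 * wt p.2) + ε * (wt p.1 * (2 * C * wt p.2)) := by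
          gcongr
          · exact h.le _
          · exact h.reg_le hε1 _
      _ = 3 * C * ε * (wt p.1 * wt p.2) := by ring
      _ ≤ 261 * C * ε * pairWt p := by
          gcongr
          · norm_num
          · exact wt_mul_wt_le p.1 p.2
  · exact (hvec p.1 p.2).trans (mul_le_mul_of_nonneg_left (wt_mul_wt_le p.1 p.2) hA)
  · rw [show pairWt p = pairWt (p.1, p.2) from rfl]
    refine (hvec p.2 p.1).trans ?_
    rw [mul_comm (wt p.2)]
    exact mul_le_mul_of_nonneg_left (wt_mul_wt_le p.1 p.2) hA

theorem reg_smul_score (h : DensityBounds C f f' f'') (hε : 0 < ε) (v : Vel 2) :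
    reg ε f v • score ε f f' v = regGrad ε f' v := by
  unfold score
  rw [smul_smul, mul_inv_cancel₀ (h.reg_pos hε v).ne', one_smul]

theorem symPair (h : DensityBounds C f f' f'') (hε : 0 < ε) (hε1 : ε ≤ 1) :
    SymPair (C ^ 2 + 261 * C * ε) (131 * C / ε) (score ε f f') (tens (reg ε f)) := by
  have e1 : (fun p : Vel 2 × Vel 2 => tens (reg ε f) p • score ε f f' p.1)
      = fun p => reg ε f p.2 • regGrad ε f' p.1 := by
    funext p
    rw [tens, mul_comm, mul_smul, h.reg_smul_score hε]
  have e2 : (fun p : Vel 2 × Vel 2 => tens (reg ε f) p • score ε f f' p.2)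
      = fun p => reg ε f p.1 • regGrad ε f' p.2 := by
    funext p
    rw [tens, mul_smul, h.reg_smul_score hε]
  have hF := h.pairBounds
  have hE := h.pairBounds_reg_sub hε hε1
  refine ⟨?_, fun p => ?_, fun p => mul_pos (h.reg_pos hε _) (h.reg_pos hε _),
    h.continuous_score hε, h.norm_score_le hε hε1⟩
  · rw [e1, e2]
    refine ⟨hasPairGrad_tens h.hasGradientAt_reg, ?_, ?_, fun p => ?_, fun p => ?_, fun p => ?_⟩
    · exact (h.continuous_reg.comp continuous_snd).smul (h.continuous_regGrad.comp continuous_fst)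
    · exact (h.continuous_reg.comp continuous_fst).smul (h.continuous_regGrad.comp continuous_snd)
    · have := abs_add_le (tens f p) (tens (reg ε f) p - tens f p)
      rw [add_sub_cancel] at this
      rw [add_mul]
      exact this.trans (add_le_add (hF.abs_le p) (hE.abs_le p))
    · have := norm_add_le (f p.2 • f' p.1) (reg ε f p.2 • regGrad ε f' p.1 - f p.2 • f' p.1)
      rw [add_sub_cancel] at this
      rw [add_mul]
      exact this.trans (add_le_add (hF.norm1_le p) (hE.norm1_le p))
    · have := norm_add_le (f p.1 • f' p.2) (reg ε f p.1 • regGrad ε f' p.2 - f p.1 • f' p.2)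
      rw [add_sub_cancel] at this
      rw [add_mul]
      exact this.trans (add_le_add (hF.norm2_le p) (hE.norm2_le p))
  · simp only [tens, Prod.fst_swap, Prod.snd_swap, mul_comm]

end DensityBounds

/-! ### The collision operator against the derivative of the Fisher information -/

/-- The collision integral in terms of the angle of the collision. -/
theorem collision_hsKernel_eq {f : Vel 2 → ℝ} (hf : Continuous f) (v : Vel 2) :
    collision hsKernel f v = ∫ w, ∫ a in (-Real.pi)..Real.pi,
      hsAngular (Real.cos a) * (‖v - w‖ * jump (tens f) (a, (v, w))) := by
  unfold collision
  congr 1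
  funext w
  rcases eq_or_ne v w with rfl | hne
  · simp [hsKernel]
  have hr : v - w ≠ 0 := sub_ne_zero.mpr hne
  set k : Sph 2 := ⟨‖v - w‖⁻¹ • (v - w), normalize_mem hr⟩ with hk
  have hc : Continuous fun σ : Sph 2 =>
      (f (postV v w σ) * f (postW v w σ) - f v * f w) * hsKernel (v - w) σ := by
    have h1 : Continuous fun σ : Sph 2 => postV v w σ := by unfold postV; fun_prop
    have h2 : Continuous fun σ : Sph 2 => postW v w σ := by unfold postW; fun_prop
    have h3 : Continuous fun σ : Sph 2 => hsKernel (v - w) σ := by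
      unfold hsKernel
      exact continuous_const.mul (continuous_hsAngular.comp (by fun_prop))
    exact (((hf.comp h1).mul (hf.comp h2)).sub continuous_const).mul h3
  rw [integral_surf_two hc k]
  refine intervalIntegral.integral_congr fun a _ => ?_
  have hkz : (‖v - w‖ / 2) • (rot a k : Vel 2) = (2⁻¹ : ℝ) • planeRot a (v - w) := by
    rw [coe_rot, hk]
    simp only [map_smul, smul_smul]
    congr 1
    have := norm_ne_zero_iff.mpr hr
    field_simp
  have h1 : postV v w (rot a k) = (coll a (v, w)).1 := by rw [postV, hkz, coll_fst]
  have h2 : postW v w (rot a k) = (coll a (v, w)).2 := by rw [postW, hkz, coll_snd]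
  have h3 : hsKernel (v - w) (rot a k) = ‖v - w‖ * hsAngular (Real.cos a) := by
    rw [hsKernel, ← inner_rot a k]
  simp only [h1, h2, h3, jump, tens]
  ring

theorem PairBounds.tame_dist_mul_jump {A : ℝ} {H : Vel 2 × Vel 2 → ℝ}
    {H1 H2 : Vel 2 × Vel 2 → Vel 2} (h : PairBounds A H H1 H2) :
    Tame fun q => ‖q.2.1 - q.2.2‖ * jump H q := by
  have ht := h.tame_dist_mul_coll.add (h.tame_dist_mul.const_mul (-1))
  refine ⟨?_, ?_⟩
  · convert ht.meas using 2 with q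
    simp only [jump]; ring
  · convert ht.bound using 5 with M q
    simp only [jump]; ring

namespace DensityBounds

variable {C ε : ℝ} {f : Vel 2 → ℝ} {f' : Vel 2 → Vel 2} {f'' : Vel 2 → Vel 2 →L[ℝ] Vel 2}

theorem abs_collision_le (h : DensityBounds C f f' f'') (v : Vel 2) :
    |collision hsKernel f v| ≤ (8 * Real.pi * C ^ 2 * ∫ w, intWt w) * intWt v := by
  have hpi := Real.pi_pos
  rw [collision_hsKernel_eq h.continuous]
  have hb : ∀ w, ‖∫ a in (-Real.pi)..Real.pi,
      hsAngular (Real.cos a) * (‖v - w‖ * jump (tens f) (a, (v, w)))‖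
      ≤ 8 * Real.pi * C ^ 2 * intWt v * intWt w := by
    intro w
    have h1 : ∀ a ∈ Set.uIoc (-Real.pi) Real.pi,
        ‖hsAngular (Real.cos a) * (‖v - w‖ * jump (tens f) (a, (v, w)))‖
        ≤ 4 * C ^ 2 * (intWt v * intWt w) := by
      intro a _
      obtain ⟨h0, h1⟩ := hsAngular_cos_mem a
      have h2 := h.pairBounds.abs_jump_le (a, (v, w))
      have h3 := one_add_dist_mul_pairWt_le (v, w)
      have h4 := (pairWt_pos (v, w)).le
      simp only at h2 h3
      rw [norm_mul, norm_mul, norm_norm, Real.norm_of_nonneg h0, Real.norm_eq_abs]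
      calc hsAngular (Real.cos a) * (‖v - w‖ * |jump (tens f) (a, (v, w))|)
          ≤ 1 * ((1 + ‖v - w‖) * (2 * C ^ 2 * pairWt (v, w))) := by
            gcongr
            linarith
        _ = 2 * C ^ 2 * ((1 + ‖v - w‖) * pairWt (v, w)) := by ring
        _ ≤ 2 * C ^ 2 * (2 * (intWt v * intWt w)) := by gcongr
        _ = _ := by ring
    have h2 := intervalIntegral.norm_integral_le_of_norm_le_const h1
    rw [show Real.pi - -Real.pi = 2 * Real.pi by ring, abs_of_pos (by positivity)] at h2
    calc _ ≤ _ := h2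
      _ = _ := by ring
  have h3 := norm_integral_le_of_norm_le
    (integrable_intWt.const_mul (8 * Real.pi * C ^ 2 * intWt v))
    (Filter.Eventually.of_forall hb)
  rw [integral_const_mul, Real.norm_eq_abs] at h3
  calc _ ≤ _ := h3
    _ = _ := by ring

theorem continuous_fisherDeriv (h : DensityBounds C f f' f'') (hε : 0 < ε) :
    Continuous (fisherDeriv (score ε f f') (scoreDeriv ε f f' f'')) := by
  unfold fisherDeriv
  have := continuous_planeTrace.comp (h.continuous_scoreDeriv hε)
  exact ((this.const_mul 2).neg).sub ((h.continuous_score hε).norm.pow 2)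

/-- A bound for the functional derivative of the Fisher information which depends on `ε`. -/
theorem abs_fisherDeriv_le (h : DensityBounds C f f' f'') (hε : 0 < ε) (hε1 : ε ≤ 1) (v : Vel 2) :
    |fisherDeriv (score ε f f') (scoreDeriv ε f f' f'') v| ≤
      4 * (131 * C / ε + (131 * C / ε) ^ 2) + (131 * C / ε) ^ 2 := by
  unfold fisherDeriv
  have h1 := abs_planeTrace_le (scoreDeriv ε f f' f'' v)
  have h2 : ‖score ε f f' v‖ ^ 2 ≤ (131 * C / ε) ^ 2 := by
    gcongr; exact h.norm_score_le hε hε1 v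
  refine (abs_sub _ _).trans ?_
  rw [abs_neg, abs_mul, abs_two, abs_of_nonneg (sq_nonneg ‖score ε f f' v‖)]
  linarith [h.norm_scoreDeriv_le hε hε1 v]

/-- The weak form of the dissipation. -/
theorem integral_fisherDeriv_mul_collision (h : DensityBounds C f f' f'') (hε : 0 < ε)
    (hε1 : ε ≤ 1) :
    ∫ v, fisherDeriv (score ε f f') (scoreDeriv ε f f' f'') v * collision hsKernel f v =
      ∫ a in (-Real.pi)..Real.pi, hsAngular (Real.cos a) *
        ∫ p, fisherFlux (score ε f f') (tens f) (fun p => f p.2 • f' p.1)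
          (fun p => f p.1 • f' p.2) (a, p) := by
  have hpi := Real.pi_pos
  set Φ := fisherDeriv (score ε f f') (scoreDeriv ε f f' f'') with hΦ
  have ht : Tame fun q => hsAngular (Real.cos q.1) *
      (Φ q.2.1 * (‖q.2.1 - q.2.2‖ * jump (tens f) q)) :=
    (h.pairBounds.tame_dist_mul_jump.bdd_mul (φ := fun q => Φ q.2.1)
      ((h.continuous_fisherDeriv hε).comp (by fun_prop)).measurable
      fun q => h.abs_fisherDeriv_le hε hε1 q.2.1).angular_mul
  have hint := ht.integrable ((volume : Measure ℝ).restrict (Ioc (-Real.pi) Real.pi))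
  have hint2 : Integrable (fun p : Vel 2 × Vel 2 => ∫ a in Ioc (-Real.pi) Real.pi,
      hsAngular (Real.cos a) * (Φ p.1 * (‖p.1 - p.2‖ * jump (tens f) (a, p))))
      ((volume : Measure (Vel 2)).prod volume) := hint.integral_prod_right
  calc ∫ v, Φ v * collision hsKernel f v
      = ∫ v, ∫ w, ∫ a in Ioc (-Real.pi) Real.pi, hsAngular (Real.cos a) *
          (Φ v * (‖v - w‖ * jump (tens f) (a, (v, w)))) := by
        congr 1
        funext v
        rw [collision_hsKernel_eq h.continuous, ← integral_const_mul]
        congr 1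
        funext w
        rw [intervalIntegral.integral_of_le (by linarith), ← integral_const_mul]
        congr 1
        funext a
        ring
    _ = ∫ p : Vel 2 × Vel 2, ∫ a in Ioc (-Real.pi) Real.pi, hsAngular (Real.cos a) *
          (Φ p.1 * (‖p.1 - p.2‖ * jump (tens f) (a, p))) := (integral_prod _ hint2).symm
    _ = ∫ a in Ioc (-Real.pi) Real.pi, ∫ p : Vel 2 × Vel 2, hsAngular (Real.cos a) *
          (Φ p.1 * (‖p.1 - p.2‖ * jump (tens f) (a, p))) :=
        (integral_integral_swap (f := fun a p => hsAngular (Real.cos a) *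
          (Φ p.1 * (‖p.1 - p.2‖ * jump (tens f) (a, p)))) hint).symm
    _ = _ := by
        rw [intervalIntegral.integral_of_le (by linarith)]
        congr 1
        funext a
        rw [integral_const_mul, hΦ, h.pairBounds.integral_fisherDeriv_mul (h.hasFDerivAt_score hε)
          (h.continuous_scoreDeriv hε) (h.norm_score_le' hε hε1) (h.norm_scoreDeriv_le hε hε1)]

theorem integrable_regErr (h : DensityBounds C f f' f'') (hε : 0 < ε) (hε1 : ε ≤ 1) :
    Integrable fun p : Vel 2 × Vel 2 => errDensity ε f p.1 * ((1 + ‖p.1 - p.2‖) * pairWt p) := by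
  refine integrable_one_add_dist_mul_pairWt.bdd_mul (c := 2) ?_
    (Filter.Eventually.of_forall fun p => ?_)
  · have hc : Continuous (errDensity ε f) := by
      unfold errDensity
      exact continuous_const.add (((h.continuous.mul continuous_wt).const_mul ε).div
        (h.continuous_reg.pow 2) fun v => pow_ne_zero 2 (h.reg_pos hε v).ne')
    exact (hc.comp continuous_fst).aestronglyMeasurable
  · rw [Real.norm_of_nonneg (h.errDensity_nonneg hε _)]
    exact h.errDensity_le hε hε1 _

theorem regErr_nonneg (h : DensityBounds C f f' f'') (hε : 0 < ε) : 0 ≤ regErr ε f :=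
  integral_nonneg fun p => mul_nonneg (h.errDensity_nonneg hε _) (one_add_dist_mul_pairWt_nonneg p)

theorem regErr_le (h : DensityBounds C f f' f'') (hε : 0 < ε) (hε1 : ε ≤ 1) :
    regErr ε f ≤ 2 * ∫ p : Vel 2 × Vel 2, (1 + ‖p.1 - p.2‖) * pairWt p := by
  rw [← integral_const_mul]
  exact integral_mono (h.integrable_regErr hε hε1) (integrable_one_add_dist_mul_pairWt.const_mul 2)
    fun p => mul_le_mul_of_nonneg_right (h.errDensity_le hε hε1 _)
      (one_add_dist_mul_pairWt_nonneg p)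

/-- Up to the error due to the regularisation, the Fisher information is dissipated. -/
theorem integral_fisherDeriv_mul_collision_le (h : DensityBounds C f f' f'') (hε : 0 < ε)
    (hε1 : ε ≤ 1) :
    ∫ v, fisherDeriv (score ε f f') (scoreDeriv ε f f' f'') v * collision hsKernel f v ≤
      2 * Real.pi * (6 * (261 * C) * (60000 * C)) * regErr ε f := by
  have hpi := Real.pi_pos
  have hC := h.one_le
  rw [h.integral_fisherDeriv_mul_collision hε hε1]
  set X := score ε f f' with hX
  have hE := h.pairBounds_reg_sub hε hε1
  have hS := h.symPair hε hε1
  have hXc := h.continuous_score hε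
  have hXM := h.norm_score_le hε hε1
  have tG := (hS.bounds.tame_fisherFlux hXc hXM)
  have tE := (hE.tame_fisherFlux hXc hXM)
  have e1 : (fun p : Vel 2 × Vel 2 => tens (reg ε f) p • X p.1)
      = fun p => reg ε f p.2 • regGrad ε f' p.1 := by
    funext p
    rw [tens, mul_comm, mul_smul, h.reg_smul_score hε]
  have e2 : (fun p : Vel 2 × Vel 2 => tens (reg ε f) p • X p.2)
      = fun p => reg ε f p.1 • regGrad ε f' p.2 := by
    funext p
    rw [tens, mul_smul, h.reg_smul_score hε]
  have hG := hS.integral_angular_fisherFlux_nonpos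
  set TG : ℝ × (Vel 2 × Vel 2) → ℝ := fisherFlux X (tens (reg ε f))
    (fun p => tens (reg ε f) p • X p.1) (fun p => tens (reg ε f) p • X p.2) with hTG
  set TE : ℝ × (Vel 2 × Vel 2) → ℝ := fisherFlux X (fun p => tens (reg ε f) p - tens f p)
      (fun p => reg ε f p.2 • regGrad ε f' p.1 - f p.2 • f' p.1)
      (fun p => reg ε f p.1 • regGrad ε f' p.2 - f p.1 • f' p.2) with hTE
  have hsplit : ∀ q, fisherFlux X (tens f) (fun p => f p.2 • f' p.1) (fun p => f p.1 • f' p.2) q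
      = TG q - TE q := fun q => by
    rw [hTG, hTE, fisherFlux_sub, e1, e2]; ring
  have hEb : ∀ a, |∫ p, TE (a, p)| ≤ 6 * (261 * C) * (60000 * C) * regErr ε f := by
    intro a
    have h1 := norm_integral_le_of_norm_le
      ((h.integrable_regErr hε hε1).const_mul (6 * (261 * C) * (60000 * C)))
      (f := fun p => TE (a, p)) (Filter.Eventually.of_forall fun p => ?_)
    · rw [integral_const_mul] at h1
      exact h1
    · refine (hE.abs_fisherFlux_le X (a, p)).trans ?_
      have h2 := h.mul_norm_score_add_sq_le hε hε1 p.1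
      have h3 := one_add_dist_mul_pairWt_nonneg p
      calc 6 * (261 * C * ε) * (‖X p.1‖ + ‖X p.1‖ ^ 2) * ((1 + ‖p.1 - p.2‖) * pairWt p)
          = 6 * (261 * C) * (ε * (‖X p.1‖ + ‖X p.1‖ ^ 2)) * ((1 + ‖p.1 - p.2‖) * pairWt p) := by ring
        _ ≤ 6 * (261 * C) * (60000 * C * errDensity ε f p.1) *
            ((1 + ‖p.1 - p.2‖) * pairWt p) := by gcongr
        _ = _ := by ring
  have hEint : |∫ a in (-Real.pi)..Real.pi, hsAngular (Real.cos a) * ∫ p, TE (a, p)|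
      ≤ 6 * (261 * C) * (60000 * C) * regErr ε f * (2 * Real.pi) := by
    have h1 := intervalIntegral.norm_integral_le_of_norm_le_const
      (f := fun a => hsAngular (Real.cos a) * ∫ p, TE (a, p)) (a := -Real.pi) (b := Real.pi)
      (C := 6 * (261 * C) * (60000 * C) * regErr ε f) fun a _ => ?_
    · rwa [show Real.pi - -Real.pi = 2 * Real.pi by ring,
        abs_of_pos (by positivity : 0 < 2 * Real.pi)] at h1
    · obtain ⟨h2, h3⟩ := hsAngular_cos_mem a
      rw [norm_mul, Real.norm_of_nonneg h2]
      calc _ ≤ 1 * ‖∫ p, TE (a, p)‖ := mul_le_mul_of_nonneg_right h3 (norm_nonneg _)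
        _ ≤ _ := by rw [one_mul]; exact hEb a
  have hdiff : ∀ a, hsAngular (Real.cos a) * ∫ p, fisherFlux X (tens f) (fun p => f p.2 • f' p.1)
        (fun p => f p.1 • f' p.2) (a, p)
      = hsAngular (Real.cos a) * (∫ p, TG (a, p)) - hsAngular (Real.cos a) * ∫ p, TE (a, p) := by
    intro a
    simp only [hsplit]
    rw [integral_sub (tG.integrable_right a) (tE.integrable_right a)]
    ring
  simp only [hdiff]
  rw [intervalIntegral.integral_sub (tG.angular_intervalIntegrable _ _)
    (tE.angular_intervalIntegrable _ _)]
  have := (abs_le.mp hEint).1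
  linarith

end DensityBounds

/-! ### The Fisher information of regularised densities -/

/-- The Fisher information of the regularised density; for `ε = 0` it is that of `f`. -/
def regFisher (ε : ℝ) (f : Vel 2 → ℝ) (f' : Vel 2 → Vel 2) : ℝ :=
  ∫ v, ‖regGrad ε f' v‖ ^ 2 / reg ε f v

namespace DensityBounds

variable {C ε : ℝ} {f : Vel 2 → ℝ} {f' : Vel 2 → Vel 2} {f'' : Vel 2 → Vel 2 →L[ℝ] Vel 2}

theorem reg_nonneg (h : DensityBounds C f f' f'') (hε : 0 ≤ ε) (v : Vel 2) : 0 ≤ reg ε f v :=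
  add_nonneg (h.nonneg v) (mul_nonneg hε (wt_pos v).le)

theorem sq_norm_regGrad_div_le (h : DensityBounds C f f' f'') (hε : 0 ≤ ε) (hε1 : ε ≤ 1)
    (v : Vel 2) : ‖regGrad ε f' v‖ ^ 2 / reg ε f v ≤ (2 * C + 33800) * wt v := by
  have hw := wt_pos v
  have hC := h.one_le
  rcases (h.reg_nonneg hε v).eq_or_lt with h0 | h0
  · rw [← h0, div_zero]; positivity
  rw [div_le_iff₀ h0]
  refine (h.sq_norm_regGrad_le hε v).trans ?_
  have h1 : (ε * wt v) ^ 2 ≤ wt v * reg ε f v := by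
    have : ε * wt v ≤ 1 * wt v := mul_le_mul_of_nonneg_right hε1 hw.le
    rw [one_mul] at this
    rw [sq]
    exact mul_le_mul this (h.le_reg v) (by positivity) hw.le
  have h2 : f v ≤ reg ε f v := le_add_of_nonneg_right (by positivity)
  have h3 : f v * wt v ≤ wt v * reg ε f v := by
    rw [mul_comm]; gcongr
  have h4 : C * (f v * wt v) ≤ C * (wt v * reg ε f v) := by gcongr
  nlinarith

theorem sq_norm_regGrad_div_nonneg (h : DensityBounds C f f' f'') (hε : 0 ≤ ε) (v : Vel 2) :
    0 ≤ ‖regGrad ε f' v‖ ^ 2 / reg ε f v :=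
  div_nonneg (sq_nonneg _) (h.reg_nonneg hε v)

theorem aestronglyMeasurable_sq_norm_regGrad_div (h : DensityBounds C f f' f'') :
    AEStronglyMeasurable (fun v => ‖regGrad ε f' v‖ ^ 2 / reg ε f v) volume :=
  (((h.continuous_regGrad (ε := ε)).norm.pow 2).measurable.div
    (h.continuous_reg (ε := ε)).measurable).aestronglyMeasurable

theorem integrable_regFisher (h : DensityBounds C f f' f'') (hε : 0 ≤ ε) (hε1 : ε ≤ 1) :
    Integrable fun v => ‖regGrad ε f' v‖ ^ 2 / reg ε f v :=
  (integrable_wt.const_mul (2 * C + 33800)).mono' h.aestronglyMeasurable_sq_norm_regGrad_div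
    (Filter.Eventually.of_forall fun v => by
      rw [Real.norm_of_nonneg (h.sq_norm_regGrad_div_nonneg hε v)]
      exact h.sq_norm_regGrad_div_le hε hε1 v)

theorem integrable (h : DensityBounds C f f' f'') : Integrable f :=
  (integrable_wt.const_mul C).mono' h.continuous.aestronglyMeasurable
    (Filter.Eventually.of_forall fun v => by
      rw [Real.norm_of_nonneg (h.nonneg v)]; exact h.le v)

theorem integrable_grad (h : DensityBounds C f f' f'') : Integrable f' :=
  (integrable_wt.const_mul C).mono' h.continuous_grad.aestronglyMeasurable
    (Filter.Eventually.of_forall h.norm_grad_le)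

/-- Convexity of the Fisher information: its graph is above its tangent at `f`, whose slope is
given by `fisherDeriv`. -/
theorem regFisher_sub_le (h : DensityBounds C f f' f'') {g : Vel 2 → ℝ} {g' : Vel 2 → Vel 2}
    {g'' : Vel 2 → Vel 2 →L[ℝ] Vel 2} (k : DensityBounds C g g' g'') (hε : 0 < ε) (hε1 : ε ≤ 1) :
    regFisher ε f f' - regFisher ε g g' ≤
      ∫ v, fisherDeriv (score ε f f') (scoreDeriv ε f f' f'') v * (f v - g v) := by
  set X := score ε f f' with hX
  have hXc : Continuous X := h.continuous_score hε
  have hd : Integrable fun v => f v - g v := h.integrable.sub k.integrable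
  have hd' : Integrable fun v => f' v - g' v := h.integrable_grad.sub k.integrable_grad
  have hgrad : ∀ v, HasGradientAt (fun v => f v - g v) (f' v - g' v) v := fun v => by
    rw [hasGradientAt_iff_hasFDerivAt, map_sub]
    exact (h.grad v).hasFDerivAt.fun_sub (k.grad v).hasFDerivAt
  have key := integral_inner_grad (h.hasFDerivAt_score hε) (h.continuous_scoreDeriv hε)
    (h.norm_score_le' hε hε1) (h.norm_scoreDeriv_le hε hε1) hgrad hd hd'
  have hia : Integrable fun v => planeTrace (scoreDeriv ε f f' f'' v) * (f v - g v) :=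
    hd.bdd_mul (c := 2 * (131 * C / ε + (131 * C / ε) ^ 2))
      (continuous_planeTrace.comp (h.continuous_scoreDeriv hε)).aestronglyMeasurable
      (Filter.Eventually.of_forall fun v => by
        rw [Real.norm_eq_abs]
        exact (abs_planeTrace_le _).trans (by linarith [h.norm_scoreDeriv_le hε hε1 v]))
  have hib : Integrable fun v => ‖X v‖ ^ 2 * (f v - g v) :=
    hd.bdd_mul (c := (131 * C / ε) ^ 2) (hXc.norm.pow 2).aestronglyMeasurable
      (Filter.Eventually.of_forall fun v => by
        rw [Real.norm_of_nonneg (by positivity)]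
        gcongr
        exact h.norm_score_le hε hε1 v)
  have hic : Integrable fun v => inner ℝ (X v) (f' v - g' v) :=
    (hd'.norm.const_mul (131 * C / ε)).mono'
      (hXc.aestronglyMeasurable.inner hd'.aestronglyMeasurable)
      (Filter.Eventually.of_forall fun v => (norm_inner_le_norm _ _).trans
        (mul_le_mul_of_nonneg_right (h.norm_score_le hε hε1 v) (norm_nonneg _)))
  have hpt : ∀ v, ‖regGrad ε f' v‖ ^ 2 / reg ε f v - ‖regGrad ε g' v‖ ^ 2 / reg ε g v ≤
      2 * inner ℝ (X v) (f' v - g' v) - ‖X v‖ ^ 2 * (f v - g v) := by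
    intro v
    have hf := h.reg_pos hε v
    have hg := k.reg_pos hε v
    have e1 : regGrad ε f' v = reg ε f v • X v := (h.reg_smul_score hε v).symm
    have e2 : f' v - g' v = regGrad ε f' v - regGrad ε g' v := by simp [regGrad]
    have e3 : f v - g v = reg ε f v - reg ε g v := by simp [reg]
    have e4 : ‖regGrad ε f' v‖ ^ 2 / reg ε f v = reg ε f v * ‖X v‖ ^ 2 := by
      rw [e1, norm_smul, Real.norm_of_nonneg hf.le]; field_simp
    have e5 : 2 * inner ℝ (X v) (regGrad ε g' v) - ‖X v‖ ^ 2 * reg ε g v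
        ≤ ‖regGrad ε g' v‖ ^ 2 / reg ε g v := by
      rw [le_div_iff₀ hg]
      have := sq_nonneg ‖regGrad ε g' v - reg ε g v • X v‖
      rw [norm_sub_sq_real, norm_smul, Real.norm_of_nonneg hg.le, real_inner_smul_right,
        real_inner_comm] at this
      nlinarith
    rw [e2, e3, e4, inner_sub_right]
    have e6 : inner ℝ (X v) (regGrad ε f' v) = reg ε f v * ‖X v‖ ^ 2 := by
      rw [e1, real_inner_smul_right, real_inner_self_eq_norm_sq]
    rw [e6]
    linarith
  have hF := h.integrable_regFisher hε.le hε1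
  have hG := k.integrable_regFisher hε.le hε1
  calc regFisher ε f f' - regFisher ε g g'
      = ∫ v, (‖regGrad ε f' v‖ ^ 2 / reg ε f v - ‖regGrad ε g' v‖ ^ 2 / reg ε g v) :=
        (integral_sub hF hG).symm
    _ ≤ ∫ v, (2 * inner ℝ (X v) (f' v - g' v) - ‖X v‖ ^ 2 * (f v - g v)) :=
        integral_mono (hF.sub hG) ((hic.const_mul 2).sub hib) hpt
    _ = _ := by
        have hia' : Integrable fun v => 2 * -(planeTrace (scoreDeriv ε f f' f'' v) * (f v - g v)) :=
          hia.neg.const_mul 2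
        rw [integral_sub (hic.const_mul 2) hib, integral_const_mul, key, ← integral_neg,
          ← integral_const_mul, ← integral_sub hia' hib]
        refine integral_congr_ae (Filter.Eventually.of_forall fun v => ?_)
        simp only [fisherDeriv]
        ring

/-- As the regularisation is removed, the Fisher information converges to that of the density. -/
theorem tendsto_regFisher (h : DensityBounds C f f' f'') :
    Filter.Tendsto (fun ε => regFisher ε f f') (nhdsWithin 0 (Ioi 0)) (nhds (regFisher 0 f f')) := by
  have hev : ∀ᶠ ε : ℝ in nhdsWithin 0 (Ioi 0), 0 < ε ∧ ε ≤ 1 :=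
    Ioc_mem_nhdsGT one_pos
  refine tendsto_integral_filter_of_dominated_convergence (fun v => (2 * C + 33800) * wt v)
    (Filter.Eventually.of_forall fun ε => h.aestronglyMeasurable_sq_norm_regGrad_div) ?_
    (integrable_wt.const_mul _) (Filter.Eventually.of_forall fun v => ?_)
  · filter_upwards [hev] with ε hε
    refine Filter.Eventually.of_forall fun v => ?_
    rw [Real.norm_of_nonneg (h.sq_norm_regGrad_div_nonneg hε.1.le v)]
    exact h.sq_norm_regGrad_div_le hε.1.le hε.2 v
  · have hw := wt_pos v
    rcases (h.nonneg v).eq_or_lt with h0 | h0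
    · -- where the density vanishes, so does its gradient
      have hg0 : f' v = 0 := by
        have := h.sq_grad_le v
        rw [← h0, zero_mul, mul_zero] at this
        exact norm_eq_zero.mp (pow_eq_zero_iff two_ne_zero |>.mp (le_antisymm this (sq_nonneg _)))
      have hlim : Filter.Tendsto (fun ε : ℝ => ε * (‖wtGrad v‖ ^ 2 / wt v))
          (nhdsWithin 0 (Ioi 0)) (nhds 0) := by
        have : Continuous fun ε : ℝ => ε * (‖wtGrad v‖ ^ 2 / wt v) := by fun_prop
        have h1 := (this.tendsto 0).mono_left (nhdsWithin_le_nhds (s := Ioi 0))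
        rwa [zero_mul] at h1
      have e0 : ‖regGrad 0 f' v‖ ^ 2 / reg 0 f v = 0 := by simp [regGrad, hg0]
      rw [e0]
      refine hlim.congr' ?_
      filter_upwards [hev] with ε hε
      simp only [regGrad, reg, hg0, ← h0, zero_add, norm_smul, Real.norm_of_nonneg hε.1.le]
      have := hε.1
      field_simp
    · have hc : ContinuousAt (fun ε : ℝ => ‖regGrad ε f' v‖ ^ 2 / reg ε f v) 0 := by
        unfold regGrad reg
        refine ContinuousAt.div (by fun_prop) (by fun_prop) ?_
        simpa using h0.ne'
      exact hc.tendsto.mono_left nhdsWithin_le_nhds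

/-- The error due to the regularisation tends to zero. -/
theorem tendsto_regErr (h : DensityBounds C f f' f'') :
    Filter.Tendsto (fun ε => regErr ε f) (nhdsWithin 0 (Ioi 0)) (nhds 0) := by
  have hev : ∀ᶠ ε : ℝ in nhdsWithin 0 (Ioi 0), 0 < ε ∧ ε ≤ 1 :=
    Ioc_mem_nhdsGT one_pos
  suffices Filter.Tendsto (fun ε => regErr ε f) (nhdsWithin 0 (Ioi 0))
      (nhds (∫ _ : Vel 2 × Vel 2, (0 : ℝ))) by simpa using this
  refine tendsto_integral_filter_of_dominated_convergence
    (fun p => 2 * ((1 + ‖p.1 - p.2‖) * pairWt p)) ?_ ?_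
    (integrable_one_add_dist_mul_pairWt.const_mul 2) (Filter.Eventually.of_forall fun p => ?_)
  · filter_upwards [hev] with ε hε
    exact (h.integrable_regErr hε.1 hε.2).aestronglyMeasurable
  · filter_upwards [hev] with ε hε
    refine Filter.Eventually.of_forall fun p => ?_
    have hW := one_add_dist_mul_pairWt_nonneg p
    rw [Real.norm_of_nonneg (mul_nonneg (h.errDensity_nonneg hε.1 _) hW)]
    exact mul_le_mul_of_nonneg_right (h.errDensity_le hε.1 hε.2 _) hW
  · have hlim : Filter.Tendsto (fun ε => errDensity ε f p.1) (nhdsWithin 0 (Ioi 0)) (nhds 0) := by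
      have hs : Filter.Tendsto (fun ε : ℝ => Real.sqrt ε) (nhdsWithin 0 (Ioi 0)) (nhds 0) := by
        have := (Real.continuous_sqrt.tendsto 0).mono_left (nhdsWithin_le_nhds (s := Ioi 0))
        rwa [Real.sqrt_zero] at this
      rcases (h.nonneg p.1).eq_or_lt with h0 | h0
      · simpa only [errDensity, ← h0, zero_mul, mul_zero, zero_div, add_zero] using hs
      · have hc : ContinuousAt (fun ε : ℝ => ε * (f p.1 * wt p.1) / reg ε f p.1 ^ 2) 0 := by
          unfold reg
          refine ContinuousAt.div (by fun_prop) (by fun_prop) ?_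
          simpa using h0.ne'
        have h1 := hs.add (hc.tendsto.mono_left (nhdsWithin_le_nhds (s := Ioi 0)))
        simpa [errDensity] using h1
    simpa using hlim.mul_const ((1 + ‖p.1 - p.2‖) * pairWt p)

/-- The Fisher information with values in `[0, ∞]` is finite. -/
theorem fisherInfo_eq (h : DensityBounds C f f' f'') :
    fisherInfo f = ENNReal.ofReal (regFisher 0 f f') := by
  have e : ∀ v, ‖gradient f v‖ ^ 2 / f v = ‖regGrad 0 f' v‖ ^ 2 / reg 0 f v := fun v => by
    simp [regGrad, reg, (h.grad v).gradient]
  unfold fisherInfo regFisher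
  simp only [e]
  exact (ofReal_integral_eq_lintegral_ofReal (h.integrable_regFisher le_rfl zero_le_one)
    (Filter.Eventually.of_forall fun v => h.sq_norm_regGrad_div_nonneg le_rfl v)).symm

end DensityBounds

/-! ### Uniform bounds for solutions -/

theorem le_mul_wt_of_decay {x A B : ℝ} {v : Vel 2} (hx : 0 ≤ x) (h0 : x ≤ A)
    (h10 : ‖v‖ ^ 10 * x ≤ B) : x ≤ 16 * (A + B) * wt v := by
  unfold wt
  rw [← div_eq_mul_inv, le_div_iff₀ (by positivity)]
  have h1 : (1 + ‖v‖ ^ 2) ^ 5 ≤ 2 ^ (5 - 1) * (1 ^ 5 + (‖v‖ ^ 2) ^ 5) :=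
    _root_.add_pow_le zero_le_one (by positivity) 5
  calc x * (1 + ‖v‖ ^ 2) ^ 5 ≤ x * (2 ^ (5 - 1) * (1 ^ 5 + (‖v‖ ^ 2) ^ 5)) := by gcongr
    _ = 16 * (x + ‖v‖ ^ 10 * x) := by ring
    _ ≤ 16 * (A + B) := by gcongr

theorem wt_le_of_dist_le_one {v y : Vel 2} (h : ‖y - v‖ ≤ 1) : wt y ≤ 243 * wt v := by
  have h1 : ‖v‖ ≤ ‖y‖ + 1 := by
    have := norm_sub_norm_le v y
    rw [norm_sub_rev] at this
    linarith
  have h2 : 1 + ‖v‖ ^ 2 ≤ 3 * (1 + ‖y‖ ^ 2) := by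
    nlinarith [norm_nonneg v, norm_nonneg y, sq_nonneg (‖y‖ - 1), mul_self_nonneg (‖y‖ + 1 - ‖v‖)]
  have h3 : (1 + ‖v‖ ^ 2) ^ 5 ≤ (3 * (1 + ‖y‖ ^ 2)) ^ 5 := pow_le_pow_left₀ (by positivity) h2 5
  unfold wt
  rw [← div_eq_mul_inv, le_div_iff₀ (by positivity), inv_mul_le_iff₀ (by positivity)]
  calc _ ≤ _ := h3
    _ = _ := by ring

/-- The gradient of a nonnegative function with bounded Hessian is controlled by the square root of
the function: the minimum along the gradient line is nonnegative. -/
theorem sq_norm_grad_le {f : Vel 2 → ℝ} {f' : Vel 2 → Vel 2} {f'' : Vel 2 → Vel 2 →L[ℝ] Vel 2}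
    {v : Vel 2} {B : ℝ} (hB : 0 < B) (hf : ∀ y, HasGradientAt f (f' y) y)
    (hf' : ∀ y, HasFDerivAt f' (f'' y) y) (h0 : ∀ y, 0 ≤ f y)
    (hb : ∀ y, ‖y - v‖ ≤ 1 → ‖f'' y‖ ≤ B) (hg : ‖f' v‖ ≤ 2 * B) :
    ‖f' v‖ ^ 2 ≤ 4 * B * f v := by
  set h : Vel 2 := (-(2 * B)⁻¹) • f' v with hh
  have hn : ‖h‖ = (2 * B)⁻¹ * ‖f' v‖ := by
    rw [hh, norm_smul, norm_neg, norm_inv, Real.norm_of_nonneg (by positivity)]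
  have hn1 : ‖h‖ ≤ 1 := by
    rw [hn, inv_mul_le_iff₀ (by positivity), mul_one]; exact hg
  have hconv := convex_closedBall v ‖h‖
  have hv : v ∈ Metric.closedBall v ‖h‖ := Metric.mem_closedBall_self (norm_nonneg _)
  have hvh : v + h ∈ Metric.closedBall v ‖h‖ := by simp
  have hmem : ∀ y ∈ Metric.closedBall v ‖h‖, ‖y - v‖ ≤ ‖h‖ := fun y hy => by
    rwa [mem_closedBall_iff_norm] at hy
  have hlip : ∀ y ∈ Metric.closedBall v ‖h‖, ‖f' y - f' v‖ ≤ B * ‖h‖ := by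
    intro y hy
    have := hconv.norm_image_sub_le_of_norm_hasFDerivWithin_le
      (fun z _ => (hf' z).hasFDerivWithinAt) (fun z hz => hb z ((hmem z hz).trans hn1)) hv hy
    exact this.trans (mul_le_mul_of_nonneg_left (hmem y hy) hB.le)
  have htay := hconv.norm_image_sub_le_of_norm_hasFDerivWithin_le'
    (f := f) (φ := InnerProductSpace.toDual ℝ (Vel 2) (f' v)) (C := B * ‖h‖)
    (fun z _ => (hf z).hasFDerivAt.hasFDerivWithinAt)
    (fun z hz => by rw [← map_sub, LinearIsometryEquiv.norm_map]; exact hlip z hz) hv hvh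
  rw [add_sub_cancel_left, InnerProductSpace.toDual_apply_apply, Real.norm_eq_abs] at htay
  have h1 := (abs_le.mp htay).2
  have h2 := h0 (v + h)
  have h3 : inner ℝ (f' v) h = -((2 * B)⁻¹ * ‖f' v‖ ^ 2) := by
    rw [hh, real_inner_smul_right, real_inner_self_eq_norm_sq]; ring
  -- at the minimum of the quadratic upper bound
  have h4 : B * ‖h‖ * ‖h‖ = (4 * B)⁻¹ * ‖f' v‖ ^ 2 := by rw [hn]; field_simp; ring
  have h5 : (2 * B)⁻¹ * ‖f' v‖ ^ 2 - (4 * B)⁻¹ * ‖f' v‖ ^ 2 = ‖f' v‖ ^ 2 / (4 * B) := by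
    field_simp; ring
  have h6 : ‖f' v‖ ^ 2 / (4 * B) ≤ f v := by rw [← h5]; rw [h3, h4] at h1; linarith
  rwa [div_le_iff₀ (by positivity), mul_comm] at h6

/-- The vector of the plane that represents a linear form. -/
def dualVec : (Vel 2 →L[ℝ] ℝ) →L[ℝ] Vel 2 :=
  ∑ i : Fin 2, (ContinuousLinearMap.apply ℝ ℝ (EuclideanSpace.single i (1 : ℝ) : Vel 2)).smulRight
    (EuclideanSpace.single i (1 : ℝ) : Vel 2)

theorem gradient_eq_dualVec {f : Vel 2 → ℝ} {v : Vel 2} (hf : DifferentiableAt ℝ f v) :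
    gradient f v = dualVec (fderiv ℝ f v) := by
  have h : ∀ y, fderiv ℝ f v y = inner ℝ (gradient f v) y := fun y => by
    rw [hf.hasGradientAt.hasFDerivAt.fderiv, InnerProductSpace.toDual_apply_apply]
  have h0 : ∀ φ : Vel 2 →L[ℝ] ℝ, dualVec φ 0 = φ (EuclideanSpace.single 0 1) := fun φ => by
    simp [dualVec, Fin.sum_univ_two]
  have h1 : ∀ φ : Vel 2 →L[ℝ] ℝ, dualVec φ 1 = φ (EuclideanSpace.single 1 1) := fun φ => by
    simp [dualVec, Fin.sum_univ_two]
  refine ext_two ?_ ?_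
  · rw [h0, h, inner_two]; simp
  · rw [h1, h, inner_two]; simp

theorem IsBoltzmannSolution.exists_densityBounds {B : Vel 2 → Sph 2 → ℝ} {T : ℝ}
    {f : ℝ → Vel 2 → ℝ} (hf : IsBoltzmannSolution B T f) :
    ∃ C, ∀ t ∈ Icc 0 T, DensityBounds C (f t) (gradient (f t))
      (fun v => dualVec.comp (fderiv ℝ (fderiv ℝ (f t)) v)) := by
  have hdecay : ∀ j ≤ 2, ∃ K, ∀ t ∈ Icc 0 T, ∀ v, ‖iteratedFDeriv ℝ j (f t) v‖ ≤ K * wt v := by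
    intro j hj
    obtain ⟨A, hA⟩ := hf.decay 0 j hj
    obtain ⟨B, hB⟩ := hf.decay 10 j hj
    refine ⟨16 * (A + B), fun t ht v => le_mul_wt_of_decay (norm_nonneg _) ?_ (hB t ht v)⟩
    simpa using hA t ht v
  obtain ⟨K₀, h₀⟩ := hdecay 0 (by norm_num)
  obtain ⟨K₁, h₁⟩ := hdecay 1 (by norm_num)
  obtain ⟨K₂, h₂⟩ := hdecay 2 le_rfl
  set L := ‖dualVec‖ with hL
  set K := 1 + |K₀| + |K₁| + L * |K₂| with hK
  have hL0 : 0 ≤ L := norm_nonneg dualVec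
  have hK1 : 1 ≤ K := by
    have := mul_nonneg hL0 (abs_nonneg K₂)
    linarith [abs_nonneg K₀, abs_nonneg K₁]
  refine ⟨972 * K, fun t ht => ?_⟩
  have hc := hf.contDiff t ht
  have hd : Differentiable ℝ (f t) := hc.differentiable (by norm_num)
  have hc1 : ContDiff ℝ 1 (fderiv ℝ (f t)) := hc.fderiv_right (by norm_num)
  have hgrad : ∀ v, HasGradientAt (f t) (gradient (f t) v) v := fun v => (hd v).hasGradientAt
  have hge : gradient (f t) = fun v => dualVec (fderiv ℝ (f t) v) :=
    funext fun v => gradient_eq_dualVec (hd v)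
  have hhess : ∀ v, HasFDerivAt (gradient (f t))
      (dualVec.comp (fderiv ℝ (fderiv ℝ (f t)) v)) v := fun v => by
    rw [hge]
    exact dualVec.hasFDerivAt.comp v (hc1.differentiable (by norm_num) v).hasFDerivAt
  have b0 : ∀ v, f t v ≤ K * wt v := fun v => by
    have := h₀ t ht v
    rw [norm_iteratedFDeriv_zero, Real.norm_of_nonneg (hf.nonneg t ht v)] at this
    refine this.trans (mul_le_mul_of_nonneg_right ?_ (wt_pos v).le)
    linarith [le_abs_self K₀, abs_nonneg K₁, mul_nonneg hL0 (abs_nonneg K₂)]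
  have b1 : ∀ v, ‖gradient (f t) v‖ ≤ K * wt v := fun v => by
    have := h₁ t ht v
    rw [norm_iteratedFDeriv_one, (hgrad v).hasFDerivAt.fderiv, LinearIsometryEquiv.norm_map] at this
    refine this.trans (mul_le_mul_of_nonneg_right ?_ (wt_pos v).le)
    linarith [le_abs_self K₁, abs_nonneg K₀, mul_nonneg hL0 (abs_nonneg K₂)]
  have b2 : ∀ v, ‖dualVec.comp (fderiv ℝ (fderiv ℝ (f t)) v)‖ ≤ K * wt v := fun v => by
    have h3 := h₂ t ht v
    have e : ‖iteratedFDeriv ℝ 2 (f t) v‖ = ‖fderiv ℝ (fderiv ℝ (f t)) v‖ := by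
      rw [← norm_iteratedFDeriv_one, norm_iteratedFDeriv_fderiv]
    rw [e] at h3
    refine (ContinuousLinearMap.opNorm_comp_le _ _).trans ?_
    calc L * ‖fderiv ℝ (fderiv ℝ (f t)) v‖ ≤ L * (|K₂| * wt v) := by
          refine mul_le_mul_of_nonneg_left (h3.trans ?_) hL0
          exact mul_le_mul_of_nonneg_right (le_abs_self _) (wt_pos v).le
      _ = L * |K₂| * wt v := by ring
      _ ≤ K * wt v := by
          refine mul_le_mul_of_nonneg_right ?_ (wt_pos v).le
          linarith [abs_nonneg K₀, abs_nonneg K₁]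
  have hup : ∀ {x : ℝ} {v : Vel 2}, x ≤ K * wt v → x ≤ 972 * K * wt v := fun {x v} hx => by
    have := mul_pos (zero_lt_one.trans_le hK1) (wt_pos v)
    linarith
  refine ⟨by linarith, hf.nonneg t ht, hgrad, hhess, ?_, fun v => hup (b0 v), fun v => hup (b1 v),
    fun v => hup (b2 v), fun v => ?_⟩
  · exact continuous_const.clm_comp (hc1.continuous_fderiv (by norm_num))
  · have hw := wt_pos v
    have := sq_norm_grad_le (B := K * (243 * wt v)) (v := v) (by positivity) hgrad hhess
      (hf.nonneg t ht) (fun y hy => (b2 y).trans ?_) ((b1 v).trans ?_)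
    · calc _ ≤ _ := this
        _ = _ := by ring
    · gcongr; exact wt_le_of_dist_le_one hy
    · nlinarith [mul_pos (zero_lt_one.trans_le hK1) hw]

/-! ### Monotonicity of the Fisher information -/

section

variable {C T : ℝ} {f : ℝ → Vel 2 → ℝ} {f' : ℝ → Vel 2 → Vel 2}
  {f'' : ℝ → Vel 2 → Vel 2 →L[ℝ] Vel 2}

/-- Solutions are Lipschitz continuous in time, with an integrable Lipschitz constant. -/
theorem abs_sub_le_of_solution (hf : IsBoltzmannSolution hsKernel T f)
    (hd : ∀ t ∈ Icc 0 T, DensityBounds C (f t) (f' t) (f'' t)) {s t : ℝ} (hs : s ∈ Icc 0 T)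
    (ht : t ∈ Icc 0 T) (v : Vel 2) :
    |f t v - f s v| ≤ (8 * Real.pi * C ^ 2 * ∫ w, intWt w) * intWt v * |t - s| :=
  (convex_Icc 0 T).norm_image_sub_le_of_norm_hasDerivWithin_le
    (fun x hx => hf.equation x hx v) (fun x hx => (hd x hx).abs_collision_le v) hs ht

variable {ε : ℝ}

theorem exists_lipschitz_regFisher (hf : IsBoltzmannSolution hsKernel T f)
    (hd : ∀ t ∈ Icc 0 T, DensityBounds C (f t) (f' t) (f'' t)) (hε : 0 < ε) (hε1 : ε ≤ 1) :
    ∃ K, ∀ s ∈ Icc 0 T, ∀ t ∈ Icc 0 T,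
      regFisher ε (f t) (f' t) - regFisher ε (f s) (f' s) ≤ K * |t - s| := by
  set Λ := 8 * Real.pi * C ^ 2 * ∫ w, intWt w with hΛ
  set M := 4 * (131 * C / ε + (131 * C / ε) ^ 2) + (131 * C / ε) ^ 2 with hM
  refine ⟨M * Λ * ∫ w, intWt w, fun s hs t ht => ?_⟩
  refine ((hd t ht).regFisher_sub_le (hd s hs) hε hε1).trans ?_
  have h1 := norm_integral_le_of_norm_le (integrable_intWt.const_mul (M * Λ * |t - s|))
    (f := fun v => fisherDeriv (score ε (f t) (f' t)) (scoreDeriv ε (f t) (f' t) (f'' t)) v *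
      (f t v - f s v)) (Filter.Eventually.of_forall fun v => ?_)
  · rw [integral_const_mul] at h1
    refine (le_abs_self _).trans (h1.trans_eq ?_)
    ring
  · have h2 := (hd t ht).abs_fisherDeriv_le hε hε1 v
    have h3 := abs_sub_le_of_solution hf hd hs ht v
    rw [Real.norm_eq_abs, abs_mul]
    calc _ ≤ M * (Λ * intWt v * |t - s|) :=
          mul_le_mul h2 h3 (abs_nonneg _) ((abs_nonneg _).trans h2)
      _ = _ := by ring

theorem continuousOn_regFisher (hf : IsBoltzmannSolution hsKernel T f)
    (hd : ∀ t ∈ Icc 0 T, DensityBounds C (f t) (f' t) (f'' t)) (hε : 0 < ε) (hε1 : ε ≤ 1) :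
    ContinuousOn (fun t => regFisher ε (f t) (f' t)) (Icc 0 T) := by
  obtain ⟨K, hK⟩ := exists_lipschitz_regFisher hf hd hε hε1
  have hL : LipschitzOnWith K.toNNReal (fun t => regFisher ε (f t) (f' t)) (Icc 0 T) := by
    refine LipschitzOnWith.of_dist_le_mul fun s hs t ht => ?_
    rw [Real.dist_eq, Real.dist_eq, Real.coe_toNNReal']
    have h1 := hK s hs t ht
    have h2 := hK t ht s hs
    rw [abs_sub_comm] at h1
    have h3 : K * |s - t| ≤ max K 0 * |s - t| :=
      mul_le_mul_of_nonneg_right (le_max_left _ _) (abs_nonneg _)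
    exact abs_le.mpr ⟨by linarith, by linarith⟩
  exact hL.continuousOn

/-- The left difference quotients of the regularised Fisher information are asymptotically bounded
by the error due to the regularisation. -/
theorem eventually_regFisher_slope_lt (hf : IsBoltzmannSolution hsKernel T f)
    (hd : ∀ t ∈ Icc 0 T, DensityBounds C (f t) (f' t) (f'' t)) (hε : 0 < ε) (hε1 : ε ≤ 1)
    {t : ℝ} (ht : t ∈ Ioc 0 T) {r : ℝ}
    (hr : 2 * Real.pi * (6 * (261 * C) * (60000 * C)) * regErr ε (f t) < r) :
    ∀ᶠ s in nhdsWithin t (Iio t),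
      (regFisher ε (f t) (f' t) - regFisher ε (f s) (f' s)) / (t - s) < r := by
  have htI : t ∈ Icc 0 T := ⟨ht.1.le, ht.2⟩
  set Φ := fisherDeriv (score ε (f t) (f' t)) (scoreDeriv ε (f t) (f' t) (f'' t)) with hΦ
  have hΦc : Continuous Φ := (hd t htI).continuous_fisherDeriv hε
  have hev : ∀ᶠ s in nhdsWithin t (Iio t), s ∈ Ico 0 t := Ico_mem_nhdsLT ht.1
  have hlim : Filter.Tendsto (fun s => ∫ v, Φ v * ((f t v - f s v) / (t - s)))
      (nhdsWithin t (Iio t)) (nhds (∫ v, Φ v * collision hsKernel (f t) v)) := by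
    set Λ := 8 * Real.pi * C ^ 2 * ∫ w, intWt w with hΛ
    set M := 4 * (131 * C / ε + (131 * C / ε) ^ 2) + (131 * C / ε) ^ 2 with hM
    refine tendsto_integral_filter_of_dominated_convergence (fun v => M * (Λ * intWt v)) ?_ ?_
      ((integrable_intWt.const_mul Λ).const_mul M) (Filter.Eventually.of_forall fun v => ?_)
    · filter_upwards [hev] with s hs
      have hsI : s ∈ Icc 0 T := ⟨hs.1, hs.2.le.trans ht.2⟩
      exact (hΦc.mul (((hd t htI).continuous.sub (hd s hsI).continuous).div_const
        _)).aestronglyMeasurable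
    · filter_upwards [hev] with s hs
      refine Filter.Eventually.of_forall fun v => ?_
      have hsI : s ∈ Icc 0 T := ⟨hs.1, hs.2.le.trans ht.2⟩
      have hts : 0 < t - s := sub_pos.mpr hs.2
      have h2 := (hd t htI).abs_fisherDeriv_le hε hε1 v
      have h3 := abs_sub_le_of_solution hf hd hsI htI v
      rw [abs_of_pos hts] at h3
      rw [Real.norm_eq_abs, abs_mul, abs_div, abs_of_pos hts]
      refine mul_le_mul h2 ?_ (by positivity) ((abs_nonneg _).trans h2)
      rwa [div_le_iff₀ hts]
    · have h1 := hasDerivWithinAt_iff_tendsto_slope.mp (hf.equation t htI v)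
      have h2 : nhdsWithin t (Iio t) ≤ nhdsWithin t (Icc 0 T \ {t}) := by
        refine nhdsWithin_le_of_mem ?_
        filter_upwards [hev] with s hs
        exact ⟨⟨hs.1, hs.2.le.trans ht.2⟩, hs.2.ne⟩
      have h3 := (h1.mono_left h2).const_mul (Φ v)
      refine h3.congr fun s => ?_
      rw [slope_def_field, ← neg_sub (f t v), ← neg_sub t s, neg_div_neg_eq]
  have hlt := hlim.eventually_lt_const
    (((hd t htI).integral_fisherDeriv_mul_collision_le hε hε1).trans_lt hr)
  filter_upwards [hlt, hev] with s h1 hs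
  have hsI : s ∈ Icc 0 T := ⟨hs.1, hs.2.le.trans ht.2⟩
  have hts : 0 < t - s := sub_pos.mpr hs.2
  refine lt_of_le_of_lt ?_ h1
  have h2 := (hd t htI).regFisher_sub_le (hd s hsI) hε hε1
  rw [div_le_iff₀ hts, ← integral_mul_const]
  refine h2.trans_eq (integral_congr_ae (Filter.Eventually.of_forall fun v => ?_))
  simp only [hΦ]
  field_simp

theorem continuousOn_regErr (hf : IsBoltzmannSolution hsKernel T f)
    (hd : ∀ t ∈ Icc 0 T, DensityBounds C (f t) (f' t) (f'' t)) (hε : 0 < ε) (hε1 : ε ≤ 1) :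
    ContinuousOn (fun t => regErr ε (f t)) (Icc 0 T) := by
  intro t ht
  refine tendsto_integral_filter_of_dominated_convergence
    (fun p => 2 * ((1 + ‖p.1 - p.2‖) * pairWt p)) ?_ ?_
    (integrable_one_add_dist_mul_pairWt.const_mul 2) (Filter.Eventually.of_forall fun p => ?_)
  · filter_upwards [self_mem_nhdsWithin] with s hs
    exact ((hd s hs).integrable_regErr hε hε1).aestronglyMeasurable
  · filter_upwards [self_mem_nhdsWithin] with s hs
    refine Filter.Eventually.of_forall fun p => ?_
    have hW := one_add_dist_mul_pairWt_nonneg p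
    rw [Real.norm_of_nonneg (mul_nonneg ((hd s hs).errDensity_nonneg hε _) hW)]
    exact mul_le_mul_of_nonneg_right ((hd s hs).errDensity_le hε hε1 _) hW
  · have hc : ContinuousWithinAt (fun s => f s p.1) (Icc 0 T) t :=
      (hf.equation t ht p.1).continuousWithinAt
    have h1 : ContinuousWithinAt (fun s => errDensity ε (f s) p.1) (Icc 0 T) t := by
      have h2 : ContinuousWithinAt (fun s => reg ε (f s) p.1) (Icc 0 T) t := hc.add_const _
      exact (((hc.mul_const _).const_mul ε).div (h2.pow 2)
        (pow_ne_zero 2 ((hd t ht).reg_pos hε p.1).ne')).const_add (Real.sqrt ε)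
    exact h1.mul_const _

/-- The increments of the regularised Fisher information are bounded by the time integral of the
error: the mean value inequality, in reversed time because of the left difference quotients. -/
theorem regFisher_sub_le_integral (hf : IsBoltzmannSolution hsKernel T f)
    (hd : ∀ t ∈ Icc 0 T, DensityBounds C (f t) (f' t) (f'' t)) (hε : 0 < ε) (hε1 : ε ≤ 1)
    {t₁ t₂ : ℝ} (h1 : 0 ≤ t₁) (h12 : t₁ ≤ t₂) (h2 : t₂ ≤ T) :
    regFisher ε (f t₂) (f' t₂) - regFisher ε (f t₁) (f' t₁) ≤
      2 * Real.pi * (6 * (261 * C) * (60000 * C)) *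
        ∫ σ in (0 : ℝ)..(t₂ - t₁), regErr ε (f (max 0 (min T (t₂ - σ)))) := by
  set K := 2 * Real.pi * (6 * (261 * C) * (60000 * C)) with hK
  set e : ℝ → ℝ := fun σ => regErr ε (f (max 0 (min T (t₂ - σ)))) with he
  have hT : 0 ≤ T := h1.trans (h12.trans h2)
  have hec : Continuous e := by
    have hmem : ∀ σ : ℝ, max 0 (min T (t₂ - σ)) ∈ Icc 0 T := fun σ =>
      ⟨le_max_left _ _, max_le hT (min_le_left _ _)⟩
    exact (continuousOn_regErr hf hd hε hε1).comp_continuous (by fun_prop) hmem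
  have hIc : ContinuousOn (fun τ => regFisher ε (f t₂) (f' t₂) -
      regFisher ε (f (t₂ - τ)) (f' (t₂ - τ))) (Icc 0 (t₂ - t₁)) := by
    refine continuousOn_const.sub ?_
    refine (continuousOn_regFisher hf hd hε hε1).comp (f := fun τ : ℝ => t₂ - τ)
      (by fun_prop) fun τ hτ => ?_
    exact ⟨by linarith [hτ.2], by linarith [hτ.1]⟩
  have hB : ∀ x, HasDerivAt (fun τ => K * ∫ σ in (0 : ℝ)..τ, e σ) (K * e x) x := fun x =>
    (intervalIntegral.integral_hasDerivAt_right (hec.intervalIntegrable _ _)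
      (hec.stronglyMeasurableAtFilter _ _) hec.continuousAt).const_mul K
  have key := image_le_of_liminf_slope_right_le_deriv_boundary hIc
    (B := fun τ => K * ∫ σ in (0 : ℝ)..τ, e σ) (B' := fun τ => K * e τ) (by simp)
    (fun x _ => (hB x).continuousAt.continuousWithinAt) (fun x _ => (hB x).hasDerivWithinAt) ?_
    (right_mem_Icc.mpr (sub_nonneg.mpr h12))
  · simpa only [sub_sub_cancel] using key
  · intro τ hτ r hr
    have ht : t₂ - τ ∈ Ioc 0 T := ⟨by linarith [hτ.2], by linarith [hτ.1]⟩
    have he' : e τ = regErr ε (f (t₂ - τ)) := by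
      simp only [he, min_eq_right ht.2, max_eq_right ht.1.le]
    rw [he'] at hr
    have hev := eventually_regFisher_slope_lt hf hd hε hε1 ht hr
    have htend : Filter.Tendsto (fun z : ℝ => t₂ - z) (nhdsWithin τ (Ioi τ))
        (nhdsWithin (t₂ - τ) (Iio (t₂ - τ))) := by
      refine tendsto_nhdsWithin_iff.mpr ⟨?_, ?_⟩
      · have : Continuous fun z : ℝ => t₂ - z := by fun_prop
        exact this.continuousAt.tendsto.mono_left nhdsWithin_le_nhds
      · filter_upwards [self_mem_nhdsWithin] with z hz
        have : τ < z := hz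
        simp only [mem_Iio]
        linarith
    refine (htend.eventually hev).frequently.mono fun z hz => ?_
    rw [slope_def_field]
    convert hz using 2 <;> ring

/-- The Fisher information of a solution is nonincreasing. -/
theorem antitoneOn_fisherInfo (hf : IsBoltzmannSolution hsKernel T f) :
    AntitoneOn (fun t => fisherInfo (f t)) (Icc 0 T) := by
  obtain ⟨C, hd⟩ := hf.exists_densityBounds
  intro t₁ h₁ t₂ h₂ h12
  simp only [(hd t₁ h₁).fisherInfo_eq, (hd t₂ h₂).fisherInfo_eq]
  refine ENNReal.ofReal_le_ofReal ?_
  have hev : ∀ᶠ ε : ℝ in nhdsWithin 0 (Ioi 0), 0 < ε ∧ ε ≤ 1 := Ioc_mem_nhdsGT one_pos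
  have hlhs := (hd t₂ h₂).tendsto_regFisher.sub (hd t₁ h₁).tendsto_regFisher
  have hT : 0 ≤ T := h₁.1.trans h₁.2
  have hmem : ∀ σ : ℝ, max 0 (min T (t₂ - σ)) ∈ Icc 0 T := fun σ =>
    ⟨le_max_left _ _, max_le hT (min_le_left _ _)⟩
  have hint : Filter.Tendsto (fun ε => ∫ σ in (0 : ℝ)..(t₂ - t₁),
      regErr ε (f (max 0 (min T (t₂ - σ))))) (nhdsWithin 0 (Ioi 0))
      (nhds (∫ _ in (0 : ℝ)..(t₂ - t₁), (0 : ℝ))) := by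
    refine intervalIntegral.tendsto_integral_filter_of_dominated_convergence
      (fun _ => 2 * ∫ p : Vel 2 × Vel 2, (1 + ‖p.1 - p.2‖) * pairWt p) ?_ ?_
      (by simp) (Filter.Eventually.of_forall fun σ _ => (hd _ (hmem σ)).tendsto_regErr)
    · filter_upwards [hev] with ε hε
      have hc : Continuous fun σ => regErr ε (f (max 0 (min T (t₂ - σ)))) :=
        (continuousOn_regErr hf hd hε.1 hε.2).comp_continuous (by fun_prop) hmem
      exact hc.aestronglyMeasurable
    · filter_upwards [hev] with ε hε
      refine Filter.Eventually.of_forall fun σ _ => ?_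
      rw [Real.norm_of_nonneg ((hd _ (hmem σ)).regErr_nonneg hε.1)]
      exact (hd _ (hmem σ)).regErr_le hε.1 hε.2
  have hrhs := hint.const_mul (2 * Real.pi * (6 * (261 * C) * (60000 * C)))
  rw [intervalIntegral.integral_zero, mul_zero] at hrhs
  have := le_of_tendsto_of_tendsto hlhs hrhs (by
    filter_upwards [hev] with ε hε
    exact regFisher_sub_le_integral hf hd hε.1 hε.2 h₁.1 h12 h₂.2)
  linarith

end

end KineticFisher

end

open KineticFisher
theorem mainTheorem6 (r : ℕ∞) (hr : 1 ≤ r) :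
    -- (i) finitely supported angular measures on the circle
    (∀ (N : ℕ) (b : ℕ → ℝ≥0), 0 < ∑ i ∈ Finset.Ico 1 N, b i →
      critInf (linBoltzAngular (angularSum N b)) r = 0 ∧
      ∀ K : ℝ, 0 < K → ¬ ∀ F : Sph 2 → ℝ, IsEvenDensity r F →
        critDen (linBoltzAngular (angularSum N b)) F
          ≤ 1 / K * critNum (linBoltzAngular (angularSum N b)) F) ∧
    -- (ii) constant kernels, in any dimension
    (∀ (d : ℕ) (c : ℝ), 2 ≤ d → 0 < c →
      ((4 * (d : ℝ) : ℝ) : EReal) ≤ critInf (linBoltz (d := d) (fun _ => c)) r) ∧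
    -- (iii) hard spheres in dimension two
    ((4 * Real.sqrt 2 : ℝ) : EReal) ≤ critInf (linBoltz (d := 2) hsSym) r ∧
    (∀ (T : ℝ) (f : ℝ → Vel 2 → ℝ), 0 < T → IsBoltzmannSolution hsKernel T f →
      AntitoneOn (fun t => fisherInfo (f t)) (Set.Icc 0 T)) := by
  refine ⟨fun N b hb => ⟨critInf_angularSum hr hb, fun K hK => not_forall_critDen_le hb hK⟩,
    fun d c hd hc => le_critInf_const (by omega) hr hc, le_critInf_hsSym hr, fun T f hT hf => ?_⟩
  exact antitoneOn_fisherInfo hf
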